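/- **Setting.** Let $n\ge 1$. All maps are germs at $0$ of holomorphic maps, and $\mathrm{Diff}(\mathbb C^k,0)$ is the group of germs of biholomorphisms of $(\mathbb C^k,0)$. A *Morse function* on $(\mathbb C^n,0)$ is a germ $f$ with $f(0)=0$, $df(0)=0$ and non-degenerate Hessian at $0$. A map $\Phi=(f,g):(\mathbb C^n,0)\to(\mathbb C^2,0)$ is *$\mathscr A$-generic* if $f,g$ are Morse functions whose quadratic parts are, after one linear change of coordinates, $\sum_i x_i^2$ and $\sum_i\lambda_i x_i^2$ with pairwise distinct $\lambda_i$. Two maps $\Phi_1,\Phi_2$ are *$\mathscr A$-conjugated* if $\Phi_2=\psi\circ\Phi_1\circ\varphi^{-1}$ for some $\varphi\in\mathrm{Diff}(\mathbb C^n,0)$ and $\psi\in\mathrm{Diff}(\mathbb C^2,0)$. The *tangency curves* $T_i$ of $\Phi$ are the irreducible components of the germ at $0$ of the common zero set of all $\partial_if\,\partial_jg-\partial_jf\,\partial_ig$. A *$\sigma$-curve* in $(\mathbb C^2,0)$ is a class $[\sigma]$ of non-constant germs $\sigma:(\mathbb C,0)\to(\mathbb C^2,0)$ modulo $\sigma\sim\sigma\circ\phi$,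 $\phi\in\mathrm{Diff}(\mathbb C,0)$. If $\sigma(t)=(at^m+\dots,bt^m+\dots)$ with $(a,b)\ne(0,0)$, its *$\sigma$-multiplicity* is $m$ and its *tangent cone* is the line $\mathbb C(a,b)$. A diffeomorphism $\psi\in\mathrm{Diff}(\mathbb C^2,0)$ acts by $\psi\cdot[\sigma]=[\psi\circ\sigma]$. If $T$ is a smooth curve with regular parametrization $\tau$ and $\Phi\circ\tau$ is non-constant, then $\Phi(T)$ denotes the $\sigma$-curve $[\Phi\circ\tau]$. **Theorem.** 1. If $\Phi$ is $\mathscr A$-generic, or more generally $\mathscr A$-conjugated to an $\mathscr A$-generic map, then it has exactly $n$ tangency curves $T_1,\dots,T_n$; they are smooth, and $\Phi$ is non-constant on each of them, so that the $\sigma$-curves $\Phi(T_1),\dots,\Phi(T_n)$ are defined. 2. Two $\mathscr A$-generic maps $\Phi_1,\Phi_2:(\mathbb C^n,0)\to(\mathbb C^2,0)$, with tangency curves $T_i^1$ and $T_i^2$, are $\mathscr A$-conjugated if and only if there is $\psi\in\mathrm{Diff}(\mathbb C^2,0)$ which maps the set of $\sigma$-curves $\{\Phi_1(T^1_i)\}_{i\le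 n}$ onto the set $\{\Phi_2(T^2_i)\}_{i\le n}$. The same holds for two maps that are $\mathscr A$-conjugated to $\mathscr A$-generic maps. 3. Let $C_1,\dots,C_n$ be $\sigma$-curves in $(\mathbb C^2,0)$ of $\sigma$-multiplicity $2$ with pairwise distinct tangent cones. Then there is a map $\Phi:(\mathbb C^n,0)\to(\mathbb C^2,0)$, $\mathscr A$-conjugated to an $\mathscr A$-generic map, whose tangency curves can be numbered $T_1,\dots,T_n$ in such a way that $\Phi(T_i)=C_i$ for all $i$. If moreover no tangent cone of a $C_i$ is one of the two coordinate axes of $\mathbb C^2$, then there is such a $\Phi$ which is $\mathscr A$-generic (in particular its components are Morse functions). -/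

import Mathlib

open Filter Topology

noncomputable section

/-- A germ of (holomorphic) diffeomorphism of `(E, 0)`, given by a representative together with a
representative of the inverse germ. -/
structure DiffGerm (E : Type*) [NormedAddCommGroup E] [NormedSpace ℂ E] where
  toFun : E → E
  invFun : E → E
  analytic_toFun : AnalyticAt ℂ toFun 0
  analytic_invFun : AnalyticAt ℂ invFun 0
  toFun_zero : toFun 0 = 0
  invFun_zero : invFun 0 = 0
  left_inv : ∀ᶠ x in 𝓝 (0 : E), invFun (toFun x) = x
  right_inv : ∀ᶠ x in 𝓝 (0 : E), toFun (invFun x) = x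

namespace DiffGerm

variable {E : Type*} [NormedAddCommGroup E] [NormedSpace ℂ E]

theorem tendsto_toFun (φ : DiffGerm E) : Tendsto φ.toFun (𝓝 0) (𝓝 0) := by
  simpa [φ.toFun_zero] using φ.analytic_toFun.continuousAt.tendsto

theorem tendsto_invFun (φ : DiffGerm E) : Tendsto φ.invFun (𝓝 0) (𝓝 0) := by
  simpa [φ.invFun_zero] using φ.analytic_invFun.continuousAt.tendsto

/-- The identity germ. -/
def refl (E : Type*) [NormedAddCommGroup E] [NormedSpace ℂ E] : DiffGerm E where
  toFun := id
  invFun := id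
  analytic_toFun := analyticAt_id
  analytic_invFun := analyticAt_id
  toFun_zero := rfl
  invFun_zero := rfl
  left_inv := Eventually.of_forall fun _ => rfl
  right_inv := Eventually.of_forall fun _ => rfl

/-- The inverse germ. -/
def symm (φ : DiffGerm E) : DiffGerm E where
  toFun := φ.invFun
  invFun := φ.toFun
  analytic_toFun := φ.analytic_invFun
  analytic_invFun := φ.analytic_toFun
  toFun_zero := φ.invFun_zero
  invFun_zero := φ.toFun_zero
  left_inv := φ.right_inv
  right_inv := φ.left_inv

/-- The composed germ `φ ∘ χ`. -/
def comp (φ χ : DiffGerm E) : DiffGerm E where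
  toFun := fun x => φ.toFun (χ.toFun x)
  invFun := fun x => χ.invFun (φ.invFun x)
  analytic_toFun := AnalyticAt.fun_comp (by rw [χ.toFun_zero]; exact φ.analytic_toFun)
    χ.analytic_toFun
  analytic_invFun := AnalyticAt.fun_comp (by rw [φ.invFun_zero]; exact χ.analytic_invFun)
    φ.analytic_invFun
  toFun_zero := by rw [χ.toFun_zero, φ.toFun_zero]
  invFun_zero := by rw [φ.invFun_zero, χ.invFun_zero]
  left_inv := by
    filter_upwards [χ.tendsto_toFun.eventually φ.left_inv, χ.left_inv] with x h1 h2
    rw [h1, h2]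
  right_inv := by
    filter_upwards [φ.tendsto_invFun.eventually χ.right_inv, φ.right_inv] with x h1 h2
    rw [h1, h2]

theorem deriv_ne_zero (φ : DiffGerm ℂ) : deriv φ.toFun 0 ≠ 0 := by
  intro h
  have h1 : HasDerivAt φ.toFun 0 0 := by
    simpa only [h] using φ.analytic_toFun.differentiableAt.hasDerivAt
  have h2 : HasDerivAt φ.invFun (deriv φ.invFun 0) (φ.toFun 0) := by
    rw [φ.toFun_zero]; exact φ.analytic_invFun.differentiableAt.hasDerivAt
  have h3 := h2.comp (0 : ℂ) h1
  have h4 : HasDerivAt (id : ℂ → ℂ) (deriv φ.invFun 0 * 0) 0 :=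
    h3.congr_of_eventuallyEq (by filter_upwards [φ.left_inv] with x hx using hx.symm)
  simpa using h4.unique (hasDerivAt_id (0 : ℂ))

end DiffGerm

/-! ### Parametrized curves and `σ`-curves in `(ℂ², 0)` -/

/-- A parametrized irreducible curve in `(ℂ², 0)`: a non-constant holomorphic germ
`σ : (ℂ, 0) → (ℂ², 0)`. The underlying irreducible curve `Γ` is the germ of the image of `σ`. -/
structure ParamCurve where
  toFun : ℂ → ℂ × ℂ
  analytic : AnalyticAt ℂ toFun 0
  map_zero : toFun 0 = 0
  nonconst : ¬ ∀ᶠ t in 𝓝 (0 : ℂ), toFun t = 0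

/-- `σ`-equivalence: `σ₁ ∘ φ = σ₂` as germs, for a diffeomorphism `φ` of `(ℂ, 0)`
(in particular the two images are then the same germ of curve). -/
def SigmaEquiv (σ₁ σ₂ : ParamCurve) : Prop :=
  ∃ φ : DiffGerm ℂ, ∀ᶠ t in 𝓝 (0 : ℂ), σ₁.toFun (φ.toFun t) = σ₂.toFun t

instance sigmaSetoid : Setoid ParamCurve where
  r := SigmaEquiv
  iseqv :=
    { refl := fun _ => ⟨DiffGerm.refl ℂ, Eventually.of_forall fun _ => rfl⟩
      symm := by
        rintro σ₁ σ₂ ⟨φ, h⟩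
        refine ⟨φ.symm, ?_⟩
        filter_upwards [φ.tendsto_invFun.eventually h, φ.right_inv] with t h1 h2
        rw [h2] at h1
        exact h1.symm
      trans := by
        rintro σ₁ σ₂ σ₃ ⟨φ, h⟩ ⟨χ, h'⟩
        refine ⟨φ.comp χ, ?_⟩
        filter_upwards [χ.tendsto_toFun.eventually h, h'] with t h1 h2
        exact h1.trans h2 }

/-- A `σ`-curve: a `σ`-equivalence class of parametrized irreducible curves in `(ℂ², 0)`. -/
def SigmaCurve : Type := Quotient sigmaSetoid

namespace SigmaCurve

/-- The `σ`-multiplicity of a `σ`-curve: the integer `m` such that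
`σ(t) = (a t ^ m + …, b t ^ m + …)` with `(a, b) ≠ (0, 0)`. -/
def multiplicity : SigmaCurve → ℕ :=
  Quotient.lift (fun σ : ParamCurve => analyticOrderNatAt σ.toFun 0) (by
    rintro σ₁ σ₂ ⟨φ, h⟩
    have h1 : analyticOrderAt (σ₁.toFun ∘ φ.toFun) 0 = analyticOrderAt σ₂.toFun 0 :=
      analyticOrderAt_congr h
    rw [analyticOrderAt_comp_of_deriv_ne_zero φ.analytic_toFun φ.deriv_ne_zero,
      φ.toFun_zero] at h1
    simp only [analyticOrderNatAt, h1])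

/-- The tangent cone at `0` of a `σ`-curve `C` of `σ`-multiplicity `m`: the line spanned by
`(a, b)`, if `σ(t) = (a t ^ m + …, b t ^ m + …)` parametrizes `C`. -/
def tangentCone (C : SigmaCurve) : Submodule ℂ (ℂ × ℂ) :=
  Submodule.span ℂ {v | ∃ σ : ParamCurve, (⟦σ⟧ : Quotient sigmaSetoid) = C ∧
    Tendsto (fun t : ℂ => (t ^ C.multiplicity)⁻¹ • σ.toFun t) (𝓝[≠] 0) (𝓝 v)}

end SigmaCurve

/-- The parametrized curve `ψ ∘ σ`. -/
def ParamCurve.map (ψ : DiffGerm (ℂ × ℂ)) (σ : ParamCurve) : ParamCurve where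
  toFun := fun t => ψ.toFun (σ.toFun t)
  analytic := AnalyticAt.fun_comp (by rw [σ.map_zero]; exact ψ.analytic_toFun) σ.analytic
  map_zero := by rw [σ.map_zero, ψ.toFun_zero]
  nonconst := by
    intro h
    apply σ.nonconst
    have hσ : Tendsto σ.toFun (𝓝 0) (𝓝 0) := by
      simpa [σ.map_zero] using σ.analytic.continuousAt.tendsto
    filter_upwards [h, hσ.eventually ψ.left_inv] with t h1 h2
    rw [← h2, h1, ψ.invFun_zero]

/-- The action of diffeomorphisms of `(ℂ², 0)` on `σ`-curves, `ψ · [σ] = [ψ ∘ σ]`. -/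
def SigmaCurve.map (ψ : DiffGerm (ℂ × ℂ)) : SigmaCurve → SigmaCurve :=
  Quotient.map (ParamCurve.map ψ) (by
    rintro σ₁ σ₂ ⟨φ, h⟩
    refine ⟨φ, ?_⟩
    filter_upwards [h] with t ht
    exact congrArg ψ.toFun ht)

/-! ### Morse functions and generic pairs -/

section Morse

variable {n : ℕ}

/-- The Hessian of `f` at `0`, as a bilinear form. -/
def hessianAtZero (f : (Fin n → ℂ) → ℂ) (u v : Fin n → ℂ) : ℂ :=
  fderiv ℂ (fderiv ℂ f) 0 u v

/-- The quadratic part of `f` at `0`. -/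
def quadraticPart (f : (Fin n → ℂ) → ℂ) (x : Fin n → ℂ) : ℂ :=
  (1 / 2 : ℂ) * hessianAtZero f x x

/-- `f` is a Morse function on `(ℂⁿ, 0)`, vanishing at `0`: a holomorphic germ with a
non-degenerate critical point at `0`. -/
structure IsMorse (f : (Fin n → ℂ) → ℂ) : Prop where
  analytic : AnalyticAt ℂ f 0
  map_zero : f 0 = 0
  critical : fderiv ℂ f 0 = 0
  nondegenerate : ∀ u, (∀ v, hessianAtZero f u v = 0) → u = 0

/-- A pair of Morse functions is `R`-generic if, up to a linear isomorphism, the quadratic parts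
are `∑ xᵢ²` and `∑ lᵢ xᵢ²` with pairwise distinct `lᵢ`. -/
structure IsRGeneric (f g : (Fin n → ℂ) → ℂ) : Prop where
  morse_left : IsMorse f
  morse_right : IsMorse g
  diagonal : ∃ (L : (Fin n → ℂ) ≃ₗ[ℂ] (Fin n → ℂ)) (l : Fin n → ℂ), Function.Injective l ∧
    ∀ x, quadraticPart f (L x) = ∑ i, x i ^ 2 ∧ quadraticPart g (L x) = ∑ i, l i * x i ^ 2

/-- `Φ : (ℂⁿ, 0) → (ℂ², 0)` is `A`-generic if its pair of components is `R`-generic. -/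
def IsAGeneric (Φ : (Fin n → ℂ) → ℂ × ℂ) : Prop :=
  IsRGeneric (fun x => (Φ x).1) (fun x => (Φ x).2)

/-- `A`-conjugacy: `Φ₂ = ψ ∘ Φ₁ ∘ φ⁻¹` as germs at `0`, for diffeomorphisms `φ` of `(ℂⁿ, 0)` and
`ψ` of `(ℂ², 0)`. -/
def AConjugate (Φ₁ Φ₂ : (Fin n → ℂ) → ℂ × ℂ) : Prop :=
  ∃ (φ : DiffGerm (Fin n → ℂ)) (ψ : DiffGerm (ℂ × ℂ)),
    ∀ᶠ x in 𝓝 (0 : Fin n → ℂ), ψ.toFun (Φ₁ (φ.invFun x)) = Φ₂ x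

/-- `Φ` is `A`-conjugated to an `A`-generic map. -/
def IsAConjugateToGeneric (Φ : (Fin n → ℂ) → ℂ × ℂ) : Prop :=
  ∃ Φ₀, IsAGeneric Φ₀ ∧ AConjugate Φ₀ Φ

/-! ### The tangency locus and its irreducible components -/

/-- The tangency locus of the components `f, g` of `Φ`: the common zeros of all
`∂ᵢf ∂ⱼg - ∂ⱼf ∂ᵢg`. Only its germ at `0` matters. -/
def tangencyLocus (Φ : (Fin n → ℂ) → ℂ × ℂ) : Set (Fin n → ℂ) :=
  {x | ∀ i j : Fin n,
    fderiv ℂ (fun y => (Φ y).1) x (Pi.single i 1) * fderiv ℂ (fun y => (Φ y).2) x (Pi.single j 1)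
      - fderiv ℂ (fun y => (Φ y).1) x (Pi.single j 1)
        * fderiv ℂ (fun y => (Φ y).2) x (Pi.single i 1) = 0}

/-- The germ of `X` at `0` is analytic: the zero set of finitely many holomorphic germs. -/
def IsAnalyticGerm (X : Set (Fin n → ℂ)) : Prop :=
  ∃ (k : ℕ) (h : Fin k → (Fin n → ℂ) → ℂ), (∀ j, AnalyticAt ℂ (h j) 0) ∧
    ∀ᶠ x in 𝓝 (0 : Fin n → ℂ), (x ∈ X ↔ ∀ j, h j x = 0)

/-- `X` and `Y` have the same germ at `0`. -/
def GermEq (X Y : Set (Fin n → ℂ)) : Prop :=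
  ∀ᶠ x in 𝓝 (0 : Fin n → ℂ), (x ∈ X ↔ x ∈ Y)

/-- The germ of `X` at `0` is contained in that of `Y`. -/
def GermLE (X Y : Set (Fin n → ℂ)) : Prop :=
  ∀ᶠ x in 𝓝 (0 : Fin n → ℂ), (x ∈ X → x ∈ Y)

/-- The germ of `X` at `0` is an irreducible analytic germ: it is analytic, non-empty and not the
union of two smaller analytic germs. -/
structure IsIrreducibleGerm (X : Set (Fin n → ℂ)) : Prop where
  analytic : IsAnalyticGerm X
  zero_mem : (0 : Fin n → ℂ) ∈ X
  irreducible : ∀ A B : Set (Fin n → ℂ), IsAnalyticGerm A → IsAnalyticGerm B →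
    GermEq X (A ∪ B) → GermEq X A ∨ GermEq X B

/-- The germ of `X` is an irreducible component of the germ of `Z` at `0`: a maximal irreducible
analytic germ contained in that of `Z`. -/
structure IsComponentGerm (X Z : Set (Fin n → ℂ)) : Prop where
  irreducible : IsIrreducibleGerm X
  le : GermLE X Z
  maximal : ∀ Y, IsIrreducibleGerm Y → GermLE X Y → GermLE Y Z → GermEq Y X

/-- `τ` is a regular parametrization of the germ of `X` at `0`, which is hence a smooth curve:
`τ` is an immersion germ, and the germ of its image is that of `X`. -/
structure IsRegularParam (τ : ℂ → (Fin n → ℂ)) (X : Set (Fin n → ℂ)) : Prop where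
  analytic : AnalyticAt ℂ τ 0
  map_zero : τ 0 = 0
  immersion : deriv τ 0 ≠ 0
  mem : ∀ᶠ t in 𝓝 (0 : ℂ), τ t ∈ X
  surj : ∀ U ∈ 𝓝 (0 : ℂ), ∀ᶠ x in 𝓝 (0 : Fin n → ℂ), x ∈ X → x ∈ τ '' U

/-- `C` is the `σ`-curve `Φ(T)`, i.e. the class of `Φ ∘ τ`, where `τ` is a regular
parametrization of `T`. -/
def IsImageCurve (Φ : (Fin n → ℂ) → ℂ × ℂ) (τ : ℂ → (Fin n → ℂ)) (C : SigmaCurve) : Prop :=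
  ∃ σ : ParamCurve, (⟦σ⟧ : Quotient sigmaSetoid) = C ∧
    ∀ᶠ t in 𝓝 (0 : ℂ), σ.toFun t = Φ (τ t)

/-- The set `{Φ(Tᵢ)}` of `σ`-curves of `Φ`, where the `Tᵢ` are the tangency curves, i.e. the
irreducible components of the tangency locus. -/
def tangencySigmaCurves (Φ : (Fin n → ℂ) → ℂ × ℂ) : Set SigmaCurve :=
  {C | ∃ (T : Set (Fin n → ℂ)) (τ : ℂ → (Fin n → ℂ)),
    IsComponentGerm T (tangencyLocus Φ) ∧ IsRegularParam τ T ∧ IsImageCurve Φ τ C}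

/-- The irreducible components of the tangency locus of `Φ` are exactly `n` smooth curves, and
they can be numbered `T₁, …, Tₙ` in such a way that `Φ(Tᵢ) = Cᵢ` for every `i`. -/
def HasTangencySigmaCurves (Φ : (Fin n → ℂ) → ℂ × ℂ) (C : Fin n → SigmaCurve) : Prop :=
  ∃ (T : Fin n → Set (Fin n → ℂ)) (τ : Fin n → ℂ → (Fin n → ℂ)),
    (∀ i, IsComponentGerm (T i) (tangencyLocus Φ)) ∧
    (∀ X, IsComponentGerm X (tangencyLocus Φ) → ∃! i, GermEq X (T i)) ∧
    (∀ i, IsRegularParam (τ i) (T i)) ∧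
    ∀ i, IsImageCurve Φ (τ i) (C i)

end Morse

end

/-! Up to a change of coordinates in the source, each of these maps is a sum `separatedMap g` of
one-variable germs γ_i(x_i), where γ_i(t) = t² g_i(t) and the vectors g_i(0) ∈ ℂ² are pairwise
independent (`IsSeparated`). For such a sum everything is visible. The minors of the differential
are x_i x_j times units for i ≠ j, so the tangency curves are the n axes, and the i-th axis is sent
to the σ-curve [γ_i].

Conversely, the σ-curves [γ_i] determine the sum up to a source diffeomorphism: reparametrizing γ_i
is a change of the single coordinate x_i, and renumbering is a permutation of coordinates
(`IsSeparated.exists_conjugate`). A diffeomorphism of the target preserves the class of separated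
sums up to a source change (`IsSeparated.exists_comp`), so the classification reduces to two maps
with the same set of σ-curves. For the realization, a σ-curve of multiplicity 2 is t² g(t) with g(0)
spanning its tangent cone, so the sum of the given curves is separated. It is generic when no cone
is a coordinate axis, and becomes generic after a suitable linear change of the target in any case.

The core is `exists_normal_form`, for Φ with zero differential at 0 and diagonal Hessian with
entries 2v_i, the v_i pairwise independent. The implicit function theorem gives a curve tangent to
each axis along which all partial derivatives of Φ are multiples of the i-th one
(`exists_tangency_curve`). A diffeomorphism straightens these curves to the axes and makes the
transverse derivatives vanish there (`exists_straightening`). Then Φ differs from a separated sum by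
a germ vanishing to second order along all axes, that is, by an element of the ideal generated by
the x_i² x_j² and x_i x_j x_k (`exists_sum_axisMonomial`). Finally x is displaced by a vector built
from these monomials divided by x_i or x_j. Each monomial carries two unknown functions, exactly
enough to produce a vector of ℂ² from the independent g_i(0), g_j(0), and one application of the
implicit function theorem absorbs the whole remainder (`exists_diffGerm_of_axis_remainder`). -/

noncomputable section

/-! ### Analytic division, implicit functions and local inverses. -/

section Tools

variable {E F : Type*} [NormedAddCommGroup E] [NormedSpace ℂ E] [NormedAddCommGroup F]
  [NormedSpace ℂ F]

/-- The multilinear terms of the difference quotient of a power series. -/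
def quotientTerm (p : FormalMultilinearSeries ℂ E F) (m : ℕ) (k : Fin (m + 1)) :
    ContinuousMultilinearMap ℂ (fun _ : Fin m => E × E) (E →L[ℂ] F) :=
  (ContinuousLinearMap.flipMultilinear ((p (m + 1)).curryMid k)).compContinuousLinearMap
    (fun i => if k ≤ i.castSucc then ContinuousLinearMap.fst ℂ E E else
      ContinuousLinearMap.snd ℂ E E)

theorem norm_quotientTerm_le (p : FormalMultilinearSeries ℂ E F) (m : ℕ) (k : Fin (m + 1)) :
    ‖quotientTerm p m k‖ ≤ ‖p (m + 1)‖ := by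
  refine (ContinuousMultilinearMap.norm_compContinuousLinearMap_le _ _).trans ?_
  have h1 : ‖ContinuousLinearMap.flipMultilinear ((p (m + 1)).curryMid k)‖ ≤ ‖p (m + 1)‖ := by
    refine (ContinuousMultilinearMap.opNorm_le_bound (by positivity) fun z => ?_)
    refine ContinuousLinearMap.opNorm_le_bound _ (by positivity) fun w => ?_
    simp only [ContinuousLinearMap.flipMultilinear_apply_apply,
      ContinuousMultilinearMap.curryMid_apply]
    refine ((p (m + 1)).le_opNorm _).trans (le_of_eq ?_)
    rw [Fin.prod_univ_succAbove _ k]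
    simp
    ring
  have h2 : ∏ i : Fin m, ‖(if k ≤ i.castSucc then ContinuousLinearMap.fst ℂ E E else
      ContinuousLinearMap.snd ℂ E E)‖ ≤ 1 := by
    refine Finset.prod_le_one (fun _ _ => norm_nonneg _) fun i _ => ?_
    split_ifs
    · exact ContinuousLinearMap.norm_fst_le ..
    · exact ContinuousLinearMap.norm_snd_le ..
  calc _ ≤ ‖p (m + 1)‖ * 1 := by gcongr
    _ = _ := mul_one _

/-- The power series of the difference quotient of a power series. -/
def quotientSeries (p : FormalMultilinearSeries ℂ E F) :
    FormalMultilinearSeries ℂ (E × E) (E →L[ℂ] F) :=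
  fun m => ∑ k : Fin (m + 1), quotientTerm p m k

/-- Telescoping: the k-th term has `z.2` in the slots before k, the increment in slot k and `z.1`
after it. It is thus the difference of the values of `p (m + 1)` with k + 1 and with k slots filled
by `z.2`. -/
theorem quotientSeries_apply (p : FormalMultilinearSeries ℂ E F) (m : ℕ) (z : E × E) :
    quotientSeries p m (fun _ => z) (z.2 - z.1) =
      p (m + 1) (fun _ => z.2) - p (m + 1) (fun _ => z.1) := by
  have hterm : ∀ k : Fin (m + 1), quotientTerm p m k (fun _ => z) (z.2 - z.1) =
      p (m + 1) (fun i => if (i : ℕ) < k + 1 then z.2 else z.1) -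
        p (m + 1) (fun i => if (i : ℕ) < k then z.2 else z.1) := by
    intro k
    have e0 : ∀ w : E, (k.insertNth w (fun i : Fin m => if k ≤ i.castSucc then z.1 else z.2) :
        Fin (m + 1) → E) = Function.update (fun i : Fin (m + 1) => if (i : ℕ) < k then z.2 else z.1) k w := by
      intro w
      ext i
      refine Fin.succAboveCases k ?_ (fun i => ?_) i
      · simp
      · have hne : k.succAbove i ≠ k := Fin.succAbove_ne k i
        rw [Fin.insertNth_apply_succAbove, Function.update_of_ne hne]
        by_cases h : k ≤ i.castSucc
        · have : (k : ℕ) ≤ i := h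
          rw [if_pos h, Fin.succAbove_of_le_castSucc _ _ h, if_neg (by simp; omega)]
        · have : (i : ℕ) < k := by simpa [Fin.le_def] using h
          rw [if_neg h, Fin.succAbove_of_castSucc_lt _ _ (not_le.1 h), if_pos (by simpa using this)]
    have e1 : quotientTerm p m k (fun _ => z) (z.2 - z.1) =
        p (m + 1) (k.insertNth (z.2 - z.1) (fun i : Fin m => if k ≤ i.castSucc then z.1 else z.2)) := by
      simp only [quotientTerm, ContinuousMultilinearMap.compContinuousLinearMap_apply,
        ContinuousLinearMap.flipMultilinear_apply_apply, ContinuousMultilinearMap.curryMid_apply]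
      congr 2
      ext i
      split_ifs <;> rfl
    rw [e1, e0, ContinuousMultilinearMap.map_update_sub]
    congr 2
    · ext i
      by_cases h : i = k
      · subst h; simp
      · rw [Function.update_of_ne h]
        have : (i : ℕ) ≠ k := fun h' => h (Fin.ext h')
        congr 1
        simp only [eq_iff_iff]; omega
    · ext i
      by_cases h : i = k
      · subst h; simp
      · rw [Function.update_of_ne h]
  simp only [quotientSeries, _root_.sum_apply, hterm]
  rw [Fin.sum_univ_eq_sum_range (fun k => p (m + 1) (fun i => if (i : ℕ) < k + 1 then z.2 else z.1) -
        p (m + 1) (fun i => if (i : ℕ) < k then z.2 else z.1)), Finset.sum_range_sub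
        (fun k => p (m + 1) (fun i => if (i : ℕ) < k then z.2 else z.1))]
  simp [Fin.is_le]

/-- The m-th coefficient is a sum of m + 1 ≤ 2^m terms bounded by C r^(m+1), which is why the radius
(2r)⁻¹ works. -/
theorem quotientSeries_radius_pos (p : FormalMultilinearSeries ℂ E F) (hp : 0 < p.radius) :
    0 < (quotientSeries p).radius := by
  obtain ⟨C, r, hC, hr, hb⟩ := p.le_mul_pow_of_radius_pos hp
  have hr' : (0 : ℝ) < (2 * r)⁻¹ := by positivity
  have key : ∀ m, ‖quotientSeries p m‖ * ((⟨(2 * r)⁻¹, hr'.le⟩ : NNReal) : ℝ) ^ m ≤ C * r := by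
    intro m
    have h1 : ‖quotientSeries p m‖ ≤ (m + 1) * (C * r ^ (m + 1)) := by
      refine (norm_sum_le Finset.univ (quotientTerm p m)).trans ?_
      refine (Finset.sum_le_sum (g := fun _ => C * r ^ (m + 1)) fun k _ =>
        (norm_quotientTerm_le p m k).trans (hb _)).trans ?_
      simp
    have h2 : ((m : ℝ) + 1) ≤ 2 ^ m := by
      have := Nat.lt_two_pow_self (n := m)
      exact_mod_cast this
    change _ * ((2 * r)⁻¹) ^ m ≤ _
    calc ‖quotientSeries p m‖ * ((2 * r)⁻¹) ^ m
        ≤ (2 ^ m * (C * r ^ (m + 1))) * ((2 * r)⁻¹) ^ m := by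
          gcongr
          exact h1.trans (by gcongr)
      _ = C * r := by
          rw [pow_succ, inv_pow, mul_pow]
          field_simp
  have := (quotientSeries p).le_radius_of_bound _ key
  refine lt_of_lt_of_le ?_ this
  exact ENNReal.coe_pos.2 (show (0 : NNReal) < ⟨(2 * r)⁻¹, hr'.le⟩ from hr')

theorem AnalyticAt.clm_apply {X : Type*} [NormedAddCommGroup X] [NormedSpace ℂ X]
    {L : X → (E →L[ℂ] F)} {v : X → E} {x : X} (hL : AnalyticAt ℂ L x) (hv : AnalyticAt ℂ v x) :
    AnalyticAt ℂ (fun y => L y (v y)) x :=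
  AnalyticAt.fun_comp (g := fun z : (E →L[ℂ] F) × E => z.1 z.2) (f := fun y => (L y, v y)) (x := x)
    ((ContinuousLinearMap.id ℂ (E →L[ℂ] F)).analyticAt_bilinear (L x, v x)) (hL.prod hv)

/-- Hadamard's lemma for analytic germs. -/
theorem AnalyticAt.exists_quotient [CompleteSpace F] {f : E → F} (hf : AnalyticAt ℂ f 0) :
    ∃ G : E × E → (E →L[ℂ] F), AnalyticAt ℂ G 0 ∧
      ∀ᶠ z in 𝓝 (0 : E × E), f z.2 - f z.1 = G z (z.2 - z.1) := by
  obtain ⟨p, hp⟩ := hf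
  obtain ⟨r, hr⟩ := hp
  have hq := quotientSeries_radius_pos p (hr.r_pos.trans_le hr.r_le)
  have hQ := (quotientSeries p).hasFPowerSeriesOnBall hq
  refine ⟨(quotientSeries p).sum, hQ.analyticAt, ?_⟩
  have hf0 : Tendsto (fun z : E × E => z.1) (𝓝 0) (𝓝 0) := continuous_fst.tendsto' _ _ rfl
  have hs0 : Tendsto (fun z : E × E => z.2) (𝓝 0) (𝓝 0) := continuous_snd.tendsto' _ _ rfl
  filter_upwards [hf0.eventually hr.eventually_hasSum, hs0.eventually hr.eventually_hasSum,
    hQ.eventually_hasSum] with z h1 h2 h3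
  simp only [zero_add] at h1 h2 h3
  have h4 := (h2.sub h1)
  -- The constant terms cancel in the difference; degree m + 1 of `p` then matches degree m of the
  -- quotient series.
  rw [← hasSum_nat_add_iff' 1] at h4
  have h5 := h3.mapL (ContinuousLinearMap.apply ℂ F (z.2 - z.1))
  simp only [ContinuousLinearMap.apply_apply, quotientSeries_apply] at h5
  have h6 := h4.unique h5
  rw [← h6]
  simp only [Finset.range_one, Finset.sum_singleton]
  have : p 0 (fun _ => z.2) = p 0 (fun _ => z.1) := congrArg _ (Subsingleton.elim _ _)
  rw [this]; abel

theorem AnalyticAt.exists_quotient_zero [CompleteSpace F] {f : E → F} (hf : AnalyticAt ℂ f 0) :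
    ∃ G : E → (E →L[ℂ] F), AnalyticAt ℂ G 0 ∧ G 0 = fderiv ℂ f 0 ∧
      ∀ᶠ x in 𝓝 (0 : E), f x = f 0 + G x x := by
  obtain ⟨G, hG, h⟩ := hf.exists_quotient
  have hi : AnalyticAt ℂ (fun x : E => ((0 : E), x)) 0 := by fun_prop
  have hG' : AnalyticAt ℂ (fun x => G (0, x)) 0 := AnalyticAt.fun_comp (f := fun x : E => ((0 : E), x)) hG hi
  have ht : Tendsto (fun x : E => ((0 : E), x)) (𝓝 0) (𝓝 0) := hi.continuousAt.tendsto
  have h' : ∀ᶠ x in 𝓝 (0 : E), f x = f 0 + G (0, x) x := by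
    filter_upwards [ht.eventually h] with x hx
    simp only [sub_zero] at hx
    rw [← hx]; abel
  refine ⟨fun x => G (0, x), hG', ?_, h'⟩
  have h1 : HasFDerivAt (fun x => f 0 + G (0, x) x) (G (0, 0)) 0 := by
    have := (hG'.differentiableAt.hasFDerivAt.clm_apply (hasFDerivAt_id (0 : E))).const_add (f 0)
    convert! this using 1
    ext v; simp
  exact (h1.congr_of_eventuallyEq h').fderiv.symm

/-- Differentiability of order `⊤` in `WithTop ℕ∞` means analyticity, so the implicit function of
the `ContDiffAt` theory is already analytic. -/
theorem analytic_implicit {P B : Type*} [NormedAddCommGroup P] [NormedSpace ℂ P] [CompleteSpace P]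
    [NormedAddCommGroup B] [NormedSpace ℂ B] [CompleteSpace B] [CompleteSpace F] {f : P × B → F} (hf : AnalyticAt ℂ f 0) (h0 : f 0 = 0)
    (A : B ≃L[ℂ] F) (hA : HasFDerivAt (fun b => f (0, b)) (A : B →L[ℂ] F) 0) :
    ∃ b : P → B, AnalyticAt ℂ b 0 ∧ b 0 = 0 ∧ ∀ᶠ p in 𝓝 (0 : P), f (p, b p) = 0 := by
  have hc : ContDiffAt ℂ (⊤ : WithTop ℕ∞) f (0, 0) := hf.contDiffAt
  have hd : fderiv ℂ f (0, 0) ∘L .inr ℂ P B = A := by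
    have h1 : HasFDerivAt (fun b : B => ((0 : P), b)) (.inr ℂ P B) 0 := hasFDerivAt_prodMk_right _ _
    have h2 := HasFDerivAt.comp (0 : B) (g := f) hf.differentiableAt.hasFDerivAt h1
    exact h2.unique hA
  have hi : (fderiv ℂ f (0, 0) ∘L .inr ℂ P B).IsInvertible := ⟨A, hd.symm⟩
  refine ⟨hc.implicitFunction (by simp) hi, ?_, hc.implicitFunction_apply_self (by simp) hi, ?_⟩
  · exact (hc.contDiffAt_implicitFunction (by simp) hi).analyticAt
  · have := hc.eventually_apply_implicitFunction (by simp) hi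
    filter_upwards [this] with x hx
    rw [hx]; exact h0

theorem DiffGerm.exists_of_fderiv [CompleteSpace E] {f : E → E} (hf : AnalyticAt ℂ f 0)
    (h0 : f 0 = 0) (A : E ≃L[ℂ] E) (hA : HasFDerivAt f (A : E →L[ℂ] E) 0) :
    ∃ φ : DiffGerm E, φ.toFun = f := by
  have hc : ContDiffAt ℂ (⊤ : WithTop ℕ∞) f 0 := hf.contDiffAt
  have hs : HasStrictFDerivAt f (A : E →L[ℂ] E) 0 := hc.hasStrictFDerivAt' hA (by simp)
  refine ⟨⟨f, hc.localInverse hA (by simp), hf, ?_, h0, ?_, ?_, ?_⟩, rfl⟩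
  · have := hc.to_localInverse hA (by simp)
    rw [h0] at this
    exact this.analyticAt
  · have := hc.localInverse_apply_image hA (by simp)
    rwa [h0] at this
  · exact hs.eventually_left_inverse
  · have := hs.eventually_right_inverse
    rwa [h0] at this

end Tools

/-! ### Germs vanishing to first or second order along the coordinate axes. -/

section Division

variable {n : ℕ} {F : Type*} [NormedAddCommGroup F] [NormedSpace ℂ F]

theorem ContinuousLinearMap.apply_eq_sum_single (L : (Fin n → ℂ) →L[ℂ] F) (v : Fin n → ℂ) :
    L v = ∑ j, v j • L (Pi.single j 1) := by
  conv_lhs => rw [← Finset.univ_sum_single v]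
  rw [map_sum]
  refine Finset.sum_congr rfl fun j _ => ?_
  rw [← map_smul, ← Pi.single_smul]
  simp

theorem analyticAt_single (i : Fin n) (t : ℂ) :
    AnalyticAt ℂ (fun t : ℂ => (Pi.single i t : Fin n → ℂ)) t :=
  (ContinuousLinearMap.single ℂ (fun _ : Fin n => ℂ) i).analyticAt t

theorem analyticAt_coord (i : Fin n) (x : Fin n → ℂ) :
    AnalyticAt ℂ (fun x : Fin n → ℂ => x i) x :=
  (ContinuousLinearMap.proj (R := ℂ) (φ := fun _ : Fin n => ℂ) i).analyticAt x

theorem analyticAt_single_coord (i : Fin n) (x : Fin n → ℂ) :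
    AnalyticAt ℂ (fun x : Fin n → ℂ => (Pi.single i (x i) : Fin n → ℂ)) x :=
  ((ContinuousLinearMap.single ℂ (fun _ : Fin n => ℂ) i).comp
    (ContinuousLinearMap.proj (R := ℂ) (φ := fun _ : Fin n => ℂ) i)).analyticAt x

theorem tendsto_single (i : Fin n) :
    Tendsto (fun t : ℂ => (Pi.single i t : Fin n → ℂ)) (𝓝 0) (𝓝 0) := by
  simpa using (analyticAt_single i 0).continuousAt.tendsto

theorem tendsto_coord (i : Fin n) : Tendsto (fun x : Fin n → ℂ => x i) (𝓝 0) (𝓝 0) :=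
  (continuous_apply i).tendsto' _ _ rfl

/-- Cancel t away from 0, then use continuity at 0. -/
theorem eventually_eq_zero_of_smul {f : ℂ → F} (hf : ContinuousAt f 0)
    (h : ∀ᶠ t in 𝓝 (0 : ℂ), t • f t = 0) : ∀ᶠ t in 𝓝 (0 : ℂ), f t = 0 := by
  have h1 : ∀ᶠ t in 𝓝[≠] (0 : ℂ), f t = 0 := by
    filter_upwards [nhdsWithin_le_nhds h, self_mem_nhdsWithin] with t ht ht'
    exact (smul_eq_zero.1 ht).resolve_left ht'
  have h2 : f 0 = 0 := by
    refine tendsto_nhds_unique (hf.tendsto.mono_left (nhdsWithin_le_nhds (s := {0}ᶜ))) ?_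
    exact tendsto_const_nhds.congr' (h1.mono fun t ht => ht.symm)
  rw [eventually_nhdsWithin_iff] at h1
  filter_upwards [h1] with t ht
  by_cases h0 : t = 0
  · rw [h0, h2]
  · exact ht h0

theorem sum_single_smul (i : Fin n) (t : ℂ) (k : Fin n → F) :
    ∑ b, (Pi.single i t : Fin n → ℂ) b • k b = t • k i := by
  rw [Finset.sum_eq_single i] <;> simp +contextual

theorem sum_single_add_single_smul (i j : Fin n) (t s : ℂ) (k : Fin n → F) :
    ∑ b, (Pi.single i t + Pi.single j s : Fin n → ℂ) b • k b = t • k i + s • k j := by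
  simp only [Pi.add_apply, add_smul, Finset.sum_add_distrib, sum_single_smul]

/-- The cofactor of `x i * x j` in the monomials generating the ideal of functions vanishing to
second order along the coordinate axes. -/
def axisCofactor (i j k : Fin n) (x : Fin n → ℂ) : ℂ :=
  if k = i ∨ k = j then x i * x j else x k

/-- The triples of indices `(i, j, k)` with `i ≠ j`. -/
abbrev AxisIndex (n : ℕ) := {m : Fin n × Fin n × Fin n // m.1 ≠ m.2.1}

/-- The monomials `x i ^ 2 * x j ^ 2` and `x i * x j * x k` (with distinct indices), generating the
ideal of functions vanishing to second order along the coordinate axes. -/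
def axisMonomial (m : AxisIndex n) (x : Fin n → ℂ) : ℂ :=
  x m.1.1 * x m.1.2.1 * axisCofactor m.1.1 m.1.2.1 m.1.2.2 x

theorem analyticAt_axisCofactor (i j k : Fin n) (x : Fin n → ℂ) :
    AnalyticAt ℂ (axisCofactor i j k) x := by
  unfold axisCofactor
  split_ifs
  · exact (analyticAt_coord i x).mul (analyticAt_coord j x)
  · exact analyticAt_coord k x

variable [CompleteSpace F]

/-- In f = ∑ x_i f_i, restriction to the i-th axis gives t f_i = 0, so f_i vanishes on that axis.
Hadamard's lemma between (the point x_i on the axis) and x then involves only the coordinates x_j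
with j ≠ i. -/
theorem exists_sum_of_vanish_on_axes {f : (Fin n → ℂ) → F} (hf : AnalyticAt ℂ f 0) (h0 : f 0 = 0)
    (h : ∀ i, ∀ᶠ t in 𝓝 (0 : ℂ), f (Pi.single i t) = 0) :
    ∃ H : Fin n → Fin n → (Fin n → ℂ) → F, (∀ i j, AnalyticAt ℂ (H i j) 0) ∧
      (∀ i x, H i i x = 0) ∧ ∀ᶠ x in 𝓝 (0 : Fin n → ℂ), f x = ∑ i, x i • ∑ j, x j • H i j x := by
  obtain ⟨G, hG, -, hfG⟩ := hf.exists_quotient_zero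
  set f1 : Fin n → (Fin n → ℂ) → F := fun i x => G x (Pi.single i 1) with hf1
  have hf1a : ∀ i, AnalyticAt ℂ (f1 i) 0 := fun i => hG.clm_apply analyticAt_const
  have hf1z : ∀ i, ∀ᶠ t in 𝓝 (0 : ℂ), f1 i (Pi.single i t) = 0 := by
    intro i
    refine eventually_eq_zero_of_smul ?_ ?_
    · refine ContinuousAt.comp (g := f1 i) ?_ (analyticAt_single i 0).continuousAt
      rw [Pi.single_zero]; exact (hf1a i).continuousAt
    · filter_upwards [h i, (tendsto_single i).eventually hfG] with t h1 h2
      rw [h1, h0, zero_add, ContinuousLinearMap.apply_eq_sum_single, sum_single_smul] at h2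
      exact h2.symm
  choose G2 hG2 hf2 using fun i => (hf1a i).exists_quotient
  have hpair : ∀ i, AnalyticAt ℂ (fun x : Fin n → ℂ => ((Pi.single i (x i) : Fin n → ℂ), x)) 0 :=
    fun i => (analyticAt_single_coord i 0).prod analyticAt_id
  have hpair0 : ∀ i : Fin n, ((Pi.single i ((0 : Fin n → ℂ) i) : Fin n → ℂ), (0 : Fin n → ℂ)) = 0 := by
    intro i; simp
  refine ⟨fun i j x => if i = j then 0 else G2 i (Pi.single i (x i), x) (Pi.single j 1), ?_, ?_, ?_⟩
  · intro i j
    by_cases hij : i = j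
    · simp only [hij, if_true]; exact analyticAt_const
    · simp only [hij, if_false]
      refine AnalyticAt.clm_apply ?_ analyticAt_const
      refine AnalyticAt.fun_comp (g := G2 i) ?_ (hpair i)
      rw [hpair0]; exact hG2 i
  · intro i x; simp
  · have hp : ∀ i, Tendsto (fun x : Fin n → ℂ => ((Pi.single i (x i) : Fin n → ℂ), x)) (𝓝 0) (𝓝 0) := by
      intro i
      have := (hpair i).continuousAt.tendsto
      rwa [hpair0] at this
    have e1 := eventually_all.2 fun i => (hp i).eventually (hf2 i)
    have e2 := eventually_all.2 fun i => (tendsto_coord i).eventually (hf1z i)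
    filter_upwards [hfG, e1, e2] with x hx h1 h2
    rw [hx, h0, zero_add, ContinuousLinearMap.apply_eq_sum_single]
    refine Finset.sum_congr rfl fun i _ => ?_
    congr 1
    have h3 := h1 i
    simp only [h2 i, sub_zero] at h3
    change f1 i x = _
    rw [h3, ContinuousLinearMap.apply_eq_sum_single]
    refine Finset.sum_congr rfl fun j _ => ?_
    by_cases hij : i = j
    · subst hij; simp
    · simp [hij, Ne.symm hij]

/-- With π the projection to the (i, j)-plane, f - f ∘ π lies in the ideal of the other coordinates.
On the plane, vanishing on the i-th axis lets x_j be divided out, and vanishing on the j-th axis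
then lets x_i be divided out. -/
theorem exists_sum_of_vanish_on_two_axes {f : (Fin n → ℂ) → F} (hf : AnalyticAt ℂ f 0)
    {i j : Fin n} (hij : i ≠ j) (hi : ∀ᶠ t in 𝓝 (0 : ℂ), f (Pi.single i t) = 0)
    (hj : ∀ᶠ t in 𝓝 (0 : ℂ), f (Pi.single j t) = 0) :
    ∃ A : Fin n → (Fin n → ℂ) → F, (∀ k, AnalyticAt ℂ (A k) 0) ∧
      ∀ᶠ x in 𝓝 (0 : Fin n → ℂ), f x = ∑ k, axisCofactor i j k x • A k x := by
  obtain ⟨G, hG, hfG⟩ := hf.exists_quotient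
  set π : (Fin n → ℂ) → (Fin n → ℂ) := fun x => Pi.single i (x i) + Pi.single j (x j) with hπ
  have hπa : ∀ x, AnalyticAt ℂ π x := fun x =>
    (analyticAt_single_coord i x).add (analyticAt_single_coord j x)
  have hπ0 : π 0 = 0 := by simp [hπ]
  have hs0 : ∀ i : Fin n, (Pi.single i ((0 : Fin n → ℂ) i) : Fin n → ℂ) = 0 := fun i => by simp
  have comp0 : ∀ {F' : Type _} [NormedAddCommGroup F'] [NormedSpace ℂ F']
      {g : (Fin n → ℂ) × (Fin n → ℂ) → F'} {a b : (Fin n → ℂ) → (Fin n → ℂ)},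
      AnalyticAt ℂ g 0 → AnalyticAt ℂ a 0 → AnalyticAt ℂ b 0 → a 0 = 0 → b 0 = 0 →
      AnalyticAt ℂ (fun x => g (a x, b x)) 0 := by
    intro F' _ _ g a b hg ha hb ha0 hb0
    refine AnalyticAt.fun_comp (g := g) ?_ (ha.prod hb)
    rw [ha0, hb0]; exact hg
  have tend0 : ∀ {a b : (Fin n → ℂ) → (Fin n → ℂ)},
      AnalyticAt ℂ a 0 → AnalyticAt ℂ b 0 → a 0 = 0 → b 0 = 0 →
      Tendsto (fun x => (a x, b x)) (𝓝 0) (𝓝 0) := by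
    intro a b ha hb ha0 hb0
    have := (ha.prod hb).continuousAt.tendsto
    rw [ha0, hb0] at this; exact this
  set h1 : (Fin n → ℂ) → F := fun x => G (Pi.single i (x i), π x) (Pi.single j 1) with hh1
  have h1a : AnalyticAt ℂ h1 0 :=
    (comp0 hG (analyticAt_single_coord i 0) (hπa 0) (hs0 i) hπ0).clm_apply analyticAt_const
  have e1 : ∀ᶠ x in 𝓝 (0 : Fin n → ℂ), f (π x) = x j • h1 x := by
    filter_upwards [(tend0 (analyticAt_single_coord i 0) (hπa 0) (hs0 i) hπ0).eventually hfG,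
      (tendsto_coord i).eventually hi] with x hx hx'
    simp only [hx', sub_zero] at hx
    rw [hx, ContinuousLinearMap.apply_eq_sum_single]
    simp only [hπ, add_sub_cancel_left, sum_single_smul]
    rfl
  have h1π : ∀ x, h1 (π x) = h1 x := by
    intro x
    simp [hh1, hπ, hij, hij.symm]
  have h1j : ∀ᶠ t in 𝓝 (0 : ℂ), h1 (Pi.single j t) = 0 := by
    refine eventually_eq_zero_of_smul ?_ ?_
    · refine ContinuousAt.comp (g := h1) ?_ (analyticAt_single j 0).continuousAt
      rw [Pi.single_zero]; exact h1a.continuousAt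
    · filter_upwards [hj, (tendsto_single j).eventually e1] with t ht ht'
      have : π (Pi.single j t) = Pi.single j t := by simp [hπ, hij]
      rw [this, ht] at ht'
      simpa using ht'.symm
  obtain ⟨G', hG', hfG'⟩ := h1a.exists_quotient
  have e2 : ∀ᶠ x in 𝓝 (0 : Fin n → ℂ),
      h1 x = x i • G' (Pi.single j (x j), π x) (Pi.single i 1) := by
    filter_upwards [(tend0 (analyticAt_single_coord j 0) (hπa 0) (hs0 j) hπ0).eventually hfG',
      (tendsto_coord j).eventually h1j] with x hx hx'
    simp only [hx', sub_zero, h1π] at hx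
    rw [hx, ContinuousLinearMap.apply_eq_sum_single]
    simp only [hπ, add_sub_cancel_right, sum_single_smul]
  -- The whole x_i x_j part is assigned to k = i; the index k = j has the same cofactor and receives
  -- 0.
  refine ⟨fun k x => if k = i then G' (Pi.single j (x j), π x) (Pi.single i 1) else
    if k = j then 0 else G (π x, x) (Pi.single k 1), ?_, ?_⟩
  · intro k
    dsimp only
    split_ifs
    · exact (comp0 hG' (analyticAt_single_coord j 0) (hπa 0) (hs0 j) hπ0).clm_apply analyticAt_const
    · exact analyticAt_const
    · exact (comp0 hG (hπa 0) analyticAt_id hπ0 rfl).clm_apply analyticAt_const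
  · filter_upwards [e1, e2, (tend0 (hπa 0) analyticAt_id hπ0 rfl).eventually hfG] with x h1 h2 h3
    have h4 : f x = f (π x) + G (π x, x) (x - π x) := by
      simp only [id] at h3; rw [← h3]; abel
    rw [h4, h1, h2, ContinuousLinearMap.apply_eq_sum_single (G (π x, x)), smul_smul]
    rw [← Finset.add_sum_erase _ _ (Finset.mem_univ i), ← Finset.add_sum_erase Finset.univ
      (fun k => axisCofactor i j k x • _) (Finset.mem_univ i)]
    have hz : (x - π x) i = 0 := by simp [hπ, hij]
    rw [hz]
    simp only [zero_smul, zero_add, axisCofactor, true_or, if_true]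
    congr 1
    · rw [mul_comm]
    · refine Finset.sum_congr rfl fun k hk => ?_
      have hk' : k ≠ i := (Finset.mem_erase.1 hk).1
      by_cases hkj : k = j
      · subst hkj; simp [hπ, hk']
      · simp [hπ, hk', hkj]

/-- A germ vanishing to second order along the coordinate axes is in the ideal generated by the
monomials `axisMonomial m`. -/
theorem exists_sum_axisMonomial {f : (Fin n → ℂ) → F} (hf : AnalyticAt ℂ f 0) (h0 : f 0 = 0)
    (h : ∀ i, ∀ᶠ t in 𝓝 (0 : ℂ), f (Pi.single i t) = 0)
    (hd : ∀ i, ∀ᶠ t in 𝓝 (0 : ℂ), fderiv ℂ f (Pi.single i t) = 0) :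
    ∃ A : AxisIndex n → (Fin n → ℂ) → F, (∀ m, AnalyticAt ℂ (A m) 0) ∧
      ∀ᶠ x in 𝓝 (0 : Fin n → ℂ), f x = ∑ m, axisMonomial m x • A m x := by
  obtain ⟨H, hH, hH0, hfH⟩ := exists_sum_of_vanish_on_axes hf h0 h
  have hKa : ∀ i j, AnalyticAt ℂ (fun x => H i j x + H j i x) 0 := fun i j => (hH i j).add (hH j i)
  -- At the point t of the i-th axis, the j-th derivative of ∑ x_a x_b H_ab is t (H_ij + H_ji). Only
  -- the symmetrized coefficient is controlled by the hypothesis `hd`.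
  have hKi : ∀ i j, i ≠ j → ∀ᶠ t in 𝓝 (0 : ℂ),
      H i j (Pi.single i t) + H j i (Pi.single i t) = 0 := by
    intro i j hij
    refine eventually_eq_zero_of_smul (f := fun t => H i j (Pi.single i t) + H j i (Pi.single i t))
      ?_ ?_
    · refine ContinuousAt.comp (g := fun x => H i j x + H j i x) ?_ (analyticAt_single i 0).continuousAt
      rw [Pi.single_zero]; exact (hKa i j).continuousAt
    · filter_upwards [hd i, (tendsto_single i).eventually hfH.eventually_nhds,
        (tendsto_single i).eventually hf.eventually_analyticAt,
        (tendsto_single i).eventually (hKa i j).eventually_analyticAt,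
        (tendsto_single i).eventually hfH, h i] with t h1 h2 h3 h4 h5 h6
      have hline : HasDerivAt (fun s : ℂ => (Pi.single i t + Pi.single j s : Fin n → ℂ))
          (Pi.single j 1) 0 :=
        (ContinuousLinearMap.single ℂ (fun _ : Fin n => ℂ) j).hasDerivAt.const_add _
      have hline0 : (Pi.single i t + Pi.single j (0 : ℂ) : Fin n → ℂ) = Pi.single i t := by simp
      have d1 : HasDerivAt (fun s : ℂ => f (Pi.single i t + Pi.single j s)) 0 0 := by
        have h7 : HasFDerivAt f (0 : (Fin n → ℂ) →L[ℂ] F) (Pi.single i t + Pi.single j (0 : ℂ)) := by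
          rw [hline0, ← h1]; exact h3.differentiableAt.hasFDerivAt
        have h8 := h7.comp_hasDerivAt (0 : ℂ) hline
        rwa [zero_apply] at h8
      have d2 : HasDerivAt (fun s : ℂ => (t * s) • (H i j (Pi.single i t + Pi.single j s) +
          H j i (Pi.single i t + Pi.single j s)))
          (t • (H i j (Pi.single i t) + H j i (Pi.single i t))) 0 := by
        have h7 := (h4.differentiableAt.hasFDerivAt)
        rw [← hline0] at h7
        have h8 := h7.comp_hasDerivAt (0 : ℂ) hline
        have h9 := ((hasDerivAt_id (0 : ℂ)).const_mul t).smul h8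
        convert! h9 using 1
        simp
      refine (d2.unique (d1.congr_of_eventuallyEq ?_))
      have ht : Tendsto (fun s : ℂ => (Pi.single i t + Pi.single j s : Fin n → ℂ)) (𝓝 0)
          (𝓝 (Pi.single i t)) := by
        have := hline.continuousAt.tendsto
        rwa [hline0] at this
      filter_upwards [ht.eventually h2] with s hs
      rw [hs]
      rw [sum_single_add_single_smul i j t s (fun a => ∑ b, (_ : ℂ) • H a b _),
        sum_single_add_single_smul, sum_single_add_single_smul]
      simp only [hH0, smul_zero, zero_add, add_zero, smul_add, smul_smul]
      rw [mul_comm s t]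
  have hK : ∀ i j, ∃ A : Fin n → (Fin n → ℂ) → F, (∀ k, AnalyticAt ℂ (A k) 0) ∧
      ∀ᶠ x in 𝓝 (0 : Fin n → ℂ), i ≠ j →
        H i j x + H j i x = ∑ k, axisCofactor i j k x • A k x := by
    intro i j
    by_cases hij : i = j
    · exact ⟨fun _ _ => 0, fun _ => analyticAt_const, Eventually.of_forall fun x hx => (hx hij).elim⟩
    · obtain ⟨A, hA, hA'⟩ := exists_sum_of_vanish_on_two_axes (hKa i j) hij (hKi i j hij) (by
        filter_upwards [hKi j i (Ne.symm hij)] with t ht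
        rw [add_comm]; exact ht)
      exact ⟨A, hA, hA'.mono fun x hx _ => hx⟩
  choose A hA hKA using hK
  refine ⟨fun m x => (1 / 2 : ℂ) • A m.1.1 m.1.2.1 m.1.2.2 x,
    fun m => analyticAt_const.smul (hA _ _ _), ?_⟩
  filter_upwards [hfH, eventually_all.2 fun i => eventually_all.2 fun j => hKA i j] with x hx hx'
  -- Exchanging i and j and averaging brings in the symmetrized coefficients, hence the factor 1/2.
  have hsym : f x = (1 / 2 : ℂ) • ∑ i, ∑ j, (x i * x j) • (H i j x + H j i x) := by
    have e1 : f x = ∑ i, ∑ j, (x i * x j) • H i j x := by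
      rw [hx]; simp only [Finset.smul_sum, smul_smul]
    have e2 : f x = ∑ i, ∑ j, (x i * x j) • H j i x := by
      rw [e1, Finset.sum_comm]
      simp only [mul_comm]
    simp only [smul_add, Finset.sum_add_distrib]
    rw [← smul_add, ← e1, ← e2, ← two_smul ℂ (f x), smul_smul]
    norm_num
  have hsub : ∑ m : AxisIndex n, axisMonomial m x • (1 / 2 : ℂ) • A m.1.1 m.1.2.1 m.1.2.2 x =
      ∑ m : Fin n × Fin n × Fin n, if m.1 ≠ m.2.1 then
        (x m.1 * x m.2.1 * axisCofactor m.1 m.2.1 m.2.2 x) • (1 / 2 : ℂ) • A m.1 m.2.1 m.2.2 x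
        else 0 := by
    rw [← Finset.sum_filter, Finset.sum_subtype (p := fun m : Fin n × Fin n × Fin n => m.1 ≠ m.2.1)
      _ (by simp)]
    rfl
  rw [hsym, hsub, Fintype.sum_prod_type, Finset.smul_sum]
  refine Finset.sum_congr rfl fun i _ => ?_
  rw [Fintype.sum_prod_type, Finset.smul_sum]
  refine Finset.sum_congr rfl fun j _ => ?_
  by_cases hij : i = j
  · subst hij; simp [hH0]
  · rw [hx' i j hij, Finset.smul_sum, Finset.smul_sum]
    refine Finset.sum_congr rfl fun k _ => ?_
    simp only [ne_eq, hij, not_false_eq_true, if_true, smul_smul]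
    congr 1; ring

end Division

/-! ### Displacements built from the axis monomials. -/

section NormalForm

variable {n : ℕ}

/-- The determinant of two vectors of `ℂ²`. -/
def wedge (v w : ℂ × ℂ) : ℂ := v.1 * w.2 - v.2 * w.1

/-- A basis of `ℂ²` as an isomorphism `(a, b) ↦ a v + b w`. -/
def basisEquiv (v w : ℂ × ℂ) (h : wedge v w ≠ 0) : (ℂ × ℂ) ≃L[ℂ] (ℂ × ℂ) :=
  LinearEquiv.toContinuousLinearEquiv
    { toFun := fun z => z.1 • v + z.2 • w
      map_add' := fun x y => by simp only [Prod.fst_add, Prod.snd_add, add_smul]; abel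
      map_smul' := fun c x => by simp only [Prod.smul_fst, Prod.smul_snd, smul_eq_mul, RingHom.id_apply]; module
      invFun := fun y => ((wedge v w)⁻¹ * wedge y w, (wedge v w)⁻¹ * wedge v y)
      left_inv := fun z => by
        ext
        · dsimp only
          rw [inv_mul_eq_iff_eq_mul₀ h]; simp [wedge]; ring
        · dsimp only
          rw [inv_mul_eq_iff_eq_mul₀ h]; simp [wedge]; ring
      right_inv := fun y => by
        simp only [mul_smul, ← smul_add]
        rw [inv_smul_eq_iff₀ h]
        ext <;> simp [wedge] <;> ring }

theorem basisEquiv_apply (v w : ℂ × ℂ) (h : wedge v w ≠ 0) (z : ℂ × ℂ) :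
    basisEquiv v w h z = z.1 • v + z.2 • w := rfl

/-- Taylor expansion of γ(t) = t² g(t) at `z.1` with increment `z.2`. Since γ has a double zero, its
linear coefficient is divisible by `z.1`; the quotient `u` takes the value 2 g(0) at 0. -/
theorem exists_square_expansion {F : Type*} [NormedAddCommGroup F] [NormedSpace ℂ F]
    [CompleteSpace F] {g : ℂ → F} (hg : AnalyticAt ℂ g 0) :
    ∃ u q : ℂ × ℂ → F, AnalyticAt ℂ u 0 ∧ AnalyticAt ℂ q 0 ∧ u 0 = (2 : ℂ) • g 0 ∧
      ∀ᶠ z in 𝓝 (0 : ℂ × ℂ), (z.1 + z.2) ^ 2 • g (z.1 + z.2) =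
        z.1 ^ 2 • g z.1 + (z.1 * z.2) • u z + z.2 ^ 2 • q z := by
  obtain ⟨G, hG, hgG⟩ := hg.exists_quotient
  have hl : AnalyticAt ℂ (fun z : ℂ × ℂ => (z.1, z.1 + z.2)) 0 :=
    analyticAt_fst.prod (analyticAt_fst.add analyticAt_snd)
  have hl0 : ((0 : ℂ × ℂ).1, (0 : ℂ × ℂ).1 + (0 : ℂ × ℂ).2) = (0 : ℂ × ℂ) := by simp
  set h : ℂ × ℂ → F := fun z => G (z.1, z.1 + z.2) 1 with hh
  have hha : AnalyticAt ℂ h 0 := by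
    refine AnalyticAt.clm_apply ?_ analyticAt_const
    refine AnalyticAt.fun_comp (g := G) (f := fun z : ℂ × ℂ => (z.1, z.1 + z.2)) ?_ hl
    rw [hl0]; exact hG
  have hga : AnalyticAt ℂ (fun z : ℂ × ℂ => g z.1) 0 :=
    AnalyticAt.fun_comp (g := g) (f := fun z : ℂ × ℂ => z.1) hg analyticAt_fst
  refine ⟨fun z => (2 : ℂ) • g z.1 + z.1 • h z,
    fun z => g z.1 + (2 * z.1) • h z + z.2 • h z,
    (analyticAt_const.smul hga).add (analyticAt_fst.smul hha),
    (hga.add ((analyticAt_const.mul analyticAt_fst).smul hha)).add (analyticAt_snd.smul hha),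
    by simp, ?_⟩
  have ht := hl.continuousAt.tendsto
  rw [hl0] at ht
  filter_upwards [ht.eventually hgG] with z hz
  have h1 : g (z.1 + z.2) = g z.1 + z.2 • h z := by
    simp only [add_sub_cancel_left] at hz
    have : G (z.1, z.1 + z.2) z.2 = z.2 • h z := by
      rw [hh, ← map_smul, smul_eq_mul, mul_one]
    rw [← this, ← hz]; abel
  rw [h1]
  module

/-- The degree of the axis monomial `m`, minus `2`. -/
def axisDegree (m : AxisIndex n) : ℕ := if m.1.2.2 = m.1.1 ∨ m.1.2.2 = m.1.2.1 then 2 else 1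

theorem axisMonomial_smul (m : AxisIndex n) (ε : ℂ) (x : Fin n → ℂ) :
    axisMonomial m (ε • x) = ε ^ 2 * (ε ^ axisDegree m * axisMonomial m x) := by
  unfold axisMonomial axisDegree axisCofactor
  split_ifs <;> simp only [Pi.smul_apply, smul_eq_mul] <;> ring

/-- The vectors `axisField l p` are the coefficients of the vector fields
`(axisMonomial m / x i) ∂ i` and `(axisMonomial m / x j) ∂ j`. -/
def axisField (l : Fin n) (p : AxisIndex n × Bool) (x : Fin n → ℂ) : ℂ :=
  if p.2 then (if l = p.1.1.1 then x p.1.1.2.1 * axisCofactor p.1.1.1 p.1.1.2.1 p.1.1.2.2 x else 0)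
  else (if l = p.1.1.2.1 then x p.1.1.1 * axisCofactor p.1.1.1 p.1.1.2.1 p.1.1.2.2 x else 0)

theorem axisCofactor_zero (i j k : Fin n) : axisCofactor i j k 0 = 0 := by
  simp [axisCofactor]

/-- Having two factors that vanish at 0 makes the coefficient flat to first order, so displacements
built from it do not alter the differential at 0. -/
theorem axisField_eq_mul (l : Fin n) (p : AxisIndex n × Bool) :
    ∃ a b : (Fin n → ℂ) → ℂ, (∀ x, AnalyticAt ℂ a x) ∧ (∀ x, AnalyticAt ℂ b x) ∧ a 0 = 0 ∧
      b 0 = 0 ∧ ∀ x, axisField l p x = a x * b x := by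
  rcases p with ⟨m, b⟩
  have hq := fun x => analyticAt_axisCofactor m.1.1 m.1.2.1 m.1.2.2 x
  have hz : ∀ x : Fin n → ℂ, AnalyticAt ℂ (fun _ : Fin n → ℂ => (0 : ℂ)) x :=
    fun x => analyticAt_const
  cases b
  · by_cases h : l = m.1.2.1
    · exact ⟨_, _, analyticAt_coord m.1.1, hq, rfl, axisCofactor_zero .., fun x => by
        simp [axisField, h]⟩
    · exact ⟨_, _, hz, hz, rfl, rfl, fun x => by simp [axisField, h]⟩
  · by_cases h : l = m.1.1
    · exact ⟨_, _, analyticAt_coord m.1.2.1, hq, rfl, axisCofactor_zero .., fun x => by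
        simp [axisField, h]⟩
    · exact ⟨_, _, hz, hz, rfl, rfl, fun x => by simp [axisField, h]⟩

theorem analyticAt_axisField (l : Fin n) (p : AxisIndex n × Bool) (x : Fin n → ℂ) :
    AnalyticAt ℂ (axisField l p) x := by
  obtain ⟨a, b, ha, hb, -, -, h⟩ := axisField_eq_mul l p
  rw [show axisField l p = fun x => a x * b x from funext h]
  exact (ha x).mul (hb x)

theorem axisField_zero (l : Fin n) (p : AxisIndex n × Bool) : axisField l p 0 = 0 := by
  obtain ⟨a, b, -, -, ha, -, h⟩ := axisField_eq_mul l p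
  rw [h, ha, zero_mul]

theorem hasFDerivAt_mul_axisField {a : (Fin n → ℂ) → ℂ} (ha : DifferentiableAt ℂ a 0)
    (l : Fin n) (p : AxisIndex n × Bool) :
    HasFDerivAt (fun x => a x * axisField l p x) (0 : (Fin n → ℂ) →L[ℂ] ℂ) 0 := by
  obtain ⟨b, c, hb, hc, hb0, hc0, h⟩ := axisField_eq_mul l p
  have h1 := ha.hasFDerivAt.mul
    ((hb 0).differentiableAt.hasFDerivAt.mul (hc 0).differentiableAt.hasFDerivAt)
  have : (fun x => a x * axisField l p x) = a * (b * c) := by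
    ext x; simp [h]
  rw [this]
  rw [hb0, hc0, Pi.mul_apply, hb0] at h1
  refine h1.congr_fderiv ?_
  ext v
  change a 0 * (0 * _ + 0 * _) + 0 * c 0 * _ = (0 : ℂ)
  ring

theorem axisField_single (l : Fin n) (p : AxisIndex n × Bool) (i : Fin n) (t : ℂ) :
    axisField l p (Pi.single i t) = 0 := by
  rcases p with ⟨⟨⟨a, b, c⟩, hab⟩, s⟩
  simp only [ne_eq] at hab
  have h0 : (Pi.single i t : Fin n → ℂ) a = 0 ∨ (Pi.single i t : Fin n → ℂ) b = 0 := by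
    by_cases h : a = i
    · right; exact Pi.single_eq_of_ne (fun h' => hab (h.trans h'.symm)) _
    · left; exact Pi.single_eq_of_ne h _
  have h1 : axisCofactor a b c (Pi.single i t) = 0 ∨
      ((Pi.single i t : Fin n → ℂ) a = 0 ∧ (Pi.single i t : Fin n → ℂ) b = 0) := by
    unfold axisCofactor
    split_ifs with h
    · left; exact mul_eq_zero.2 h0
    · push Not at h
      by_cases hc : c = i
      · subst hc
        right; exact ⟨Pi.single_eq_of_ne h.1.symm _, Pi.single_eq_of_ne h.2.symm _⟩
      · left; exact Pi.single_eq_of_ne hc _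
  rcases h1 with h1 | ⟨h1, h2⟩
  · cases s <;> simp [axisField, h1]
  · cases s <;> simp only [axisField, h1, h2] <;> simp

/-- The products of the coefficients of the axis fields vanish to second order along the axes. -/
theorem exists_axisField_mul (l : Fin n) (p p' : AxisIndex n × Bool) :
    ∃ c : AxisIndex n → (Fin n → ℂ) → ℂ, (∀ m, AnalyticAt ℂ (c m) 0) ∧
      ∀ᶠ x in 𝓝 (0 : Fin n → ℂ), axisField l p x * axisField l p' x =
        ∑ m, axisMonomial m x * c m x := by
  refine exists_sum_axisMonomial (f := fun x => axisField l p x * axisField l p' x)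
    ((analyticAt_axisField l p 0).mul (analyticAt_axisField l p' 0)) ?_ ?_ ?_
  · simp [axisField_zero]
  · intro i
    simp [axisField_single]
  · intro i
    refine Eventually.of_forall fun t => ?_
    have h1 := (analyticAt_axisField l p (Pi.single i t)).differentiableAt.hasFDerivAt.mul
      (analyticAt_axisField l p' (Pi.single i t)).differentiableAt.hasFDerivAt
    simp only [axisField_single] at h1
    refine (h1.congr_fderiv ?_).fderiv
    ext v
    change 0 * _ + 0 * _ = (0 : ℂ)
    ring

/-- The coefficient functionals on the unknowns `b`. -/
def axisCoeff (b : AxisIndex n → ℂ × ℂ) (p : AxisIndex n × Bool) : ℂ :=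
  if p.2 then (b p.1).1 else (b p.1).2

theorem axisCoeff_eq_clm (p : AxisIndex n × Bool) :
    ∃ L : (AxisIndex n → ℂ × ℂ) →L[ℂ] ℂ, ∀ b, axisCoeff b p = L b := by
  rcases p with ⟨m, s⟩
  cases s
  · exact ⟨(ContinuousLinearMap.snd ℂ ℂ ℂ).comp
      (ContinuousLinearMap.proj (R := ℂ) (φ := fun _ : AxisIndex n => ℂ × ℂ) m), fun b => rfl⟩
  · exact ⟨(ContinuousLinearMap.fst ℂ ℂ ℂ).comp
      (ContinuousLinearMap.proj (R := ℂ) (φ := fun _ : AxisIndex n => ℂ × ℂ) m), fun b => rfl⟩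

theorem analyticAt_axisCoeff (p : AxisIndex n × Bool) (b : AxisIndex n → ℂ × ℂ) :
    AnalyticAt ℂ (fun b => axisCoeff b p) b := by
  obtain ⟨L, hL⟩ := axisCoeff_eq_clm p
  rw [show (fun b => axisCoeff b p) = L from funext hL]
  exact L.analyticAt b

/-- The displacement with unknowns `b`. -/
def axisShift (x : Fin n → ℂ) (b : AxisIndex n → ℂ × ℂ) (l : Fin n) : ℂ :=
  ∑ p, axisCoeff b p * axisField l p x

theorem axisShift_zero (b : AxisIndex n → ℂ × ℂ) (l : Fin n) : axisShift 0 b l = 0 := by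
  simp [axisShift, axisField_zero]

/-- Multiplication by x_l restores the monomials. The monomial with indices i, j thus appears with
the coefficient (b m).1 u_i + (b m).2 u_j, which can be any vector of ℂ² when u_i and u_j are
independent. -/
theorem sum_axisShift_smul (x : Fin n → ℂ) (b : AxisIndex n → ℂ × ℂ) (u : Fin n → ℂ × ℂ) :
    ∑ l, (x l * axisShift x b l) • u l =
      ∑ m, axisMonomial m x • ((b m).1 • u m.1.1 + (b m).2 • u m.1.2.1) := by
  simp only [axisShift, Finset.mul_sum, Finset.sum_smul]
  rw [Finset.sum_comm, Fintype.sum_prod_type]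
  refine Finset.sum_congr rfl fun m _ => ?_
  rw [Fintype.sum_bool]
  simp only [axisCoeff, axisField, if_true, Bool.false_eq_true, if_false, mul_ite, mul_zero,
    ite_smul, zero_smul, Finset.sum_ite_eq', Finset.mem_univ, smul_add,
    smul_smul, axisMonomial]
  congr 1 <;> congr 1 <;> ring

/-- The squares of the displacements stay in the ideal of the axis monomials, so they only add terms
quadratic in b to the equation attached to each monomial. -/
theorem sum_axisShift_sq_smul (x : Fin n → ℂ) (b : AxisIndex n → ℂ × ℂ) (q : Fin n → ℂ × ℂ)
    (c : Fin n → AxisIndex n × Bool → AxisIndex n × Bool → AxisIndex n → ℂ)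
    (hc : ∀ l p p', axisField l p x * axisField l p' x = ∑ m, axisMonomial m x * c l p p' m) :
    ∑ l, axisShift x b l ^ 2 • q l = ∑ m, axisMonomial m x •
      ∑ l, ∑ p, ∑ p', (axisCoeff b p * axisCoeff b p' * c l p p' m) • q l := by
  have h1 : ∀ l, axisShift x b l ^ 2 • q l = ∑ m, axisMonomial m x •
      ∑ p, ∑ p', (axisCoeff b p * axisCoeff b p' * c l p p' m) • q l := by
    intro l
    rw [sq, axisShift, Finset.sum_mul_sum, Finset.sum_smul]
    simp only [Finset.smul_sum]
    rw [Finset.sum_comm]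
    refine Finset.sum_congr rfl fun p _ => ?_
    rw [Finset.sum_smul, Finset.sum_comm]
    refine Finset.sum_congr rfl fun p' _ => ?_
    rw [mul_mul_mul_comm, hc, Finset.mul_sum, Finset.sum_smul]
    refine Finset.sum_congr rfl fun m _ => ?_
    rw [smul_smul]
    congr 1; ring
  simp only [h1]
  rw [Finset.sum_comm]
  simp only [Finset.smul_sum]

end NormalForm

/-! ### Absorbing a remainder of second order along the axes. -/

section NormalForm

variable {n : ℕ}

theorem hasFDerivAt_mul_clm_zero {B : Type*} [NormedAddCommGroup B] [NormedSpace ℂ B]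
    {F : Type*} [NormedAddCommGroup F] [NormedSpace ℂ F] (L M : B →L[ℂ] ℂ) (c : ℂ) (w : F) :
    HasFDerivAt (fun b => (L b * M b * c) • w) (0 : B →L[ℂ] F) 0 := by
  have h1 := ((L.hasFDerivAt (x := (0 : B))).mul (M.hasFDerivAt (x := (0 : B)))).mul_const c
  have h2 := h1.smul_const w
  refine h2.congr_fderiv ?_
  ext v
  simp

theorem analyticAt_smul_const_left {B : Type*} [NormedAddCommGroup B] [NormedSpace ℂ B] (c : ℂ)
    (x : B) : AnalyticAt ℂ (fun x : B => c • x) x :=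
  (c • ContinuousLinearMap.id ℂ B).analyticAt x

/-- A germ differing from `∑ i, x i ^ 2 • g i (x i)` by an element of the ideal of germs vanishing
to second order along the axes is right equivalent to it. -/
theorem exists_diffGerm_of_axis_remainder (g : Fin n → ℂ → ℂ × ℂ) (hg : ∀ i, AnalyticAt ℂ (g i) 0)
    (hdet : ∀ i j, i ≠ j → wedge (g i 0) (g j 0) ≠ 0)
    (A : AxisIndex n → (Fin n → ℂ) → ℂ × ℂ) (hA : ∀ m, AnalyticAt ℂ (A m) 0)
    (Φ : (Fin n → ℂ) → ℂ × ℂ) (hΦ : ∀ᶠ x in 𝓝 (0 : Fin n → ℂ),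
      Φ x = ∑ l, x l ^ 2 • g l (x l) + ∑ m, axisMonomial m x • A m x) :
    ∃ φ : DiffGerm (Fin n → ℂ), ∀ᶠ x in 𝓝 (0 : Fin n → ℂ),
      ∑ l, φ.toFun x l ^ 2 • g l (φ.toFun x l) = Φ x := by
  choose u q hu hq hu0 huq using fun l => exists_square_expansion (hg l)
  choose c hc hcm using fun l p p' => exists_axisField_mul (n := n) l p p'
  -- the rescaled arguments
  set arg : Fin n → (ℂ × (Fin n → ℂ)) × (AxisIndex n → ℂ × ℂ) → ℂ × ℂ :=
    fun l z => (z.1.1 * z.1.2 l, z.1.1 * axisShift z.1.2 z.2 l) with harg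
  have hx : ∀ (l : Fin n) (z : (ℂ × (Fin n → ℂ)) × (AxisIndex n → ℂ × ℂ)),
      AnalyticAt ℂ (fun z : (ℂ × (Fin n → ℂ)) × (AxisIndex n → ℂ × ℂ) => z.1.2 l) z := fun l z =>
    ((ContinuousLinearMap.proj (R := ℂ) (φ := fun _ : Fin n => ℂ) l).comp
      ((ContinuousLinearMap.snd ℂ ℂ (Fin n → ℂ)).comp
        (ContinuousLinearMap.fst ℂ (ℂ × (Fin n → ℂ)) (AxisIndex n → ℂ × ℂ)))).analyticAt z
  have hx2 : ∀ z, AnalyticAt ℂ (fun z : (ℂ × (Fin n → ℂ)) × (AxisIndex n → ℂ × ℂ) => z.1.2) z :=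
    fun z => ((ContinuousLinearMap.snd ℂ ℂ (Fin n → ℂ)).comp
        (ContinuousLinearMap.fst ℂ (ℂ × (Fin n → ℂ)) (AxisIndex n → ℂ × ℂ))).analyticAt z
  have hε : ∀ z, AnalyticAt ℂ (fun z : (ℂ × (Fin n → ℂ)) × (AxisIndex n → ℂ × ℂ) => z.1.1) z :=
    fun z => ((ContinuousLinearMap.fst ℂ ℂ (Fin n → ℂ)).comp
        (ContinuousLinearMap.fst ℂ (ℂ × (Fin n → ℂ)) (AxisIndex n → ℂ × ℂ))).analyticAt z
  have hb : ∀ p z, AnalyticAt ℂ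
      (fun z : (ℂ × (Fin n → ℂ)) × (AxisIndex n → ℂ × ℂ) => axisCoeff z.2 p) z := fun p z =>
    AnalyticAt.fun_comp (g := fun b => axisCoeff b p) (analyticAt_axisCoeff p z.2) analyticAt_snd
  have hshift : ∀ l z, AnalyticAt ℂ
      (fun z : (ℂ × (Fin n → ℂ)) × (AxisIndex n → ℂ × ℂ) => axisShift z.1.2 z.2 l) z := by
    intro l z
    refine Finset.analyticAt_fun_sum _ fun p _ => (hb p z).mul ?_
    exact AnalyticAt.fun_comp (g := axisField l p) (analyticAt_axisField l p _) (hx2 z)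
  have harga : ∀ l z, AnalyticAt ℂ (arg l) z := fun l z =>
    ((hε z).mul (hx l z)).prod ((hε z).mul (hshift l z))
  have harg0 : ∀ l, arg l 0 = 0 := fun l => by simp [harg]
  have compa : ∀ {f : ℂ × ℂ → ℂ × ℂ} (l : Fin n), AnalyticAt ℂ f 0 →
      AnalyticAt ℂ (fun z => f (arg l z)) 0 := by
    intro f l hf
    refine AnalyticAt.fun_comp (g := f) (f := arg l) ?_ (harga l 0)
    rw [harg0]; exact hf
  -- For x = εy displaced by ε times the shift at y, equating coefficients of the m-th monomial
  -- gives `E = 0`, after division by ε². Without ε, the value A_m(0) need not be small and b = 0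
  -- would not solve the equation at the origin; the factor ε ^ `axisDegree m` removes this
  -- obstruction.
  set E : (ℂ × (Fin n → ℂ)) × (AxisIndex n → ℂ × ℂ) → AxisIndex n → ℂ × ℂ := fun z m =>
    (axisCoeff z.2 (m, true) • u m.1.1 (arg m.1.1 z) +
      axisCoeff z.2 (m, false) • u m.1.2.1 (arg m.1.2.1 z)) +
    (∑ l, ∑ p, ∑ p', (axisCoeff z.2 p * axisCoeff z.2 p' * c l p p' m z.1.2) • q l (arg l z)) -
    z.1.1 ^ axisDegree m • A m (z.1.1 • z.1.2) with hE
  have hEa : AnalyticAt ℂ E 0 := by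
    rw [analyticAt_pi_iff]
    intro m
    refine AnalyticAt.sub (AnalyticAt.add (AnalyticAt.add ?_ ?_) ?_) ?_
    · exact (hb _ 0).smul (compa _ (hu _))
    · exact (hb _ 0).smul (compa _ (hu _))
    · refine Finset.analyticAt_fun_sum _ fun l _ => Finset.analyticAt_fun_sum _ fun p _ =>
        Finset.analyticAt_fun_sum _ fun p' _ => ?_
      exact (((hb _ 0).mul (hb _ 0)).mul (AnalyticAt.fun_comp (g := c l p p' m)
        (hc l p p' m) (hx2 0))).smul (compa _ (hq l))
    · refine ((hε 0).pow _).smul ?_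
      refine AnalyticAt.fun_comp (g := A m)
        (f := fun z : (ℂ × (Fin n → ℂ)) × (AxisIndex n → ℂ × ℂ) => z.1.1 • z.1.2) ?_
        ((hε 0).smul (hx2 0))
      simpa using hA m
  have hdeg : ∀ m : AxisIndex n, axisDegree m ≠ 0 := fun m => by
    unfold axisDegree; split_ifs <;> simp
  have harg0' : ∀ l b, arg l (0, b) = 0 := fun l b => by simp [harg]
  have hE0b : ∀ b m, E (0, b) m = ((b m).1 • u m.1.1 0 + (b m).2 • u m.1.2.1 0) +
      (∑ l, ∑ p, ∑ p', (axisCoeff b p * axisCoeff b p' * c l p p' m 0) • q l 0) := by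
    intro b m
    simp only [hE, harg0', Prod.fst_zero, Prod.snd_zero, zero_pow (hdeg m), zero_smul, sub_zero,
      axisCoeff, if_true, Bool.false_eq_true, if_false]
  have hE0 : E 0 = 0 := by
    ext1 m
    have := hE0b 0 m
    rw [show ((0, 0) : (ℂ × (Fin n → ℂ)) × (AxisIndex n → ℂ × ℂ)) = 0 from rfl] at this
    rw [this]; simp [axisCoeff]
  have hdet2 : ∀ m : AxisIndex n, wedge (u m.1.1 0) (u m.1.2.1 0) ≠ 0 := by
    intro m
    rw [hu0, hu0]
    have h := hdet _ _ m.2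
    have : wedge ((2 : ℂ) • g m.1.1 0) ((2 : ℂ) • g m.1.2.1 0) =
        4 * wedge (g m.1.1 0) (g m.1.2.1 0) := by
      simp [wedge]; ring
    rw [this]
    exact mul_ne_zero (by norm_num) h
  -- The derivative of `E` in b at the origin. It is block diagonal over the monomials, with block
  -- (a, b) ↦ a u_i(0) + b u_j(0); the quadratic terms contribute nothing.
  let Λ : (AxisIndex n → ℂ × ℂ) ≃L[ℂ] (AxisIndex n → ℂ × ℂ) :=
    ContinuousLinearEquiv.piCongrRight fun m => basisEquiv (u m.1.1 0) (u m.1.2.1 0) (hdet2 m)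
  have hΛ : HasFDerivAt (fun b => E (0, b)) (Λ : (AxisIndex n → ℂ × ℂ) →L[ℂ] _) 0 := by
    rw [hasFDerivAt_pi']
    intro m
    have h1 : HasFDerivAt (fun b : AxisIndex n → ℂ × ℂ =>
        (b m).1 • u m.1.1 0 + (b m).2 • u m.1.2.1 0)
        ((ContinuousLinearMap.proj (R := ℂ) (φ := fun _ : AxisIndex n => ℂ × ℂ) m).comp
          (Λ : (AxisIndex n → ℂ × ℂ) →L[ℂ] _)) 0 := by
      have := ((ContinuousLinearMap.proj (R := ℂ) (φ := fun _ : AxisIndex n => ℂ × ℂ) m).comp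
        (Λ : (AxisIndex n → ℂ × ℂ) →L[ℂ] _)).hasFDerivAt (x := 0)
      exact this
    have h2 : HasFDerivAt (fun b : AxisIndex n → ℂ × ℂ =>
        ∑ l, ∑ p, ∑ p', (axisCoeff b p * axisCoeff b p' * c l p p' m 0) • q l 0)
        (∑ l : Fin n, ∑ p : AxisIndex n × Bool, ∑ p' : AxisIndex n × Bool,
          (0 : (AxisIndex n → ℂ × ℂ) →L[ℂ] ℂ × ℂ)) 0 := by
      refine HasFDerivAt.fun_sum fun l _ => HasFDerivAt.fun_sum fun p _ =>
        HasFDerivAt.fun_sum fun p' _ => ?_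
      obtain ⟨L, hL⟩ := axisCoeff_eq_clm p
      obtain ⟨M, hM⟩ := axisCoeff_eq_clm p'
      simp only [hL, hM]
      exact hasFDerivAt_mul_clm_zero L M _ _
    simp only [hE0b]
    refine (h1.add h2).congr_fderiv ?_
    simp only [Finset.sum_const_zero, add_zero]
  obtain ⟨b, hba, -, hbE⟩ := analytic_implicit hEa hE0 Λ hΛ
  -- choice of a small scaling factor
  have hline : Tendsto (fun ε : ℂ => (ε, (0 : Fin n → ℂ))) (𝓝[≠] 0) (𝓝 0) :=
    ((Continuous.prodMk continuous_id continuous_const).tendsto' (0 : ℂ) _ rfl).mono_left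
      nhdsWithin_le_nhds
  obtain ⟨ε, ⟨hε1, hε2⟩, hε0⟩ := ((hline.eventually
    (hba.eventually_analyticAt.and hbE.eventually_nhds)).and self_mem_nhdsWithin).exists
  have hε0 : ε ≠ 0 := hε0
  have hpair : AnalyticAt ℂ (fun x : Fin n → ℂ => (ε, ε⁻¹ • x)) 0 :=
    analyticAt_const.prod (analyticAt_smul_const_left _ _)
  have hpair0 : (ε, ε⁻¹ • (0 : Fin n → ℂ)) = (ε, 0) := by simp
  -- Undoing the rescaling evaluates `b` near (ε, 0) with ε ≠ 0 fixed. This is why analyticity and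
  -- the equation were required around that point.
  set β : (Fin n → ℂ) → AxisIndex n → ℂ × ℂ := fun x => b (ε, ε⁻¹ • x) with hβ
  have hβa : AnalyticAt ℂ β 0 := by
    refine AnalyticAt.fun_comp (g := b) ?_ hpair
    rw [hpair0]; exact hε1
  set f : (Fin n → ℂ) → Fin n → ℂ := fun x l => x l + ε * axisShift (ε⁻¹ • x) (β x) l with hf
  have hf0 : f 0 = 0 := by ext l; simp [hf, axisShift_zero]
  have hscal : ∀ x, AnalyticAt ℂ (fun x : Fin n → ℂ => ε⁻¹ • x) x := fun x =>
    analyticAt_smul_const_left _ _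
  have hcβ : ∀ p, AnalyticAt ℂ (fun x => axisCoeff (β x) p) 0 := fun p =>
    AnalyticAt.fun_comp (g := fun b => axisCoeff b p) (analyticAt_axisCoeff p _) hβa
  have hfield : ∀ l p, AnalyticAt ℂ (fun x : Fin n → ℂ => axisField l p (ε⁻¹ • x)) 0 := fun l p =>
    AnalyticAt.fun_comp (g := axisField l p) (analyticAt_axisField l p _) (hscal 0)
  have hsh : ∀ l, AnalyticAt ℂ (fun x => ε * axisShift (ε⁻¹ • x) (β x) l) 0 := fun l =>
    analyticAt_const.mul (Finset.analyticAt_fun_sum _ fun p _ => (hcβ p).mul (hfield l p))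
  have hfa : AnalyticAt ℂ f 0 := by
    rw [analyticAt_pi_iff]
    exact fun l => (analyticAt_coord l 0).add (hsh l)
  have hfd : HasFDerivAt f ((ContinuousLinearEquiv.refl ℂ (Fin n → ℂ) :
      (Fin n → ℂ) ≃L[ℂ] (Fin n → ℂ)) : (Fin n → ℂ) →L[ℂ] (Fin n → ℂ)) 0 := by
    rw [hasFDerivAt_pi']
    intro l
    have h1 : HasFDerivAt (fun x : Fin n → ℂ => x l)
        (ContinuousLinearMap.proj (R := ℂ) (φ := fun _ : Fin n => ℂ) l) 0 :=
      (ContinuousLinearMap.proj (R := ℂ) (φ := fun _ : Fin n => ℂ) l).hasFDerivAt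
    have h2 : HasFDerivAt (fun x => ε * axisShift (ε⁻¹ • x) (β x) l)
        (0 : (Fin n → ℂ) →L[ℂ] ℂ) 0 := by
      have h3 : HasFDerivAt (fun y : Fin n → ℂ => axisShift y (β (ε • y)) l)
          (0 : (Fin n → ℂ) →L[ℂ] ℂ) 0 := by
        have := HasFDerivAt.fun_sum (u := Finset.univ) fun p (_ : p ∈ Finset.univ) =>
          hasFDerivAt_mul_axisField (a := fun y : Fin n → ℂ => axisCoeff (β (ε • y)) p) (by
            have h4 : AnalyticAt ℂ (fun y : Fin n → ℂ => ε • y) 0 :=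
              analyticAt_smul_const_left _ _
            refine (AnalyticAt.fun_comp (g := fun x => axisCoeff (β x) p) ?_ h4).differentiableAt
            simpa using hcβ p) l p
        exact this.congr_fderiv Finset.sum_const_zero
      have h4 : HasFDerivAt (fun x : Fin n → ℂ => ε⁻¹ • x)
          (ε⁻¹ • ContinuousLinearMap.id ℂ (Fin n → ℂ)) 0 := (hasFDerivAt_id _).const_smul ε⁻¹
      have h3' : HasFDerivAt (fun y : Fin n → ℂ => axisShift y (β (ε • y)) l)
          (0 : (Fin n → ℂ) →L[ℂ] ℂ) (ε⁻¹ • (0 : Fin n → ℂ)) := by simpa using h3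
      have h5 := (HasFDerivAt.comp (0 : Fin n → ℂ) h3' h4).const_mul ε
      have h6 : (fun x => ε * axisShift (ε⁻¹ • x) (β x) l) = fun x =>
          ε * ((fun y : Fin n → ℂ => axisShift y (β (ε • y)) l) ∘ fun x => ε⁻¹ • x) x := by
        ext x; simp [smul_smul, hε0]
      rw [h6]
      refine h5.congr_fderiv ?_
      ext v; simp
    refine (h1.add h2).congr_fderiv ?_
    ext v; simp
  obtain ⟨φ, hφ⟩ := DiffGerm.exists_of_fderiv hfa hf0 _ hfd
  refine ⟨φ, ?_⟩
  rw [hφ]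
  have hsc0 : Tendsto (fun x : Fin n → ℂ => ε⁻¹ • x) (𝓝 0) (𝓝 0) := by
    simpa using (hscal 0).continuousAt.tendsto
  have hpt : Tendsto (fun x : Fin n → ℂ => (ε, ε⁻¹ • x)) (𝓝 0) (𝓝 (ε, 0)) := by
    simpa using hpair.continuousAt.tendsto
  have hargt : ∀ l, Tendsto (fun x : Fin n → ℂ => (x l, ε * axisShift (ε⁻¹ • x) (β x) l)) (𝓝 0)
      (𝓝 (0 : ℂ × ℂ)) := by
    intro l
    have := ((analyticAt_coord l (0 : Fin n → ℂ)).prod (hsh l)).continuousAt.tendsto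
    have h0 : ((0 : Fin n → ℂ) l, ε * axisShift (ε⁻¹ • (0 : Fin n → ℂ)) (β 0) l) = (0 : ℂ × ℂ) := by
      simp [axisShift_zero]
    rwa [h0] at this
  filter_upwards [hΦ, hpt.eventually hε2, eventually_all.2 fun l => (hargt l).eventually (huq l),
    eventually_all.2 fun l => eventually_all.2 fun p => eventually_all.2 fun p' =>
      hsc0.eventually (hcm l p p')] with x h1 h2 h3 h4
  set y : Fin n → ℂ := ε⁻¹ • x with hy
  have hxy : x = ε • y := by rw [hy, smul_smul, mul_inv_cancel₀ hε0, one_smul]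
  have hargx : ∀ l, arg l ((ε, y), b (ε, y)) = (x l, ε * axisShift y (β x) l) := by
    intro l
    simp only [harg, hβ, ← hy]
    rw [hxy]; rfl
  have hsum1 := sum_axisShift_smul y (β x) fun l => u l (x l, ε * axisShift y (β x) l)
  have hsum2 := sum_axisShift_sq_smul y (β x) (fun l => q l (x l, ε * axisShift y (β x) l))
    (fun l p p' m => c l p p' m y) h4
  have hm : ∀ m, ((β x m).1 • u m.1.1 (x m.1.1, ε * axisShift y (β x) m.1.1) +
      (β x m).2 • u m.1.2.1 (x m.1.2.1, ε * axisShift y (β x) m.1.2.1)) +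
      (∑ l, ∑ p, ∑ p', (axisCoeff (β x) p * axisCoeff (β x) p' * c l p p' m y) •
        q l (x l, ε * axisShift y (β x) l)) = ε ^ axisDegree m • A m x := by
    intro m
    have h5 := congrFun h2 m
    simp only [hE, hargx, axisCoeff, if_true, Bool.false_eq_true, if_false, Pi.zero_apply,
      ← hxy] at h5
    exact sub_eq_zero.1 h5
  rw [h1]
  simp only [hf, ← hy, h3]
  rw [Finset.sum_add_distrib, Finset.sum_add_distrib, add_assoc]
  congr 1
  have e1 : ∑ l, (x l * (ε * axisShift y (β x) l)) • u l (x l, ε * axisShift y (β x) l) =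
      ε ^ 2 • ∑ l, (y l * axisShift y (β x) l) • u l (x l, ε * axisShift y (β x) l) := by
    rw [Finset.smul_sum]
    refine Finset.sum_congr rfl fun l _ => ?_
    rw [smul_smul]
    congr 1
    have : x l = ε * y l := by rw [hxy]; rfl
    rw [this]; ring
  have e2 : ∑ l, (ε * axisShift y (β x) l) ^ 2 • q l (x l, ε * axisShift y (β x) l) =
      ε ^ 2 • ∑ l, axisShift y (β x) l ^ 2 • q l (x l, ε * axisShift y (β x) l) := by
    rw [Finset.smul_sum]
    refine Finset.sum_congr rfl fun l _ => ?_
    rw [smul_smul, mul_pow]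
  rw [e1, e2, hsum1, hsum2, ← smul_add, ← Finset.sum_add_distrib, Finset.smul_sum]
  refine Finset.sum_congr rfl fun m _ => ?_
  have hmono : axisMonomial m x = ε ^ 2 * (ε ^ axisDegree m * axisMonomial m y) := by
    rw [← axisMonomial_smul, ← hxy]
  rw [← smul_add, hm, hmono, smul_smul, smul_smul]
  congr 1; ring

end NormalForm

/-! ### Second-order division and tangency curves. -/

section Straightening

variable {n : ℕ}

/-- Two applications of Hadamard's lemma give K. To identify K 0 on the diagonal, differentiate
f(se) = s² k(s), where k(s) = K (s e) e e, and compare with the first-order quotient of `fderiv ℂ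
f`: after division by s, the value at s = 0 is 2 k(0). -/
theorem exists_second_order_quotient {E F : Type*} [NormedAddCommGroup E] [NormedSpace ℂ E]
    [NormedAddCommGroup F] [NormedSpace ℂ F] [CompleteSpace F] {f : E → F}
    (hf : AnalyticAt ℂ f 0) (h0 : f 0 = 0) (hd : fderiv ℂ f 0 = 0) :
    ∃ K : E → E →L[ℂ] E →L[ℂ] F, AnalyticAt ℂ K 0 ∧ (∀ᶠ x in 𝓝 (0 : E), f x = K x x x) ∧
      ∀ e, (2 : ℂ) • K 0 e e = fderiv ℂ (fderiv ℂ f) 0 e e := by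
  obtain ⟨H, hH, hH0, hfH⟩ := hf.exists_quotient_zero
  obtain ⟨K, hK, -, hHK⟩ := hH.exists_quotient_zero
  obtain ⟨G, hG, hG0, hfG⟩ := hf.fderiv.exists_quotient_zero
  have hfK : ∀ᶠ x in 𝓝 (0 : E), f x = K x x x := by
    filter_upwards [hfH, hHK] with x h1 h2
    rw [h1, h2, h0, hH0, hd]; simp
  refine ⟨K, hK, hfK, fun e => ?_⟩
  have hline : AnalyticAt ℂ (fun s : ℂ => s • e) 0 := analyticAt_id.smul analyticAt_const
  have hl0 : Tendsto (fun s : ℂ => s • e) (𝓝 0) (𝓝 0) := by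
    simpa using hline.continuousAt.tendsto
  have hk : AnalyticAt ℂ (fun s : ℂ => K (s • e) e e) 0 := by
    refine AnalyticAt.clm_apply (AnalyticAt.clm_apply ?_ analyticAt_const) analyticAt_const
    refine AnalyticAt.fun_comp (g := K) ?_ hline
    simpa using hK
  have hg : AnalyticAt ℂ (fun s : ℂ => G (s • e) e e) 0 := by
    refine AnalyticAt.clm_apply (AnalyticAt.clm_apply ?_ analyticAt_const) analyticAt_const
    refine AnalyticAt.fun_comp (g := G) ?_ hline
    simpa using hG
  have key : ∀ᶠ s in 𝓝 (0 : ℂ), G (s • e) e e - ((2 : ℂ) • K (s • e) e e +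
      s • deriv (fun s : ℂ => K (s • e) e e) s) = 0 := by
    refine eventually_eq_zero_of_smul ?_ ?_
    · exact (hg.sub ((analyticAt_const.smul hk).add (analyticAt_id.smul hk.deriv))).continuousAt
    · filter_upwards [hl0.eventually hfK.eventually_nhds, hl0.eventually hfG,
        hl0.eventually hf.eventually_analyticAt, hk.eventually_analyticAt] with s h1 h2 h3 h4
      have hls : HasDerivAt (fun s : ℂ => s • e) e s := by
        simpa using (hasDerivAt_id s).smul_const e
      have d1 : HasDerivAt (fun s : ℂ => f (s • e)) (fderiv ℂ f (s • e) e) s :=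
        h3.differentiableAt.hasFDerivAt.comp_hasDerivAt s hls
      have d2 := ((hasDerivAt_id s).pow 2).smul h4.differentiableAt.hasDerivAt
      have he : (fun s : ℂ => f (s • e)) =ᶠ[𝓝 s] ((id : ℂ → ℂ) ^ 2) • fun s : ℂ => K (s • e) e e := by
        filter_upwards [hls.continuousAt.tendsto.eventually h1] with s' hs'
        rw [hs']; simp [smul_smul, sq]
      have h5 := d1.unique (d2.congr_of_eventuallyEq he)
      rw [h2, hd] at h5
      simp only [map_smul, zero_add, smul_apply] at h5
      rw [smul_sub, h5]
      simp [smul_smul, sq]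
      module
  have h6 := key.self_of_nhds
  simp only [zero_smul, add_zero] at h6
  rw [← sub_eq_zero.1 h6, hG0]

/-- The tangency curve of `Φ` tangent to the `i`-th axis. -/
theorem exists_tangency_curve {Φ : (Fin n → ℂ) → ℂ × ℂ} (hΦ : AnalyticAt ℂ Φ 0)
    (hd : fderiv ℂ Φ 0 = 0) (v : Fin n → ℂ × ℂ)
    (hv : ∀ i j, i ≠ j → wedge (v i) (v j) ≠ 0)
    (hH : ∀ i j, fderiv ℂ (fderiv ℂ Φ) 0 (Pi.single i 1) (Pi.single j 1) =
      if i = j then (2 : ℂ) • v i else 0) (i : Fin n) :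
    ∃ (ζ : ℂ → Fin n → ℂ) (c : Fin n → ℂ → ℂ), AnalyticAt ℂ ζ 0 ∧ ζ 0 = 0 ∧
      (∀ j, AnalyticAt ℂ (c j) 0) ∧ (∀ j, c j 0 = 0) ∧ (∀ t, c i t = 0) ∧
      ∀ j, j ≠ i → ∀ᶠ t in 𝓝 (0 : ℂ),
        fderiv ℂ Φ (t • (Pi.single i 1 + ζ t)) (Pi.single j 1) =
          c j t • fderiv ℂ Φ (t • (Pi.single i 1 + ζ t)) (Pi.single i 1) := by
  obtain ⟨G, hG, hG0, hfG⟩ := hΦ.fderiv.exists_quotient_zero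
  -- For each j ≠ i there are two unknowns: the j-th coordinate of ζ and the proportionality factor
  -- c_j.
  let B := {j : Fin n // j ≠ i} → ℂ × ℂ
  let Z : B →L[ℂ] (Fin n → ℂ) := ∑ j : {j : Fin n // j ≠ i},
    (ContinuousLinearMap.single ℂ (fun _ : Fin n => ℂ) j.1).comp
      ((ContinuousLinearMap.fst ℂ ℂ ℂ).comp
        (ContinuousLinearMap.proj (R := ℂ) (φ := fun _ : {j : Fin n // j ≠ i} => ℂ × ℂ) j))
  have hZ : ∀ b, Z b = ∑ j : {j : Fin n // j ≠ i}, Pi.single j.1 (b j).1 := by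
    intro b
    simp only [Z, sum_apply]
    rfl
  have hDZ : ∀ b j, fderiv ℂ (fderiv ℂ Φ) 0 (Pi.single i 1 + Z b) (Pi.single j.1 1) =
      (b j).1 • (2 : ℂ) • v j.1 := by
    intro b j
    rw [map_add, add_apply, hH, if_neg (Ne.symm j.2), zero_add, hZ, map_sum, sum_apply,
      Finset.sum_eq_single j]
    · rw [show (Pi.single j.1 (b j).1 : Fin n → ℂ) = (b j).1 • Pi.single j.1 1 by
        rw [← Pi.single_smul]; simp, map_smul, smul_apply, hH, if_pos rfl]
    · intro k _ hk
      rw [show (Pi.single k.1 (b k).1 : Fin n → ℂ) = (b k).1 • Pi.single k.1 1 by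
        rw [← Pi.single_smul]; simp, map_smul, smul_apply, hH,
        if_neg (fun h => hk (Subtype.ext h)), smul_zero]
    · simp
  have hDZi : ∀ b, fderiv ℂ (fderiv ℂ Φ) 0 (Pi.single i 1 + Z b) (Pi.single i 1) =
      (2 : ℂ) • v i := by
    intro b
    rw [map_add, add_apply, hH, if_pos rfl, hZ, map_sum, sum_apply, Finset.sum_eq_zero, add_zero]
    intro k _
    rw [show (Pi.single k.1 (b k).1 : Fin n → ℂ) = (b k).1 • Pi.single k.1 1 by
        rw [← Pi.single_smul]; simp, map_smul, smul_apply, hH, if_neg k.2, smul_zero]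
  set w : ℂ × B → (Fin n → ℂ) := fun z => Pi.single i 1 + Z z.2 with hw
  have hwa : ∀ z, AnalyticAt ℂ w z := fun z => analyticAt_const.add
    (AnalyticAt.fun_comp (g := Z) (Z.analyticAt _) analyticAt_snd)
  -- The j-th partial derivative of Φ at t w is t times `P j`. Dividing by t desingularizes the
  -- tangency equations at the origin and separates the n branches.
  set P : Fin n → ℂ × B → ℂ × ℂ := fun j z => G (z.1 • w z) (w z) (Pi.single j 1) with hP
  have hPa : ∀ j, AnalyticAt ℂ (P j) 0 := by
    intro j
    refine AnalyticAt.clm_apply (AnalyticAt.clm_apply ?_ (hwa 0)) analyticAt_const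
    refine AnalyticAt.fun_comp (g := G) (f := fun z => z.1 • w z) ?_
      (analyticAt_fst.smul (hwa 0))
    simpa using hG
  set E : ℂ × B → B := fun z j => P j.1 z - (z.2 j).2 • P i z with hE
  have hEa : AnalyticAt ℂ E 0 := by
    rw [analyticAt_pi_iff]
    intro j
    refine (hPa j.1).sub (AnalyticAt.fun_smul ?_ (hPa i))
    exact ((ContinuousLinearMap.snd ℂ ℂ ℂ).comp
        ((ContinuousLinearMap.proj (R := ℂ) (φ := fun _ : {j : Fin n // j ≠ i} => ℂ × ℂ) j).comp
          (ContinuousLinearMap.snd ℂ ℂ B))).analyticAt 0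
  have hne : ∀ j : {j : Fin n // j ≠ i}, wedge ((2 : ℂ) • v j.1) (-((2 : ℂ) • v i)) ≠ 0 := by
    intro j
    have : wedge ((2 : ℂ) • v j.1) (-((2 : ℂ) • v i)) = -4 * wedge (v j.1) (v i) := by
      simp [wedge]; ring
    rw [this]
    exact mul_ne_zero (by norm_num) (hv _ _ j.2)
  let Λ : B ≃L[ℂ] B := ContinuousLinearEquiv.piCongrRight fun j => basisEquiv _ _ (hne j)
  -- At t = 0 the system is linear in b: its j-th entry is ζ_j (2 v_j) - c_j (2 v_i), invertible
  -- because v_i and v_j are independent.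
  have hE0 : (fun b => E (0, b)) = Λ := by
    ext1 b
    ext1 j
    change P j.1 (0, b) - (b j).2 • P i (0, b) = (b j).1 • _ + (b j).2 • _
    simp only [hP, hw, zero_smul, hG0, hDZ, hDZi]
    rw [smul_neg, sub_eq_add_neg]
  have hE00 : E 0 = 0 := by
    have := congrFun hE0 0
    rw [map_zero] at this
    exact this
  have hΛ : HasFDerivAt (fun b => E (0, b)) (Λ : B →L[ℂ] B) 0 := by
    rw [hE0]; exact Λ.hasFDerivAt
  obtain ⟨b, hb, hb0, hbE⟩ := analytic_implicit hEa hE00 Λ hΛ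
  have hcoord : ∀ j : {j : Fin n // j ≠ i}, AnalyticAt ℂ (fun t => (b t j).2) 0 := fun j =>
    AnalyticAt.fun_comp (g := fun b : B => (b j).2)
      (((ContinuousLinearMap.snd ℂ ℂ ℂ).comp (ContinuousLinearMap.proj (R := ℂ)
        (φ := fun _ : {j : Fin n // j ≠ i} => ℂ × ℂ) j)).analyticAt _) hb
  have hζa : AnalyticAt ℂ (fun t => Z (b t)) 0 := AnalyticAt.fun_comp (g := Z) (Z.analyticAt _) hb
  refine ⟨fun t => Z (b t), fun j t => if h : j ≠ i then (b t ⟨j, h⟩).2 else 0, hζa, ?_, ?_, ?_,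
    ?_, ?_⟩
  · simp only [hb0, map_zero]
  · intro j
    by_cases h : j = i
    · simp only [h, ne_eq, not_true_eq_false, dite_false]; exact analyticAt_const
    · simp only [ne_eq, h, not_false_eq_true, dite_true]; exact hcoord ⟨j, h⟩
  · intro j
    dsimp only
    split_ifs
    · rw [hb0]; rfl
    · rfl
  · intro t; simp
  · intro j hj
    have ht : Tendsto (fun t : ℂ => t • (Pi.single i 1 + Z (b t))) (𝓝 0) (𝓝 0) := by
      have := (analyticAt_id.fun_smul (analyticAt_const.fun_add hζa) : AnalyticAt ℂ
        (fun t : ℂ => t • (Pi.single i (1 : ℂ) + Z (b t))) 0).continuousAt.tendsto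
      simp only [id, zero_smul] at this
      exact this
    filter_upwards [hbE, ht.eventually hfG] with t h1 h2
    have h3 := congrFun h1 ⟨j, hj⟩
    have h4 := sub_eq_zero.1 h3
    simp only [dif_pos hj, h2, hd, zero_add, map_smul, smul_apply]
    rw [smul_comm]
    exact congrArg (t • ·) h4

end Straightening

/-! ### Straightening the tangency curves and the normal form. -/

section Straightening

variable {n : ℕ}

/-- The map `x ↦ ∑ i, γ i (x i)` with `γ i t = t ^ 2 • g i t`. -/
def separatedMap (g : Fin n → ℂ → ℂ × ℂ) (x : Fin n → ℂ) : ℂ × ℂ :=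
  ∑ i, x i ^ 2 • g i (x i)

theorem separatedMap_zero (g : Fin n → ℂ → ℂ × ℂ) : separatedMap g 0 = 0 := by
  simp [separatedMap]

theorem analyticAt_comp_coord {F : Type*} [NormedAddCommGroup F] [NormedSpace ℂ F] {h : ℂ → F}
    (i : Fin n) (x : Fin n → ℂ) (hh : AnalyticAt ℂ h (x i)) :
    AnalyticAt ℂ (fun x : Fin n → ℂ => h (x i)) x :=
  AnalyticAt.fun_comp (g := h) (f := fun x : Fin n → ℂ => x i) hh (analyticAt_coord i x)

theorem analyticAt_separatedMap {g : Fin n → ℂ → ℂ × ℂ} (hg : ∀ i, AnalyticAt ℂ (g i) 0) :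
    AnalyticAt ℂ (separatedMap g) 0 :=
  Finset.analyticAt_fun_sum _ fun i _ =>
    ((analyticAt_coord i 0).fun_pow 2).fun_smul (analyticAt_comp_coord i 0 (hg i))

theorem separatedMap_single (g : Fin n → ℂ → ℂ × ℂ) (i : Fin n) (t : ℂ) :
    separatedMap g (Pi.single i t) = t ^ 2 • g i t := by
  rw [separatedMap, Finset.sum_eq_single i]
  · simp
  · intro k _ hk
    simp [hk]
  · simp

theorem separatedMap_single_add_single (g : Fin n → ℂ → ℂ × ℂ) {i j : Fin n} (hij : i ≠ j)
    (t s : ℂ) :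
    separatedMap g (Pi.single i t + Pi.single j s) = t ^ 2 • g i t + s ^ 2 • g j s := by
  rw [separatedMap, Finset.sum_eq_add i j hij]
  · simp [hij, hij.symm]
  · intro k _ hk
    simp [hk.1, hk.2]
  · simp
  · simp

theorem hasFDerivAt_coord_smul {F : Type*} [NormedAddCommGroup F] [NormedSpace ℂ F]
    {h : (Fin n → ℂ) → F} (hh : DifferentiableAt ℂ h 0) (h0 : h 0 = 0) (l : Fin n) :
    HasFDerivAt (fun x : Fin n → ℂ => x l • h x) (0 : (Fin n → ℂ) →L[ℂ] F) 0 := by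
  have h1 : HasFDerivAt (fun x : Fin n → ℂ => x l)
      (ContinuousLinearMap.proj (R := ℂ) (φ := fun _ : Fin n => ℂ) l) 0 :=
    (ContinuousLinearMap.proj (R := ℂ) (φ := fun _ : Fin n => ℂ) l).hasFDerivAt
  refine (h1.smul hh.hasFDerivAt).congr_fderiv ?_
  ext v
  simp [h0]

theorem hasDerivAt_line (i j : Fin n) (t : ℂ) :
    HasDerivAt (fun s : ℂ => (Pi.single i t + Pi.single j s : Fin n → ℂ)) (Pi.single j 1) 0 :=
  (ContinuousLinearMap.single ℂ (fun _ : Fin n => ℂ) j).hasDerivAt.const_add _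

/-- Coordinates in which the tangency curves are the axes and the differential of the map vanishes
along the `i`-th axis in the directions of the other axes. -/
theorem exists_straightening {Φ : (Fin n → ℂ) → ℂ × ℂ} (ζ : Fin n → ℂ → Fin n → ℂ)
    (c : Fin n → Fin n → ℂ → ℂ) (hζ : ∀ i, AnalyticAt ℂ (ζ i) 0) (hζ0 : ∀ i, ζ i 0 = 0)
    (hc : ∀ i j, AnalyticAt ℂ (c i j) 0) (hc0 : ∀ i j, c i j 0 = 0) (hcd : ∀ i t, c i i t = 0)
    (hcΦ : ∀ i j, j ≠ i → ∀ᶠ t in 𝓝 (0 : ℂ),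
        fderiv ℂ Φ (t • (Pi.single i 1 + ζ i t)) (Pi.single j 1) =
          c i j t • fderiv ℂ Φ (t • (Pi.single i 1 + ζ i t)) (Pi.single i 1)) :
    ∃ θ : DiffGerm (Fin n → ℂ), (∀ i t, θ.toFun (Pi.single i t) = t • (Pi.single i 1 + ζ i t)) ∧
      ∀ i j, j ≠ i → ∀ᶠ t in 𝓝 (0 : ℂ), ∃ w,
        HasDerivAt (fun s : ℂ => θ.toFun (Pi.single i t + Pi.single j s)) w 0 ∧
        fderiv ℂ Φ (θ.toFun (Pi.single i t)) w = 0 := by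
  -- The map x ↦ x + ∑ x_l (ζ_l(x_l) - ∑ d_kl(x_k) e_k) has, at t on the i-th axis, the j-th
  -- derivative (1 - t d_ji'(0)) e_j - d_ij(t) e_i. The differential of Φ kills this vector if
  -- d_ij(t) = c_ij(t) (1 - t d_ji'(0)). Because c_ij(0) = 0, such a d satisfies d_ji'(0) =
  -- c_ji'(0), so the formula is not circular.
  set d : Fin n → Fin n → ℂ → ℂ := fun i j t => c i j t * (1 - deriv (c j i) 0 * t) with hd
  have hda : ∀ i j, AnalyticAt ℂ (d i j) 0 := fun i j =>
    (hc i j).fun_mul (analyticAt_const.fun_sub (analyticAt_const.fun_mul analyticAt_id))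
  have hd0 : ∀ i j, d i j 0 = 0 := fun i j => by simp [hd, hc0]
  have hdd : ∀ i t, d i i t = 0 := fun i t => by simp [hd, hcd]
  have hdder : ∀ i j, HasDerivAt (d i j) (deriv (c i j) 0) 0 := by
    intro i j
    have h1 := (hc i j).differentiableAt.hasDerivAt.fun_mul
      (((hasDerivAt_id (0 : ℂ)).const_mul (deriv (c j i) 0)).const_sub 1)
    convert! h1 using 1
    simp [hc0]
  set h : Fin n → (Fin n → ℂ) → (Fin n → ℂ) :=
    fun l x => ζ l (x l) - ∑ k, d k l (x k) • Pi.single k (1 : ℂ) with hh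
  have hha : ∀ l, AnalyticAt ℂ (h l) 0 := fun l =>
    (analyticAt_comp_coord l 0 (hζ l)).fun_sub (Finset.analyticAt_fun_sum _ fun k _ =>
      (analyticAt_comp_coord k 0 (hda k l)).fun_smul analyticAt_const)
  have hh0 : ∀ l, h l 0 = 0 := fun l => by simp [hh, hζ0, hd0]
  set f : (Fin n → ℂ) → (Fin n → ℂ) := fun x => x + ∑ l, x l • h l x with hf
  have hfa : AnalyticAt ℂ f 0 := analyticAt_id.fun_add
    (Finset.analyticAt_fun_sum _ fun l _ => (analyticAt_coord l 0).fun_smul (hha l))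
  have hf0 : f 0 = 0 := by simp [hf]
  have hfd : HasFDerivAt f ((ContinuousLinearEquiv.refl ℂ (Fin n → ℂ) :
      (Fin n → ℂ) ≃L[ℂ] (Fin n → ℂ)) : (Fin n → ℂ) →L[ℂ] (Fin n → ℂ)) 0 := by
    refine ((hasFDerivAt_id (0 : Fin n → ℂ)).fun_add (HasFDerivAt.fun_sum (u := Finset.univ)
      fun l _ => hasFDerivAt_coord_smul (hha l).differentiableAt (hh0 l) l)).congr_fderiv ?_
    ext v; simp
  have hfs : ∀ i t, f (Pi.single i t) = t • (Pi.single i 1 + ζ i t) := by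
    intro i t
    have h1 : h i (Pi.single i t) = ζ i t := by
      simp only [hh, Pi.single_eq_same]
      rw [Finset.sum_eq_zero, sub_zero]
      intro k _
      by_cases hk : k = i
      · subst hk; simp [hdd]
      · simp [hk, hd0]
    simp only [hf]
    rw [sum_single_smul i t (fun l => h l (Pi.single i t)), h1, smul_add, ← Pi.single_smul]
    simp
  have hfss : ∀ i j, j ≠ i → ∀ t s, f (Pi.single i t + Pi.single j s) =
      (Pi.single i t + Pi.single j s) + (t • (ζ i t - d j i s • Pi.single j (1 : ℂ)) +
        s • (ζ j s - d i j t • Pi.single i (1 : ℂ))) := by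
    intro i j hij t s
    simp only [hf]
    have h0 := sum_single_add_single_smul i j t s
      (fun l => h l (Pi.single i t + Pi.single j s : Fin n → ℂ))
    rw [h0]
    have h1 : h i (Pi.single i t + Pi.single j s) = ζ i t - d j i s • Pi.single j (1 : ℂ) := by
      simp only [hh]
      rw [Finset.sum_eq_single j]
      · simp [hij, hij.symm]
      · intro k _ hk
        by_cases hki : k = i
        · subst hki; simp [hdd]
        · simp [hk, hki, hd0]
      · simp
    have h2 : h j (Pi.single i t + Pi.single j s) = ζ j s - d i j t • Pi.single i (1 : ℂ) := by
      simp only [hh]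
      rw [Finset.sum_eq_single i]
      · simp [hij, hij.symm]
      · intro k _ hk
        by_cases hki : k = j
        · subst hki; simp [hdd]
        · simp [hk, hki, hd0]
      · simp
    rw [h1, h2]
  obtain ⟨θ, hθ⟩ := DiffGerm.exists_of_fderiv hfa hf0 _ hfd
  refine ⟨θ, ?_, ?_⟩
  · rw [hθ]; exact hfs
  · rw [hθ]
    intro i j hij
    filter_upwards [hcΦ i j hij] with t ht
    refine ⟨Pi.single j 1 + (t • (0 - deriv (c j i) 0 • Pi.single j (1 : ℂ)) +
      (ζ j 0 - d i j t • Pi.single i (1 : ℂ))), ?_, ?_⟩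
    · simp only [hfss i j hij]
      refine (hasDerivAt_line i j t).fun_add (HasDerivAt.fun_add ?_ ?_)
      · exact ((hasDerivAt_const (0 : ℂ) (ζ i t)).fun_sub
          ((hdder j i).smul_const (Pi.single j (1 : ℂ) : Fin n → ℂ))).fun_const_smul t
      · have h1 := (hasDerivAt_id (0 : ℂ)).fun_smul ((hζ j).differentiableAt.hasDerivAt.fun_sub
          (hasDerivAt_const (0 : ℂ) (d i j t • (Pi.single i (1 : ℂ) : Fin n → ℂ))))
        refine h1.congr_deriv ?_
        simp
    · rw [hfs, hζ0]
      simp only [map_add, map_smul, zero_sub, map_neg, ht, hd]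
      module

/-- **Normal form.** A germ with vanishing differential whose Hessian is diagonal with pairwise
independent diagonal entries is right equivalent to a sum of functions of one variable. -/
theorem exists_normal_form {Φ : (Fin n → ℂ) → ℂ × ℂ} (hΦ : AnalyticAt ℂ Φ 0) (h0 : Φ 0 = 0)
    (hd : fderiv ℂ Φ 0 = 0) (v : Fin n → ℂ × ℂ)
    (hv : ∀ i j, i ≠ j → wedge (v i) (v j) ≠ 0)
    (hH : ∀ i j, fderiv ℂ (fderiv ℂ Φ) 0 (Pi.single i 1) (Pi.single j 1) =
      if i = j then (2 : ℂ) • v i else 0) :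
    ∃ (φ : DiffGerm (Fin n → ℂ)) (g : Fin n → ℂ → ℂ × ℂ), (∀ i, AnalyticAt ℂ (g i) 0) ∧
      (∀ i, g i 0 = v i) ∧ ∀ᶠ x in 𝓝 (0 : Fin n → ℂ), Φ (φ.toFun x) = separatedMap g x := by
  choose ζ c hζ hζ0 hc hc0 hcd hcΦ using exists_tangency_curve hΦ hd v hv hH
  obtain ⟨θ, hθ, hθd⟩ := exists_straightening ζ c hζ hζ0 hc hc0 hcd hcΦ
  obtain ⟨K, hK, hΦK, hK0⟩ := exists_second_order_quotient hΦ h0 hd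
  -- Φ along the i-th tangency curve, divided by t².
  set g : Fin n → ℂ → ℂ × ℂ := fun i t =>
    K (t • (Pi.single i 1 + ζ i t)) (Pi.single i 1 + ζ i t) (Pi.single i 1 + ζ i t) with hg
  have hwa : ∀ i, AnalyticAt ℂ (fun t => (Pi.single i 1 + ζ i t : Fin n → ℂ)) 0 := fun i =>
    analyticAt_const.fun_add (hζ i)
  have htw : ∀ i, AnalyticAt ℂ (fun t : ℂ => t • (Pi.single i 1 + ζ i t : Fin n → ℂ)) 0 := fun i =>
    analyticAt_id.fun_smul (hwa i)
  have hga : ∀ i, AnalyticAt ℂ (g i) 0 := by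
    intro i
    refine AnalyticAt.clm_apply (AnalyticAt.clm_apply ?_ (hwa i)) (hwa i)
    refine AnalyticAt.fun_comp (g := K) ?_ (htw i)
    simpa using hK
  have hg0 : ∀ i, g i 0 = v i := by
    intro i
    have h1 := hK0 (Pi.single i 1)
    rw [hH, if_pos rfl] at h1
    have h2 := smul_right_injective (ℂ × ℂ) (two_ne_zero (α := ℂ)) h1
    simpa [hg, hζ0] using h2
  set f : (Fin n → ℂ) → ℂ × ℂ := fun x => Φ (θ.toFun x) - separatedMap g x with hf
  have hΦθ : AnalyticAt ℂ (fun x => Φ (θ.toFun x)) 0 := by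
    refine AnalyticAt.fun_comp (g := Φ) ?_ θ.analytic_toFun
    rw [θ.toFun_zero]; exact hΦ
  have hfa : AnalyticAt ℂ f 0 := hΦθ.fun_sub (analyticAt_separatedMap hga)
  have hf0 : f 0 = 0 := by simp [hf, θ.toFun_zero, h0, separatedMap_zero]
  have hfax : ∀ i, ∀ᶠ t in 𝓝 (0 : ℂ), f (Pi.single i t) = 0 := by
    intro i
    have ht : Tendsto (fun t : ℂ => t • (Pi.single i 1 + ζ i t : Fin n → ℂ)) (𝓝 0) (𝓝 0) := by
      simpa using (htw i).continuousAt.tendsto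
    filter_upwards [ht.eventually hΦK] with t h1
    simp only [hf, hθ, separatedMap_single, h1, map_smul, smul_apply, hg, smul_smul, sq, sub_self]
  have hfd : ∀ i, ∀ᶠ t in 𝓝 (0 : ℂ), fderiv ℂ f (Pi.single i t) = 0 := by
    intro i
    have hθt : Tendsto (fun t : ℂ => θ.toFun (Pi.single i t)) (𝓝 0) (𝓝 0) :=
      θ.tendsto_toFun.comp (tendsto_single i)
    have hall : ∀ᶠ t in 𝓝 (0 : ℂ), ∀ j, j ≠ i → ∃ w,
        HasDerivAt (fun s : ℂ => θ.toFun (Pi.single i t + Pi.single j s)) w 0 ∧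
        fderiv ℂ Φ (θ.toFun (Pi.single i t)) w = 0 :=
      eventually_all.2 fun j => by
        by_cases hj : j = i
        · exact Eventually.of_forall fun t h => (h hj).elim
        · exact (hθd i j hj).mono fun t h _ => h
    filter_upwards [(hfax i).eventually_nhds, (tendsto_single i).eventually hfa.eventually_analyticAt,
      hθt.eventually hΦ.eventually_analyticAt, hall] with t h1 h2 h3 h4
    have hder := h2.differentiableAt.hasFDerivAt
    ext1 v
    rw [ContinuousLinearMap.apply_eq_sum_single, zero_apply]
    refine Finset.sum_eq_zero fun j _ => ?_
    -- Along the i-th axis the i-th derivative vanishes because f does. For j ≠ i the j-th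
    -- derivatives of Φ ∘ θ and of the separated sum vanish separately, the former by straightening
    -- and the latter because γ_j'(0) = 0.
    suffices hs : fderiv ℂ f (Pi.single i t) (Pi.single j 1) = 0 by rw [hs, smul_zero]
    by_cases hj : j = i
    · subst hj
      have hs : HasDerivAt (fun s : ℂ => (Pi.single j s : Fin n → ℂ)) (Pi.single j 1) t :=
        (ContinuousLinearMap.single ℂ (fun _ : Fin n => ℂ) j).hasDerivAt
      have d1 := hder.comp_hasDerivAt t hs
      exact d1.unique ((hasDerivAt_const t (0 : ℂ × ℂ)).congr_of_eventuallyEq h1)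
    · obtain ⟨w, hw1, hw2⟩ := h4 j hj
      have hz : (Pi.single i t + Pi.single j (0 : ℂ) : Fin n → ℂ) = Pi.single i t := by simp
      have d1 : HasDerivAt (fun s : ℂ => f (Pi.single i t + Pi.single j s))
          (fderiv ℂ f (Pi.single i t) (Pi.single j 1)) 0 := by
        rw [← hz] at hder
        have := hder.comp_hasDerivAt (0 : ℂ) (hasDerivAt_line i j t)
        rw [hz] at this
        exact this
      have d2 : HasDerivAt (fun s : ℂ => Φ (θ.toFun (Pi.single i t + Pi.single j s))) 0 0 := by
        have h5 := h3.differentiableAt.hasFDerivAt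
        have h6 : HasFDerivAt Φ (fderiv ℂ Φ (θ.toFun (Pi.single i t)))
            (θ.toFun (Pi.single i t + Pi.single j (0 : ℂ))) := by rw [hz]; exact h5
        have := h6.comp_hasDerivAt (0 : ℂ) hw1
        rw [hw2] at this
        exact this
      have d3 : HasDerivAt (fun s : ℂ => separatedMap g (Pi.single i t + Pi.single j s)) 0 0 := by
        simp only [separatedMap_single_add_single g (Ne.symm hj)]
        have h5 := (hasDerivAt_const (0 : ℂ) (t ^ 2 • g i t)).fun_add
          (((hasDerivAt_id (0 : ℂ)).fun_pow 2).fun_smul (hga j).differentiableAt.hasDerivAt)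
        refine h5.congr_deriv ?_
        simp
      have := d1.unique (d2.fun_sub d3)
      rw [this, sub_zero]
  obtain ⟨A, hA, hfA⟩ := exists_sum_axisMonomial hfa hf0 hfax hfd
  obtain ⟨φ, hφ⟩ := exists_diffGerm_of_axis_remainder g hga
    (fun i j hij => by rw [hg0, hg0]; exact hv i j hij) A hA (fun x => Φ (θ.toFun x)) (by
      filter_upwards [hfA] with x hx
      rw [← hx]; simp [hf, separatedMap])
  refine ⟨θ.comp φ.symm, g, hga, hg0, ?_⟩
  filter_upwards [φ.tendsto_invFun.eventually hφ, φ.right_inv] with x h1 h2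
  change Φ (θ.toFun (φ.invFun x)) = _
  rw [← h1, h2]
  rfl

end Straightening

/-! ### From generic maps to separated maps and back. -/

section Generic

variable {n : ℕ}

theorem DiffGerm.fderiv_comp_fderiv {E : Type*} [NormedAddCommGroup E] [NormedSpace ℂ E]
    (φ : DiffGerm E) (v : E) : fderiv ℂ φ.toFun 0 (fderiv ℂ φ.invFun 0 v) = v := by
  have h1 : HasFDerivAt φ.toFun (fderiv ℂ φ.toFun 0) (φ.invFun 0) := by
    rw [φ.invFun_zero]; exact φ.analytic_toFun.differentiableAt.hasFDerivAt
  have h2 := h1.comp (0 : E) φ.analytic_invFun.differentiableAt.hasFDerivAt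
  have h3 : HasFDerivAt (id : E → E) _ 0 :=
    h2.congr_of_eventuallyEq (by filter_upwards [φ.right_inv] with x hx using hx.symm)
  exact congrArg (fun A : E →L[ℂ] E => A v) (h3.unique (hasFDerivAt_id (0 : E)))

/-- The scalar factor is the determinant of A. -/
theorem wedge_map (A : ℂ × ℂ →L[ℂ] ℂ × ℂ) (v w : ℂ × ℂ) :
    wedge (A v) (A w) = wedge (A (1, 0)) (A (0, 1)) * wedge v w := by
  have h : ∀ z : ℂ × ℂ, A z = z.1 • A (1, 0) + z.2 • A (0, 1) := by
    intro z
    rw [← map_smul, ← map_smul, ← map_add]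
    simp
  rw [h v, h w]
  simp only [wedge, Prod.fst_add, Prod.snd_add, Prod.smul_fst, Prod.smul_snd, smul_eq_mul]
  ring

theorem DiffGerm.wedge_fderiv_ne_zero (ψ : DiffGerm (ℂ × ℂ)) {v w : ℂ × ℂ} (h : wedge v w ≠ 0) :
    wedge (fderiv ℂ ψ.toFun 0 v) (fderiv ℂ ψ.toFun 0 w) ≠ 0 := by
  intro h0
  apply h
  have h1 := wedge_map (fderiv ℂ ψ.invFun 0) (fderiv ℂ ψ.toFun 0 v) (fderiv ℂ ψ.toFun 0 w)
  rw [h0, mul_zero] at h1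
  have := ψ.symm.fderiv_comp_fderiv
  simp only [DiffGerm.symm] at this
  rwa [this, this] at h1

theorem DiffGerm.fderiv_ne_zero {E : Type*} [NormedAddCommGroup E] [NormedSpace ℂ E]
    (φ : DiffGerm E) {v : E} (h : v ≠ 0) : fderiv ℂ φ.toFun 0 v ≠ 0 := by
  intro h0
  have := φ.symm.fderiv_comp_fderiv v
  simp only [DiffGerm.symm] at this
  rw [h0, map_zero] at this
  exact h this.symm

section Hessian

variable {E F G : Type*} [NormedAddCommGroup E] [NormedSpace ℂ E] [CompleteSpace E]
  [NormedAddCommGroup F] [NormedSpace ℂ F] [CompleteSpace F]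
  [NormedAddCommGroup G] [NormedSpace ℂ G] [CompleteSpace G]

/-- In the chain rule for the second derivative, the term containing the second derivative of ψ is
multiplied by the differential of f, which is 0 at the point. -/
theorem hessian_comp_of_critical {ψ : F → G} {f : E → F} (hψ : AnalyticAt ℂ ψ 0)
    (hf : AnalyticAt ℂ f 0) (h0 : f 0 = 0) (hd : fderiv ℂ f 0 = 0) :
    fderiv ℂ (fun x => ψ (f x)) 0 = 0 ∧ ∀ u w, fderiv ℂ (fderiv ℂ (fun x => ψ (f x))) 0 u w =
      fderiv ℂ ψ 0 (fderiv ℂ (fderiv ℂ f) 0 u w) := by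
  have hft : Tendsto f (𝓝 0) (𝓝 0) := by simpa [h0] using hf.continuousAt.tendsto
  have h1 : ∀ᶠ x in 𝓝 (0 : E), fderiv ℂ (fun x => ψ (f x)) x =
      (fderiv ℂ ψ (f x)).comp (fderiv ℂ f x) := by
    filter_upwards [hft.eventually hψ.eventually_analyticAt, hf.eventually_analyticAt] with x h1 h2
    exact (h1.differentiableAt.hasFDerivAt.comp x h2.differentiableAt.hasFDerivAt).fderiv
  constructor
  · rw [h1.self_of_nhds, hd]; simp
  · intro u w
    have h2 : DifferentiableAt ℂ (fun x => fderiv ℂ ψ (f x)) 0 := by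
      refine (AnalyticAt.fun_comp (g := fderiv ℂ ψ) ?_ hf).differentiableAt
      rw [h0]; exact hψ.fderiv
    have h3 := h2.hasFDerivAt.clm_comp hf.fderiv.differentiableAt.hasFDerivAt
    have h4 := (h3.congr_of_eventuallyEq h1).fderiv
    rw [h4]
    simp [hd, h0]

theorem hessian_comp_linear {f : F → G} (hf : AnalyticAt ℂ f 0) (L : E →L[ℂ] F) :
    fderiv ℂ (fun x => f (L x)) 0 = (fderiv ℂ f 0).comp L ∧
      ∀ u w, fderiv ℂ (fderiv ℂ (fun x => f (L x))) 0 u w =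
        fderiv ℂ (fderiv ℂ f) 0 (L u) (L w) := by
  have hLt : Tendsto L (𝓝 0) (𝓝 0) := by simpa using L.continuous.tendsto 0
  have h1 : ∀ᶠ x in 𝓝 (0 : E), fderiv ℂ (fun x => f (L x)) x = (fderiv ℂ f (L x)).comp L := by
    filter_upwards [hLt.eventually hf.eventually_analyticAt] with x h1
    exact (h1.differentiableAt.hasFDerivAt.comp x L.hasFDerivAt).fderiv
  refine ⟨by rw [h1.self_of_nhds, map_zero], fun u w => ?_⟩
  have h2 : HasFDerivAt (fderiv ℂ f) (fderiv ℂ (fderiv ℂ f) 0) (L 0) := by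
    rw [map_zero]; exact hf.fderiv.differentiableAt.hasFDerivAt
  have h3 := (h2.comp (0 : E) L.hasFDerivAt).clm_comp (hasFDerivAt_const L (0 : E))
  have h4 := (h3.congr_of_eventuallyEq h1).fderiv
  rw [h4]
  simp

end Hessian

/-- The derivative of `t ^ 2 • g i t` divided by `t`. -/
def separatedDeriv (g : Fin n → ℂ → ℂ × ℂ) (i : Fin n) (t : ℂ) : ℂ × ℂ :=
  (2 : ℂ) • g i t + t • deriv (g i) t

theorem analyticAt_separatedDeriv {g : Fin n → ℂ → ℂ × ℂ} (hg : ∀ i, AnalyticAt ℂ (g i) 0)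
    (i : Fin n) : AnalyticAt ℂ (separatedDeriv g i) 0 :=
  (analyticAt_const.fun_smul (hg i)).fun_add (analyticAt_id.fun_smul (hg i).deriv)

theorem separatedDeriv_zero (g : Fin n → ℂ → ℂ × ℂ) (i : Fin n) :
    separatedDeriv g i 0 = (2 : ℂ) • g i 0 := by
  simp [separatedDeriv]

theorem fderiv_separatedMap {g : Fin n → ℂ → ℂ × ℂ} (hg : ∀ i, AnalyticAt ℂ (g i) 0) :
    ∀ᶠ x in 𝓝 (0 : Fin n → ℂ), ∀ j, fderiv ℂ (separatedMap g) x (Pi.single j 1) =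
      x j • separatedDeriv g j (x j) := by
  filter_upwards [eventually_all.2 fun i =>
    (tendsto_coord i).eventually (hg i).eventually_analyticAt] with x hx j
  have h1 : ∀ i, HasFDerivAt (fun x : Fin n → ℂ => x i ^ 2 • g i (x i))
      ((ContinuousLinearMap.toSpanSingleton ℂ (x i • separatedDeriv g i (x i))).comp
        (ContinuousLinearMap.proj (R := ℂ) (φ := fun _ : Fin n => ℂ) i)) x := by
    intro i
    have h2 := ((hasDerivAt_id (x i)).fun_pow 2).fun_smul (hx i).differentiableAt.hasDerivAt
    have h3 : HasDerivAt (fun t : ℂ => t ^ 2 • g i t) (x i • separatedDeriv g i (x i)) (x i) := by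
      refine h2.congr_deriv ?_
      simp only [separatedDeriv, id]
      push_cast
      module
    exact HasFDerivAt.comp x h3.hasFDerivAt
      (ContinuousLinearMap.proj (R := ℂ) (φ := fun _ : Fin n => ℂ) i).hasFDerivAt
  have h2 := (HasFDerivAt.fun_sum (u := Finset.univ) fun i _ => h1 i).fderiv
  change fderiv ℂ (fun x : Fin n → ℂ => ∑ i, x i ^ 2 • g i (x i)) x (Pi.single j 1) = _
  rw [h2, sum_apply, Finset.sum_eq_single j]
  · simp
  · intro k _ hk
    simp [hk]
  · simp

theorem fderiv_separatedMap_zero {g : Fin n → ℂ → ℂ × ℂ} (hg : ∀ i, AnalyticAt ℂ (g i) 0) :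
    fderiv ℂ (separatedMap g) 0 = 0 := by
  ext1 v
  rw [ContinuousLinearMap.apply_eq_sum_single, zero_apply]
  refine Finset.sum_eq_zero fun j _ => ?_
  rw [(fderiv_separatedMap hg).self_of_nhds j]
  simp

theorem hessian_separatedMap {g : Fin n → ℂ → ℂ × ℂ} (hg : ∀ i, AnalyticAt ℂ (g i) 0)
    (i j : Fin n) : fderiv ℂ (fderiv ℂ (separatedMap g)) 0 (Pi.single i 1) (Pi.single j 1) =
      if i = j then (2 : ℂ) • g i 0 else 0 := by
  have hs : HasDerivAt (fun s : ℂ => (Pi.single i s : Fin n → ℂ)) (Pi.single i 1) 0 :=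
    (ContinuousLinearMap.single ℂ (fun _ : Fin n => ℂ) i).hasDerivAt
  have h1 : HasFDerivAt (fderiv ℂ (separatedMap g)) (fderiv ℂ (fderiv ℂ (separatedMap g)) 0)
      (Pi.single i 0) := by
    rw [Pi.single_zero]
    exact (analyticAt_separatedMap hg).fderiv.differentiableAt.hasFDerivAt
  have h2 := (h1.comp_hasDerivAt (0 : ℂ) hs).clm_apply (hasDerivAt_const (0 : ℂ) (Pi.single j 1))
  rw [map_zero, add_zero] at h2
  refine h2.unique ?_
  have h3 : HasDerivAt (fun s : ℂ => (Pi.single i s : Fin n → ℂ) j •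
      separatedDeriv g j ((Pi.single i s : Fin n → ℂ) j)) (if i = j then (2 : ℂ) • g i 0 else 0) 0 := by
    by_cases hij : i = j
    · subst hij
      simp only [Pi.single_eq_same, if_true]
      refine ((hasDerivAt_id (0 : ℂ)).fun_smul
        (analyticAt_separatedDeriv hg i).differentiableAt.hasDerivAt).congr_deriv ?_
      simp [separatedDeriv_zero]
    · simp only [Pi.single_eq_of_ne (Ne.symm hij), zero_smul, hij, if_false]
      exact hasDerivAt_const _ _
  refine h3.congr_of_eventuallyEq ?_
  filter_upwards [(tendsto_single i).eventually (fderiv_separatedMap hg)] with s hs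
  exact hs j

/-- The data of a normal form: germs `γ i t = t ^ 2 • g i t` with pairwise distinct tangents. -/
structure IsSeparated (g : Fin n → ℂ → ℂ × ℂ) : Prop where
  analytic : ∀ i, AnalyticAt ℂ (g i) 0
  ne_zero : ∀ i, g i 0 ≠ 0
  wedge_ne_zero : ∀ i j, i ≠ j → wedge (g i 0) (g j 0) ≠ 0

/-- The Hessian of ψ ∘ `separatedMap g` is again diagonal, with entries 2 dψ(g_i(0)), and these
remain pairwise independent because dψ is invertible. The normal form therefore applies again. -/
theorem IsSeparated.exists_comp {g : Fin n → ℂ → ℂ × ℂ} (hg : IsSeparated g)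
    (ψ : DiffGerm (ℂ × ℂ)) : ∃ (φ : DiffGerm (Fin n → ℂ)) (g' : Fin n → ℂ → ℂ × ℂ),
      IsSeparated g' ∧ ∀ᶠ x in 𝓝 (0 : Fin n → ℂ),
        ψ.toFun (separatedMap g (φ.toFun x)) = separatedMap g' x := by
  have ha := analyticAt_separatedMap hg.analytic
  obtain ⟨h1, h2⟩ := hessian_comp_of_critical ψ.analytic_toFun ha (separatedMap_zero g)
    (fderiv_separatedMap_zero hg.analytic)
  have hw : ∀ i j, i ≠ j →
      wedge (fderiv ℂ ψ.toFun 0 (g i 0)) (fderiv ℂ ψ.toFun 0 (g j 0)) ≠ 0 := fun i j hij =>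
    ψ.wedge_fderiv_ne_zero (hg.wedge_ne_zero i j hij)
  obtain ⟨φ, g', hg', hg0, h⟩ := exists_normal_form (Φ := fun x => ψ.toFun (separatedMap g x)) (by
    refine AnalyticAt.fun_comp (g := ψ.toFun) ?_ ha
    rw [separatedMap_zero]; exact ψ.analytic_toFun)
    (by simp only [separatedMap_zero, ψ.toFun_zero]) h1 (fun i => fderiv ℂ ψ.toFun 0 (g i 0)) hw
    (by
      intro i j
      rw [h2, hessian_separatedMap hg.analytic]
      split_ifs
      · rw [map_smul]
      · rw [map_zero])
  refine ⟨φ, g', ⟨hg', fun i => ?_, fun i j hij => ?_⟩, h⟩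
  · rw [hg0]; exact ψ.fderiv_ne_zero (hg.ne_zero i)
  · rw [hg0, hg0]; exact hw i j hij

/-- Polarization. -/
theorem bilin_single_of_diagonal (B : (Fin n → ℂ) →L[ℂ] (Fin n → ℂ) →L[ℂ] ℂ)
    (hB : ∀ u v, B u v = B v u) (l : Fin n → ℂ) (h : ∀ x, (1 / 2 : ℂ) * B x x = ∑ i, l i * x i ^ 2)
    (i j : Fin n) : B (Pi.single i 1) (Pi.single j 1) = if i = j then 2 * l i else 0 := by
  have hdiag : ∀ i, B (Pi.single i 1) (Pi.single i 1) = 2 * l i := by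
    intro i
    have h1 := h (Pi.single i 1)
    rw [Finset.sum_eq_single i (by intro k _ hk; simp [hk]) (by simp)] at h1
    simp only [Pi.single_eq_same, one_pow, mul_one] at h1
    linear_combination 2 * h1
  by_cases hij : i = j
  · subst hij; rw [if_pos rfl, hdiag]
  · rw [if_neg hij]
    have h1 := h (Pi.single i 1 + Pi.single j 1)
    rw [Finset.sum_eq_add i j hij (by intro k _ hk; simp [hk.1, hk.2]) (by simp) (by simp)] at h1
    simp only [map_add, add_apply, hdiag, hB (Pi.single j 1) (Pi.single i 1), Pi.add_apply,
      Pi.single_eq_same, Pi.single_eq_of_ne hij, Pi.single_eq_of_ne (Ne.symm hij)] at h1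
    linear_combination h1

theorem bilin_apply_of_single (B : (Fin n → ℂ) →L[ℂ] (Fin n → ℂ) →L[ℂ] ℂ) (l : Fin n → ℂ)
    (h : ∀ i j, B (Pi.single i 1) (Pi.single j 1) = if i = j then 2 * l i else 0)
    (x y : Fin n → ℂ) : B x y = ∑ i, 2 * l i * (x i * y i) := by
  rw [ContinuousLinearMap.apply_eq_sum_single B x, sum_apply]
  refine Finset.sum_congr rfl fun i _ => ?_
  rw [smul_apply, ContinuousLinearMap.apply_eq_sum_single, Finset.sum_eq_single i]
  · rw [h, if_pos rfl]; simp only [smul_eq_mul]; ring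
  · intro k _ hk
    rw [h, if_neg (Ne.symm hk), smul_zero]
  · simp

/-- In the diagonalizing coordinates the Hessian entries are 2 (1, l_i), and the determinant of (1,
l_i) and (1, l_j) is l_j - l_i ≠ 0. -/
theorem exists_separated_of_generic {Φ : (Fin n → ℂ) → ℂ × ℂ} (hΦ : IsAGeneric Φ) :
    ∃ (φ : DiffGerm (Fin n → ℂ)) (g : Fin n → ℂ → ℂ × ℂ), IsSeparated g ∧
      ∀ᶠ x in 𝓝 (0 : Fin n → ℂ), Φ (φ.toFun x) = separatedMap g x := by
  obtain ⟨hf, hg, L, l, hl, hL⟩ := hΦ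
  have hΦa : AnalyticAt ℂ Φ 0 := hf.analytic.prod hg.analytic
  have hΦd : fderiv ℂ Φ 0 = 0 := by
    have h1 := (hf.analytic.differentiableAt.hasFDerivAt.prodMk
      hg.analytic.differentiableAt.hasFDerivAt).fderiv
    rw [hf.critical, hg.critical] at h1
    exact h1
  have hΦ0 : Φ 0 = 0 := Prod.ext hf.map_zero hg.map_zero
  let M := L.toContinuousLinearEquiv
  have hM : ∀ x, M x = L x := fun x => rfl
  obtain ⟨μ, hμ⟩ := DiffGerm.exists_of_fderiv (M.analyticAt 0) (map_zero M) M M.hasFDerivAt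
  obtain ⟨hd, hH⟩ := hessian_comp_linear hΦa (M : (Fin n → ℂ) →L[ℂ] (Fin n → ℂ))
  have hcomp : ∀ {p : ℂ × ℂ →L[ℂ] ℂ} {l : Fin n → ℂ},
      (∀ x, quadraticPart (fun x => p (Φ x)) (L x) = ∑ i, l i * x i ^ 2) → ∀ i j,
      p (fderiv ℂ (fderiv ℂ Φ) 0 (M (Pi.single i 1)) (M (Pi.single j 1))) =
        if i = j then 2 * l i else 0 := by
    intro p l h i j
    have ha : AnalyticAt ℂ (fun x => p (Φ (M x))) 0 := by
      refine AnalyticAt.fun_comp (g := fun y => p (Φ y)) ?_ (M.analyticAt 0)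
      rw [map_zero]
      exact AnalyticAt.fun_comp (g := p) (p.analyticAt _) hΦa
    have hsym := ha.contDiffAt (n := ⊤) |>.isSymmSndFDerivAt (by simp)
    have hp := (hessian_comp_of_critical (p.analyticAt 0) hΦa hΦ0 hΦd).2
    have hp2 := (hessian_comp_linear (f := fun y => p (Φ y))
      (AnalyticAt.fun_comp (g := p) (p.analyticAt _) hΦa) (M : (Fin n → ℂ) →L[ℂ] (Fin n → ℂ))).2
    have h1 := bilin_single_of_diagonal (fderiv ℂ (fderiv ℂ (fun x => p (Φ (M x)))) 0)
      (fun u v => hsym u v) l (fun x => by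
        rw [← h]
        exact congrArg ((1 / 2 : ℂ) * ·) (hp2 x x)) i j
    rw [← h1]
    rw [ContinuousLinearMap.fderiv] at hp
    rw [← hp]
    exact (hp2 _ _).symm
  have hw : ∀ i j, i ≠ j → wedge ((1 : ℂ), l i) (1, l j) ≠ 0 := by
    intro i j hij h
    simp only [wedge, one_mul, mul_one] at h
    exact hij (hl (sub_eq_zero.1 h).symm)
  obtain ⟨φ, g, hga, hg0, h⟩ := exists_normal_form (Φ := fun x => Φ (M x)) (by
      refine AnalyticAt.fun_comp (g := Φ) ?_ (M.analyticAt 0)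
      rw [map_zero]; exact hΦa) (by simp only [map_zero, hΦ0])
    (hd.trans (by rw [hΦd]; rfl)) (fun i => ((1 : ℂ), l i)) hw (by
      intro i j
      have h1 := hcomp (p := ContinuousLinearMap.fst ℂ ℂ ℂ) (l := fun _ => 1)
        (fun x => by simpa using (hL x).1) i j
      have h2 := hcomp (p := ContinuousLinearMap.snd ℂ ℂ ℂ) (l := l) (fun x => (hL x).2) i j
      refine (hH _ _).trans ?_
      refine Prod.ext (h1.trans ?_) (h2.trans ?_) <;> split_ifs <;> simp)
  refine ⟨μ.comp φ, g, ⟨hga, fun i => ?_, fun i j hij => ?_⟩, ?_⟩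
  · rw [hg0]; simp
  · rw [hg0, hg0]; exact hw i j hij
  · filter_upwards [h] with x hx
    rw [← hx]
    change Φ (μ.toFun (φ.toFun x)) = _
    rw [hμ]

/-- The component Hessians are diagonal with entries twice the coordinates of g_i(0). Dividing x_i
by a square root of the first coordinate normalizes the first form; the λ_i are then the slopes of
g_i(0), distinct because these vectors are independent. -/
theorem IsSeparated.isAGeneric {g : Fin n → ℂ → ℂ × ℂ} (hg : IsSeparated g)
    (h1 : ∀ i, (g i 0).1 ≠ 0) (h2 : ∀ i, (g i 0).2 ≠ 0) : IsAGeneric (separatedMap g) := by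
  have ha := analyticAt_separatedMap hg.analytic
  have hh : ∀ (p : ℂ × ℂ →L[ℂ] ℂ),
      fderiv ℂ (fun x => p (separatedMap g x)) 0 = 0 ∧ ∀ u v,
        hessianAtZero (fun x => p (separatedMap g x)) u v = ∑ i, 2 * p (g i 0) * (u i * v i) := by
    intro p
    have hp := hessian_comp_of_critical (p.analyticAt 0) ha (separatedMap_zero g)
      (fderiv_separatedMap_zero hg.analytic)
    refine ⟨hp.1, fun u v => ?_⟩
    refine bilin_apply_of_single (fderiv ℂ (fderiv ℂ (fun x => p (separatedMap g x))) 0)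
      (fun i => p (g i 0)) (fun i j => ?_) u v
    rw [hp.2, hessian_separatedMap hg.analytic, ContinuousLinearMap.fderiv]
    split_ifs <;> simp
  have hmorse : ∀ (p : ℂ × ℂ →L[ℂ] ℂ), (∀ i, p (g i 0) ≠ 0) →
      IsMorse (fun x => p (separatedMap g x)) := by
    intro p hp
    refine ⟨AnalyticAt.fun_comp (g := p) (p.analyticAt _) ha, by rw [separatedMap_zero, map_zero],
      (hh p).1, fun u hu => ?_⟩
    ext i
    have h3 := hu (Pi.single i 1)
    rw [(hh p).2, Finset.sum_eq_single i (by intro k _ hk; simp [hk]) (by simp)] at h3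
    simpa [hp i] using h3
  have hs : ∀ i, ∃ s : ℂ, s ^ 2 = (g i 0).1 := fun i => IsAlgClosed.exists_pow_nat_eq _ (by norm_num)
  choose s hs using hs
  have hs0 : ∀ i, s i ≠ 0 := fun i h => h1 i (by rw [← hs, h]; norm_num)
  refine ⟨hmorse (ContinuousLinearMap.fst ℂ ℂ ℂ) h1, hmorse (ContinuousLinearMap.snd ℂ ℂ ℂ) h2,
    LinearEquiv.piCongrRight fun i => LinearEquiv.smulOfUnit (Units.mk0 (s i)⁻¹ (inv_ne_zero (hs0 i))),
    fun i => (g i 0).2 / (g i 0).1, ?_, ?_⟩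
  · intro i j hij
    by_contra hne
    apply hg.wedge_ne_zero i j hne
    simp only at hij
    rw [div_eq_div_iff (h1 i) (h1 j)] at hij
    simp only [wedge]
    linear_combination -hij
  · intro x
    have hL : ∀ i, (LinearEquiv.piCongrRight fun i => LinearEquiv.smulOfUnit
      (Units.mk0 (s i)⁻¹ (inv_ne_zero (hs0 i))) : (Fin n → ℂ) ≃ₗ[ℂ] (Fin n → ℂ)) x i =
        (s i)⁻¹ * x i := fun i => rfl
    constructor
    · have h3 := (hh (ContinuousLinearMap.fst ℂ ℂ ℂ)).2
      simp only [ContinuousLinearMap.coe_fst'] at h3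
      rw [quadraticPart, h3, Finset.mul_sum]
      refine Finset.sum_congr rfl fun i _ => ?_
      rw [hL, ← hs]
      have := hs0 i
      field_simp
    · have h3 := (hh (ContinuousLinearMap.snd ℂ ℂ ℂ)).2
      simp only [ContinuousLinearMap.coe_snd'] at h3
      rw [quadraticPart, h3, Finset.mul_sum]
      refine Finset.sum_congr rfl fun i _ => ?_
      dsimp only
      rw [hL, ← hs]
      have := hs0 i
      field_simp

end Generic

/-! ### Germs of sets under diffeomorphisms, and regular parametrizations. -/

section Germs

variable {n : ℕ} {X Y Z : Set (Fin n → ℂ)}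

theorem GermEq.symm (h : GermEq X Y) : GermEq Y X := h.mono fun _ hx => hx.symm

theorem GermEq.trans (h : GermEq X Y) (h' : GermEq Y Z) : GermEq X Z := by
  filter_upwards [h, h'] with x h1 h2 using h1.trans h2

theorem GermEq.le (h : GermEq X Y) : GermLE X Y := h.mono fun _ hx => hx.1

theorem GermLE.trans (h : GermLE X Y) (h' : GermLE Y Z) : GermLE X Z := by
  filter_upwards [h, h'] with x h1 h2 using fun hx => h2 (h1 hx)

theorem GermLE.antisymm (h : GermLE X Y) (h' : GermLE Y X) : GermEq X Y := by
  filter_upwards [h, h'] with x h1 h2 using ⟨h1, h2⟩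

theorem IsAnalyticGerm.of_finite {ι : Type*} [Finite ι] (h : ι → (Fin n → ℂ) → ℂ)
    (ha : ∀ j, AnalyticAt ℂ (h j) 0)
    (hX : ∀ᶠ x in 𝓝 (0 : Fin n → ℂ), (x ∈ X ↔ ∀ j, h j x = 0)) : IsAnalyticGerm X := by
  obtain ⟨k, ⟨e⟩⟩ := Finite.exists_equiv_fin ι
  refine ⟨k, fun j => h (e.symm j), fun j => ha _, ?_⟩
  filter_upwards [hX] with x hx
  rw [hx]
  exact ⟨fun H j => H _, fun H j => by simpa using H (e j)⟩

theorem IsAnalyticGerm.inter (hX : IsAnalyticGerm X) (hY : IsAnalyticGerm Y) :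
    IsAnalyticGerm (X ∩ Y) := by
  obtain ⟨k, f, hf, hfX⟩ := hX
  obtain ⟨l, g, hg, hgY⟩ := hY
  refine IsAnalyticGerm.of_finite (Sum.elim f g) (fun j => ?_) ?_
  · cases j
    · exact hf _
    · exact hg _
  · filter_upwards [hfX, hgY] with x h1 h2
    rw [Set.mem_inter_iff, h1, h2, Sum.forall]
    rfl

theorem IsAnalyticGerm.preimage (hX : IsAnalyticGerm X) (φ : DiffGerm (Fin n → ℂ)) :
    IsAnalyticGerm (φ.toFun ⁻¹' X) := by
  obtain ⟨k, f, hf, hfX⟩ := hX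
  refine ⟨k, fun j x => f j (φ.toFun x), fun j => ?_, ?_⟩
  · refine AnalyticAt.fun_comp (g := f j) ?_ φ.analytic_toFun
    rw [φ.toFun_zero]; exact hf j
  · exact φ.tendsto_toFun.eventually hfX

theorem GermEq.preimage (h : GermEq X Y) (φ : DiffGerm (Fin n → ℂ)) :
    GermEq (φ.toFun ⁻¹' X) (φ.toFun ⁻¹' Y) :=
  φ.tendsto_toFun.eventually h

theorem GermLE.preimage (h : GermLE X Y) (φ : DiffGerm (Fin n → ℂ)) :
    GermLE (φ.toFun ⁻¹' X) (φ.toFun ⁻¹' Y) :=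
  φ.tendsto_toFun.eventually h

theorem germEq_preimage_preimage (X : Set (Fin n → ℂ)) (φ : DiffGerm (Fin n → ℂ)) :
    GermEq (φ.toFun ⁻¹' (φ.symm.toFun ⁻¹' X)) X := by
  filter_upwards [φ.left_inv] with x hx
  change φ.invFun (φ.toFun x) ∈ X ↔ _
  rw [hx]

theorem IsIrreducibleGerm.preimage (hX : IsIrreducibleGerm X) (φ : DiffGerm (Fin n → ℂ)) :
    IsIrreducibleGerm (φ.toFun ⁻¹' X) := by
  refine ⟨hX.analytic.preimage φ, ?_, fun A B hA hB hAB => ?_⟩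
  · rw [Set.mem_preimage, φ.toFun_zero]; exact hX.zero_mem
  · have h1 := (germEq_preimage_preimage X φ.symm).symm.trans (hAB.preimage φ.symm)
    rw [Set.preimage_union] at h1
    rcases hX.irreducible _ _ (hA.preimage φ.symm) (hB.preimage φ.symm) h1 with h | h
    · exact Or.inl ((h.preimage φ).trans (germEq_preimage_preimage A φ))
    · exact Or.inr ((h.preimage φ).trans (germEq_preimage_preimage B φ))

theorem IsComponentGerm.preimage (hX : IsComponentGerm X Z) (φ : DiffGerm (Fin n → ℂ)) :
    IsComponentGerm (φ.toFun ⁻¹' X) (φ.toFun ⁻¹' Z) := by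
  refine ⟨hX.irreducible.preimage φ, hX.le.preimage φ, fun Y hY h1 h2 => ?_⟩
  have h3 := hX.maximal _ (hY.preimage φ.symm)
    ((germEq_preimage_preimage X φ.symm).symm.le.trans (h1.preimage φ.symm))
    ((h2.preimage φ.symm).trans (germEq_preimage_preimage Z φ.symm).le)
  exact (germEq_preimage_preimage Y φ).symm.trans (h3.preimage φ)

theorem IsComponentGerm.congr_right (hX : IsComponentGerm X Y) (h : GermEq Y Z) :
    IsComponentGerm X Z :=
  ⟨hX.irreducible, hX.le.trans h.le, fun W hW h1 h2 => hX.maximal W hW h1 (h2.trans h.symm.le)⟩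

/-- The preimage under the inverse germ plays the role of the image of X under φ, so that the
preceding lemmas on preimages apply to it. -/
theorem IsRegularParam.preimage {τ : ℂ → Fin n → ℂ} (h : IsRegularParam τ X)
    (φ : DiffGerm (Fin n → ℂ)) :
    IsRegularParam (fun t => φ.toFun (τ t)) (φ.symm.toFun ⁻¹' X) := by
  have hφ : AnalyticAt ℂ φ.toFun (τ 0) := by rw [h.map_zero]; exact φ.analytic_toFun
  have hτ : Tendsto τ (𝓝 0) (𝓝 0) := by
    simpa [h.map_zero] using h.analytic.continuousAt.tendsto
  refine ⟨AnalyticAt.fun_comp hφ h.analytic, by rw [h.map_zero, φ.toFun_zero], ?_, ?_, ?_⟩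
  · have h1 := hφ.differentiableAt.hasFDerivAt.comp_hasDerivAt (0 : ℂ)
      h.analytic.differentiableAt.hasDerivAt
    have h2 : deriv (fun t => φ.toFun (τ t)) 0 = fderiv ℂ φ.toFun (τ 0) (deriv τ 0) := h1.deriv
    rw [h2, h.map_zero]
    exact φ.fderiv_ne_zero h.immersion
  · filter_upwards [h.mem, hτ.eventually φ.left_inv] with t h1 h2
    change φ.invFun (φ.toFun (τ t)) ∈ X
    rwa [h2]
  · intro U hU
    filter_upwards [φ.tendsto_invFun.eventually (h.surj U hU), φ.right_inv] with x h1 h2 hx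
    obtain ⟨t, ht, htx⟩ := h1 hx
    exact ⟨t, ht, by dsimp only; rw [htx, h2]⟩

theorem DiffGerm.exists_of_deriv {f : ℂ → ℂ} (hf : AnalyticAt ℂ f 0) (h0 : f 0 = 0)
    (hd : deriv f 0 ≠ 0) : ∃ φ : DiffGerm ℂ, φ.toFun = f := by
  refine DiffGerm.exists_of_fderiv hf h0 (ContinuousLinearEquiv.unitsEquivAut ℂ (Units.mk0 _ hd)) ?_
  refine hf.differentiableAt.hasDerivAt.hasFDerivAt.congr_fderiv ?_
  ext
  simp

/-- Some coordinate τ_k is a local diffeomorphism α of ℂ, so the parameter of a point of the curve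
can be read from its k-th coordinate: the reparametrization is α⁻¹ ∘ τ'_k. Its derivative is
non-zero because τ' is an immersion. -/
theorem IsRegularParam.exists_reparam {τ τ' : ℂ → Fin n → ℂ} (h : IsRegularParam τ X)
    (h' : IsRegularParam τ' Y) (hXY : GermEq X Y) :
    ∃ φ : DiffGerm ℂ, ∀ᶠ t in 𝓝 (0 : ℂ), τ (φ.toFun t) = τ' t := by
  obtain ⟨k, hk⟩ := Function.ne_iff.1 h.immersion
  have hdτ := h.analytic.differentiableAt.hasDerivAt
  have hτ' : Tendsto τ' (𝓝 0) (𝓝 0) := by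
    simpa [h'.map_zero] using h'.analytic.continuousAt.tendsto
  have hcoord : ∀ {τ : ℂ → Fin n → ℂ}, AnalyticAt ℂ τ 0 → AnalyticAt ℂ (fun t => τ t k) 0 :=
    fun hτ => AnalyticAt.fun_comp (g := fun x : Fin n → ℂ => x k) (analyticAt_coord k _) hτ
  obtain ⟨α, hα⟩ := DiffGerm.exists_of_deriv (hcoord h.analytic) (by rw [h.map_zero]; rfl)
    (by rw [((hasDerivAt_pi.1 hdτ) k).deriv]; exact hk)
  set s : ℂ → ℂ := fun t => α.invFun (τ' t k) with hs
  have hs0 : s 0 = 0 := by simp [hs, h'.map_zero, α.invFun_zero]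
  have hsa : AnalyticAt ℂ s 0 := by
    refine AnalyticAt.fun_comp (g := α.invFun) ?_ (hcoord h'.analytic)
    rw [h'.map_zero]; exact α.analytic_invFun
  have key : ∀ᶠ t in 𝓝 (0 : ℂ), τ (s t) = τ' t := by
    have hU : {t | α.invFun (τ t k) = t} ∈ 𝓝 (0 : ℂ) := by
      have := α.left_inv
      rwa [hα] at this
    filter_upwards [h'.mem, hτ'.eventually hXY, hτ'.eventually (h.surj _ hU)] with t h1 h2 h3
    obtain ⟨r, hr, hrt⟩ := h3 (h2.2 h1)
    have : s t = r := by simp only [hs, ← hrt]; exact hr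
    rw [this, hrt]
  have hds : deriv s 0 ≠ 0 := by
    intro h0
    have h1 := hsa.differentiableAt.hasDerivAt
    rw [h0] at h1
    have h2 : HasDerivAt τ (deriv τ 0) (s 0) := by rw [hs0]; exact hdτ
    have h3 := h2.scomp (0 : ℂ) h1
    rw [zero_smul] at h3
    exact h'.immersion (h3.congr_of_eventuallyEq (key.mono fun t ht => ht.symm)).deriv
  obtain ⟨φ, hφ⟩ := DiffGerm.exists_of_deriv hsa hs0 hds
  exact ⟨φ, by rw [hφ]; exact key⟩

end Germs

/-! ### Transport of tangency curves and their images under conjugacy. -/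

section Transport

variable {n : ℕ}

theorem wedge_sum_smul_left {ι : Type*} (s : Finset ι) (a : ι → ℂ) (p : ι → ℂ × ℂ) (w : ℂ × ℂ) :
    wedge (∑ i ∈ s, a i • p i) w = ∑ i ∈ s, a i * wedge (p i) w := by
  simp only [wedge, Prod.fst_sum, Prod.snd_sum, Finset.sum_mul, ← Finset.sum_sub_distrib]
  refine Finset.sum_congr rfl fun i _ => ?_
  simp only [Prod.smul_fst, Prod.smul_snd, smul_eq_mul]
  ring

theorem wedge_swap (v w : ℂ × ℂ) : wedge v w = -wedge w v := by
  simp only [wedge]; ring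

theorem mem_tangencyLocus_iff_single {Φ : (Fin n → ℂ) → ℂ × ℂ} {x : Fin n → ℂ}
    (h : DifferentiableAt ℂ Φ x) : x ∈ tangencyLocus Φ ↔
      ∀ i j, wedge (fderiv ℂ Φ x (Pi.single i 1)) (fderiv ℂ Φ x (Pi.single j 1)) = 0 := by
  have h1 : fderiv ℂ (fun y => (Φ y).1) x = (ContinuousLinearMap.fst ℂ ℂ ℂ).comp (fderiv ℂ Φ x) :=
    h.hasFDerivAt.fst.fderiv
  have h2 : fderiv ℂ (fun y => (Φ y).2) x = (ContinuousLinearMap.snd ℂ ℂ ℂ).comp (fderiv ℂ Φ x) :=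
    h.hasFDerivAt.snd.fderiv
  simp only [tangencyLocus, Set.mem_ofPred_eq, h1, h2, wedge]
  refine forall_congr' fun i => forall_congr' fun j => ?_
  rw [mul_comm (((ContinuousLinearMap.fst ℂ ℂ ℂ).comp (fderiv ℂ Φ x)) (Pi.single j 1))]
  rfl

/-- A coordinate-free form, as needed for changes of variables: the differential has rank at most 1.
-/
theorem mem_tangencyLocus_iff {Φ : (Fin n → ℂ) → ℂ × ℂ} {x : Fin n → ℂ}
    (h : DifferentiableAt ℂ Φ x) : x ∈ tangencyLocus Φ ↔
      ∀ u v, wedge (fderiv ℂ Φ x u) (fderiv ℂ Φ x v) = 0 := by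
  rw [mem_tangencyLocus_iff_single h]
  refine ⟨fun H u v => ?_, fun H i j => H _ _⟩
  rw [ContinuousLinearMap.apply_eq_sum_single _ u, wedge_sum_smul_left]
  refine Finset.sum_eq_zero fun i _ => ?_
  rw [wedge_swap, ContinuousLinearMap.apply_eq_sum_single _ v, wedge_sum_smul_left]
  simp only [H, mul_zero, Finset.sum_const_zero, neg_zero]

variable {Φ₁ Φ₂ Φ₃ : (Fin n → ℂ) → ℂ × ℂ}

/-- `Φ₂ = ψ ∘ Φ₁ ∘ φ⁻¹` as germs. -/
def ConjugateBy (φ : DiffGerm (Fin n → ℂ)) (ψ : DiffGerm (ℂ × ℂ))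
    (Φ₁ Φ₂ : (Fin n → ℂ) → ℂ × ℂ) : Prop :=
  ∀ᶠ x in 𝓝 (0 : Fin n → ℂ), ψ.toFun (Φ₁ (φ.invFun x)) = Φ₂ x

theorem ConjugateBy.trans {φ φ' : DiffGerm (Fin n → ℂ)} {ψ ψ' : DiffGerm (ℂ × ℂ)}
    (h : ConjugateBy φ ψ Φ₁ Φ₂) (h' : ConjugateBy φ' ψ' Φ₂ Φ₃) :
    ConjugateBy (φ'.comp φ) (ψ'.comp ψ) Φ₁ Φ₃ := by
  filter_upwards [φ'.tendsto_invFun.eventually h, h'] with x h1 h2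
  change ψ'.toFun (ψ.toFun (Φ₁ (φ.invFun (φ'.invFun x)))) = _
  rw [h1, h2]

theorem ConjugateBy.symm {φ : DiffGerm (Fin n → ℂ)} {ψ : DiffGerm (ℂ × ℂ)}
    (h : ConjugateBy φ ψ Φ₁ Φ₂) (ha : AnalyticAt ℂ Φ₁ 0) (h0 : Φ₁ 0 = 0) :
    ConjugateBy φ.symm ψ.symm Φ₂ Φ₁ := by
  have ht : Tendsto Φ₁ (𝓝 0) (𝓝 0) := by simpa [h0] using ha.continuousAt.tendsto
  filter_upwards [φ.tendsto_toFun.eventually h, φ.left_inv, ht.eventually ψ.left_inv] with x h1 h2 h3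
  change ψ.invFun (Φ₂ (φ.toFun x)) = _
  rw [← h1, h2, h3]

theorem ConjugateBy.map_zero {φ : DiffGerm (Fin n → ℂ)} {ψ : DiffGerm (ℂ × ℂ)}
    (h : ConjugateBy φ ψ Φ₁ Φ₂) (h0 : Φ₁ 0 = 0) : Φ₂ 0 = 0 := by
  rw [← h.self_of_nhds, φ.invFun_zero, h0, ψ.toFun_zero]

theorem ConjugateBy.analyticAt {φ : DiffGerm (Fin n → ℂ)} {ψ : DiffGerm (ℂ × ℂ)}
    (h : ConjugateBy φ ψ Φ₁ Φ₂) (ha : AnalyticAt ℂ Φ₁ 0) (h0 : Φ₁ 0 = 0) : AnalyticAt ℂ Φ₂ 0 := by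
  refine AnalyticAt.congr ?_ h
  refine AnalyticAt.fun_comp (g := ψ.toFun) ?_ (AnalyticAt.fun_comp (g := Φ₁) ?_ φ.analytic_invFun)
  · rw [φ.invFun_zero, h0]; exact ψ.analytic_toFun
  · rw [φ.invFun_zero]; exact ha

/-- By the chain rule, the minors of the new map are old minors multiplied by the determinant of dψ.
-/
theorem ConjugateBy.tangencyLocus_le {φ : DiffGerm (Fin n → ℂ)} {ψ : DiffGerm (ℂ × ℂ)}
    (h : ConjugateBy φ ψ Φ₁ Φ₂) (ha : AnalyticAt ℂ Φ₁ 0) (h0 : Φ₁ 0 = 0) :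
    GermLE (φ.symm.toFun ⁻¹' tangencyLocus Φ₁) (tangencyLocus Φ₂) := by
  have ht : Tendsto (fun x => Φ₁ (φ.invFun x)) (𝓝 0) (𝓝 0) := by
    refine Tendsto.comp (g := Φ₁) ?_ φ.tendsto_invFun
    simpa [h0] using ha.continuousAt.tendsto
  filter_upwards [h.eventually_nhds, φ.analytic_invFun.eventually_analyticAt,
    φ.tendsto_invFun.eventually ha.eventually_analyticAt,
    ht.eventually ψ.analytic_toFun.eventually_analyticAt] with x h1 h2 h3 h4 hx
  have hx' : φ.invFun x ∈ tangencyLocus Φ₁ := hx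
  have h5 := (h4.differentiableAt.hasFDerivAt.comp (φ.invFun x)
    h3.differentiableAt.hasFDerivAt).comp x h2.differentiableAt.hasFDerivAt
  have h6 : HasFDerivAt Φ₂ _ x := h5.congr_of_eventuallyEq (h1.mono fun y hy => hy.symm)
  rw [mem_tangencyLocus_iff h3.differentiableAt] at hx'
  rw [mem_tangencyLocus_iff h6.differentiableAt, h6.fderiv]
  intro u v
  simp only [ContinuousLinearMap.comp_apply]
  rw [wedge_map, hx', mul_zero]

theorem ConjugateBy.tangencyLocus_eq {φ : DiffGerm (Fin n → ℂ)} {ψ : DiffGerm (ℂ × ℂ)}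
    (h : ConjugateBy φ ψ Φ₁ Φ₂) (ha : AnalyticAt ℂ Φ₁ 0) (h0 : Φ₁ 0 = 0) :
    GermEq (φ.symm.toFun ⁻¹' tangencyLocus Φ₁) (tangencyLocus Φ₂) := by
  refine (h.tangencyLocus_le ha h0).antisymm ?_
  have h1 := (h.symm ha h0).tangencyLocus_le (h.analyticAt ha h0) (h.map_zero h0)
  exact (germEq_preimage_preimage (tangencyLocus Φ₂) φ.symm).symm.le.trans (h1.preimage φ.symm)

theorem IsImageCurve.conjugate {φ : DiffGerm (Fin n → ℂ)} {ψ : DiffGerm (ℂ × ℂ)}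
    (h : ConjugateBy φ ψ Φ₁ Φ₂) {τ : ℂ → Fin n → ℂ} {X : Set (Fin n → ℂ)}
    (hτ : IsRegularParam τ X) {C : SigmaCurve} (hC : IsImageCurve Φ₁ τ C) :
    IsImageCurve Φ₂ (fun t => φ.toFun (τ t)) (C.map ψ) := by
  obtain ⟨σ, rfl, hσ⟩ := hC
  have hτt : Tendsto τ (𝓝 0) (𝓝 0) := by
    simpa [hτ.map_zero] using hτ.analytic.continuousAt.tendsto
  refine ⟨σ.map ψ, rfl, ?_⟩
  filter_upwards [hσ, hτt.eventually φ.left_inv,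
    hτt.eventually (φ.tendsto_toFun.eventually h)] with t h1 h2 h3
  change ψ.toFun (σ.toFun t) = _
  rw [h1, ← h3, h2]

theorem HasTangencySigmaCurves.conjugate {φ : DiffGerm (Fin n → ℂ)} {ψ : DiffGerm (ℂ × ℂ)}
    (h : ConjugateBy φ ψ Φ₁ Φ₂) (ha : AnalyticAt ℂ Φ₁ 0) (h0 : Φ₁ 0 = 0) {C : Fin n → SigmaCurve}
    (hC : HasTangencySigmaCurves Φ₁ C) : HasTangencySigmaCurves Φ₂ fun i => (C i).map ψ := by
  obtain ⟨T, τ, hT, hTu, hτ, hτC⟩ := hC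
  have hZ := h.tangencyLocus_eq ha h0
  refine ⟨fun i => φ.symm.toFun ⁻¹' T i, fun i t => φ.toFun (τ i t),
    fun i => ((hT i).preimage φ.symm).congr_right hZ, fun X hX => ?_,
    fun i => (hτ i).preimage φ, fun i => IsImageCurve.conjugate h (hτ i) (hτC i)⟩
  have hX' := (hX.preimage φ).congr_right
    ((hZ.preimage φ).symm.trans (germEq_preimage_preimage _ φ))
  have hiff : ∀ i, GermEq X (φ.symm.toFun ⁻¹' T i) ↔ GermEq (φ.toFun ⁻¹' X) (T i) := fun i =>
    ⟨fun H => (H.preimage φ).trans (germEq_preimage_preimage _ φ),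
      fun H => (germEq_preimage_preimage X φ.symm).symm.trans (H.preimage φ.symm)⟩
  simp only [hiff]
  exact hTu _ hX'

/-- The σ-curve Φ(T) does not depend on the regular parametrization of T, since two of them differ
by a diffeomorphism of the parameter. -/
theorem HasTangencySigmaCurves.tangencySigmaCurves_eq {Φ : (Fin n → ℂ) → ℂ × ℂ}
    {C : Fin n → SigmaCurve} (hC : HasTangencySigmaCurves Φ C) :
    tangencySigmaCurves Φ = Set.range C := by
  obtain ⟨T, τ, hT, hTu, hτ, hτC⟩ := hC
  ext D
  constructor
  · rintro ⟨X, τ', hX, hτ', hD⟩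
    obtain ⟨i, hi, -⟩ := hTu X hX
    refine ⟨i, ?_⟩
    obtain ⟨σ, hσ, hσΦ⟩ := hτC i
    obtain ⟨σ', hσ', hσΦ'⟩ := hD
    obtain ⟨φ, hφ⟩ := (hτ i).exists_reparam hτ' hi.symm
    rw [← hσ, ← hσ']
    refine Quotient.sound ⟨φ, ?_⟩
    filter_upwards [hφ, hσΦ', φ.tendsto_toFun.eventually hσΦ] with t h1 h2 h3
    rw [h3, h1, h2]
  · rintro ⟨i, rfl⟩
    exact ⟨T i, τ i, hT i, hτ i, hτC i⟩

end Transport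

/-! ### Tangency curves of separated maps and recovery of the map from its σ-curves. -/

section Axes

variable {n : ℕ}

/-- The `i`-th coordinate axis. -/
def axis (i : Fin n) : Set (Fin n → ℂ) := {x | ∀ j, j ≠ i → x j = 0}

theorem single_mem_axis (i : Fin n) (t : ℂ) : (Pi.single i t : Fin n → ℂ) ∈ axis i :=
  fun j hj => by simp [hj]

theorem eq_single_of_mem_axis {i : Fin n} {x : Fin n → ℂ} (hx : x ∈ axis i) :
    Pi.single i (x i) = x := by
  ext j
  by_cases hj : j = i
  · subst hj; simp
  · rw [Pi.single_eq_of_ne hj, hx j hj]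

theorem isAnalyticGerm_axis (i : Fin n) : IsAnalyticGerm (axis i) :=
  IsAnalyticGerm.of_finite (fun (j : {j : Fin n // j ≠ i}) x => x j.1)
    (fun j => analyticAt_coord j.1 0)
    (Eventually.of_forall fun _ => ⟨fun h j => h j.1 j.2, fun h j hj => h ⟨j, hj⟩⟩)

theorem isAnalyticGerm_hyperplane (i : Fin n) : IsAnalyticGerm {x : Fin n → ℂ | x i = 0} :=
  IsAnalyticGerm.of_finite (fun (_ : Unit) x => x i) (fun _ => analyticAt_coord i 0)
    (Eventually.of_forall fun _ => ⟨fun h _ => h, fun h => h ()⟩)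

/-- Zeros of an analytic function of one variable are isolated unless it vanishes identically near
0. -/
theorem IsAnalyticGerm.axis_le_or {A : Set (Fin n → ℂ)} (hA : IsAnalyticGerm A) (i : Fin n) :
    GermLE (axis i) A ∨ ∀ᶠ t in 𝓝[≠] (0 : ℂ), (Pi.single i t : Fin n → ℂ) ∉ A := by
  obtain ⟨k, h, hh, hA⟩ := hA
  have ha : ∀ j, AnalyticAt ℂ (fun t : ℂ => h j (Pi.single i t)) 0 := by
    intro j
    refine AnalyticAt.fun_comp (g := h j) ?_ (analyticAt_single i 0)
    rw [Pi.single_zero]; exact hh j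
  by_cases H : ∀ j, ∀ᶠ t in 𝓝 (0 : ℂ), h j (Pi.single i t) = 0
  · left
    filter_upwards [hA, (tendsto_coord i).eventually (eventually_all.2 H)] with x h1 h2 hx
    rw [eq_single_of_mem_axis hx] at h2
    exact h1.2 h2
  · right
    push Not at H
    obtain ⟨j, hj⟩ := H
    have h1 := ((ha j).eventually_eq_zero_or_eventually_ne_zero).resolve_left
      (by simpa only [Filter.not_eventually] using hj)
    filter_upwards [h1, nhdsWithin_le_nhds ((tendsto_single i).eventually hA)] with t h2 h3 h4
    exact h2 (h3.1 h4 j)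

theorem isIrreducibleGerm_axis (i : Fin n) : IsIrreducibleGerm (axis i) := by
  refine ⟨isAnalyticGerm_axis i, fun _ _ => rfl, fun A B hA hB hAB => ?_⟩
  rcases hA.axis_le_or i with h | h
  · left
    refine h.antisymm ?_
    filter_upwards [hAB] with x hx hxA using hx.2 (Or.inl hxA)
  rcases hB.axis_le_or i with h' | h'
  · right
    refine h'.antisymm ?_
    filter_upwards [hAB] with x hx hxB using hx.2 (Or.inr hxB)
  exfalso
  obtain ⟨t, ⟨h1, h2⟩, h3⟩ :=
    ((h.and h').and (nhdsWithin_le_nhds ((tendsto_single i).eventually hAB))).exists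
  rcases h3.1 (single_mem_axis i t) with h4 | h4
  · exact h1 h4
  · exact h2 h4

theorem eq_of_axis_le {i j : Fin n} (h : GermLE (axis i) (axis j)) : i = j := by
  by_contra hij
  have h0 : ∀ᶠ t in 𝓝[≠] (0 : ℂ), (Pi.single i t : Fin n → ℂ) ∈ axis i → Pi.single i t ∈ axis j :=
    ((tendsto_single i).eventually h).filter_mono nhdsWithin_le_nhds
  obtain ⟨t, h1, h2⟩ := (h0.and
    (self_mem_nhdsWithin : ∀ᶠ t in 𝓝[≠] (0 : ℂ), t ∈ ({0}ᶜ : Set ℂ))).exists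
  have h3 := h1 (single_mem_axis i t) i hij
  rw [Pi.single_eq_same] at h3
  exact h2 h3

/-- For each i, X is the union of its parts in the hyperplane x_i = 0 and in the i-th axis. If it
lies in no axis, irreducibility puts it in every hyperplane, hence in {0}, which is contained in an
axis since n ≥ 1. -/
theorem IsIrreducibleGerm.le_axis (hn : 1 ≤ n) {X : Set (Fin n → ℂ)} (hX : IsIrreducibleGerm X)
    (h : GermLE X (⋃ i, axis i)) : ∃ i, GermLE X (axis i) := by
  have hcover : ∀ i, GermEq X (X ∩ {x | x i = 0} ∪ X ∩ axis i) := by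
    intro i
    filter_upwards [h] with x hx
    refine ⟨fun hxX => ?_, fun hxX => hxX.elim (fun h => h.1) fun h => h.1⟩
    obtain ⟨j, hj⟩ := Set.mem_iUnion.1 (hx hxX)
    by_cases hij : i = j
    · subst hij; exact Or.inr ⟨hxX, hj⟩
    · exact Or.inl ⟨hxX, hj i hij⟩
  by_contra! hne
  have hzero : ∀ i, GermLE X {x | x i = 0} := by
    intro i
    rcases hX.irreducible _ _ (hX.analytic.inter (isAnalyticGerm_hyperplane i))
      (hX.analytic.inter (isAnalyticGerm_axis i)) (hcover i) with h1 | h1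
    · filter_upwards [h1] with x hx hxX using (hx.1 hxX).2
    · exact (hne i (by filter_upwards [h1] with x hx hxX using (hx.1 hxX).2)).elim
  refine hne ⟨0, hn⟩ ?_
  filter_upwards [eventually_all.2 hzero] with x hx hxX j _ using hx j hxX

variable {g : Fin n → ℂ → ℂ × ℂ}

/-- For i ≠ j the (i, j) minor is x_i x_j times a unit, so at a common zero at most one coordinate
is non-zero. -/
theorem IsSeparated.tangencyLocus_eq (hn : 1 ≤ n) (hg : IsSeparated g) :
    GermEq (tangencyLocus (separatedMap g)) (⋃ i, axis i) := by
  have hw : ∀ i j, i ≠ j → ∀ᶠ x in 𝓝 (0 : Fin n → ℂ),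
      wedge (separatedDeriv g i (x i)) (separatedDeriv g j (x j)) ≠ 0 := by
    intro i j hij
    have hc : ∀ i, ContinuousAt (fun x : Fin n → ℂ => separatedDeriv g i (x i)) 0 := fun i =>
      (analyticAt_comp_coord i 0 (analyticAt_separatedDeriv hg.analytic i)).continuousAt
    have hcw : ContinuousAt (fun x : Fin n → ℂ =>
        wedge (separatedDeriv g i (x i)) (separatedDeriv g j (x j))) 0 :=
      ((hc i).fst.mul (hc j).snd).sub ((hc i).snd.mul (hc j).fst)
    refine hcw.eventually_ne ?_
    simp only [Pi.zero_apply, separatedDeriv_zero]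
    have h1 : wedge ((2 : ℂ) • g i 0) ((2 : ℂ) • g j 0) = 4 * wedge (g i 0) (g j 0) := by
      simp [wedge]; ring
    rw [h1]
    exact mul_ne_zero (by norm_num) (hg.wedge_ne_zero i j hij)
  have hw' : ∀ᶠ x in 𝓝 (0 : Fin n → ℂ), ∀ i j, i ≠ j →
      wedge (separatedDeriv g i (x i)) (separatedDeriv g j (x j)) ≠ 0 :=
    eventually_all.2 fun i => eventually_all.2 fun j => by
      by_cases hij : i = j
      · exact Eventually.of_forall fun x h => (h hij).elim
      · exact (hw i j hij).mono fun x h _ => h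
  filter_upwards [hw', fderiv_separatedMap hg.analytic,
    (analyticAt_separatedMap hg.analytic).eventually_analyticAt] with x h1 h2 h3
  rw [mem_tangencyLocus_iff_single h3.differentiableAt, Set.mem_iUnion]
  have h4 : ∀ i j, wedge (fderiv ℂ (separatedMap g) x (Pi.single i 1))
      (fderiv ℂ (separatedMap g) x (Pi.single j 1)) =
        x i * x j * wedge (separatedDeriv g i (x i)) (separatedDeriv g j (x j)) := by
    intro i j
    rw [h2, h2]
    simp only [wedge, Prod.smul_fst, Prod.smul_snd, smul_eq_mul]
    ring
  simp only [h4]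
  constructor
  · intro H
    by_cases hx : ∃ i, x i ≠ 0
    · obtain ⟨i, hi⟩ := hx
      refine ⟨i, fun j hj => ?_⟩
      have h5 := H i j
      simpa [hi, h1 i j (Ne.symm hj)] using h5
    · push Not at hx
      exact ⟨⟨0, hn⟩, fun j _ => hx j⟩
  · rintro ⟨k, hk⟩ i j
    by_cases hi : i = k
    · by_cases hj : j = k
      · subst hi; subst hj; simp only [wedge]; ring
      · rw [hk j hj]; ring
    · rw [hk i hi]; ring

theorem isRegularParam_axis (i : Fin n) :
    IsRegularParam (fun t : ℂ => (Pi.single i t : Fin n → ℂ)) (axis i) := by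
  refine ⟨analyticAt_single i 0, Pi.single_zero i, ?_, Eventually.of_forall (single_mem_axis i), ?_⟩
  · have h1 : HasDerivAt (fun s : ℂ => (Pi.single i s : Fin n → ℂ)) (Pi.single i 1) 0 :=
      (ContinuousLinearMap.single ℂ (fun _ : Fin n => ℂ) i).hasDerivAt
    rw [h1.deriv]
    simp
  · intro U hU
    filter_upwards [(tendsto_coord i).eventually hU] with x h1 h2
    exact ⟨x i, h1, eq_single_of_mem_axis h2⟩

/-- The axes are irreducible, none contains another, and every irreducible germ in their union lies
in one of them; so they are exactly the components. -/
theorem IsSeparated.hasTangencySigmaCurves (hn : 1 ≤ n) (hg : IsSeparated g)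
    (σ : Fin n → ParamCurve) (hσ : ∀ i, ∀ᶠ t in 𝓝 (0 : ℂ), (σ i).toFun t = t ^ 2 • g i t) :
    HasTangencySigmaCurves (separatedMap g) fun i => (⟦σ i⟧ : Quotient sigmaSetoid) := by
  have hZ := hg.tangencyLocus_eq hn
  refine ⟨axis, fun i t => Pi.single i t, fun i => ?_, fun X hX => ?_, isRegularParam_axis,
    fun i => ⟨σ i, rfl, ?_⟩⟩
  · refine ⟨isIrreducibleGerm_axis i, ?_, fun Y hY h1 h2 => ?_⟩
    · filter_upwards [hZ] with x hx hxi using hx.2 (Set.mem_iUnion.2 ⟨i, hxi⟩)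
    · obtain ⟨j, hj⟩ := hY.le_axis hn (h2.trans hZ.le)
      have hij := eq_of_axis_le (h1.trans hj)
      subst hij
      exact hj.antisymm h1
  · obtain ⟨i, hi⟩ := hX.irreducible.le_axis hn (hX.le.trans hZ.le)
    have h1 := hX.maximal (axis i) (isIrreducibleGerm_axis i) hi (by
      filter_upwards [hZ] with x hx hxi using hx.2 (Set.mem_iUnion.2 ⟨i, hxi⟩))
    exact ⟨i, h1.symm, fun j hj => (eq_of_axis_le (h1.trans hj).le).symm⟩
  · filter_upwards [hσ i] with t ht
    rw [ht, separatedMap_single]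

/-- The parametrized curve `t ↦ t ^ 2 • g i t`. -/
def IsSeparated.curve (hg : IsSeparated g) (i : Fin n) : ParamCurve where
  toFun := fun t => t ^ 2 • g i t
  analytic := (analyticAt_id.fun_pow 2).fun_smul (hg.analytic i)
  map_zero := by simp
  nonconst := by
    intro h
    have h1 : ∀ᶠ t in 𝓝 (0 : ℂ), t • g i t = 0 := by
      refine eventually_eq_zero_of_smul (analyticAt_id.fun_smul (hg.analytic i)).continuousAt ?_
      filter_upwards [h] with t ht
      change t • t • g i t = 0
      rw [smul_smul, ← sq]
      exact ht
    exact hg.ne_zero i (eventually_eq_zero_of_smul (hg.analytic i).continuousAt h1).self_of_nhds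

/-- A reparametrization multiplies the leading vector by the square of its derivative at 0. This
controls the tangent direction of a whole σ-class. -/
theorem tendsto_leading {φ : DiffGerm ℂ} {g : ℂ → ℂ × ℂ} (hg : AnalyticAt ℂ g 0) :
    Tendsto (fun t : ℂ => (t ^ 2)⁻¹ • φ.toFun t ^ 2 • g (φ.toFun t)) (𝓝[≠] 0)
      (𝓝 (deriv φ.toFun 0 ^ 2 • g 0)) := by
  have h1 : Tendsto (fun t : ℂ => t⁻¹ • (φ.toFun (0 + t) - φ.toFun 0)) (𝓝[≠] 0)
      (𝓝 (deriv φ.toFun 0)) :=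
    hasDerivAt_iff_tendsto_slope_zero.1 φ.analytic_toFun.differentiableAt.hasDerivAt
  have h2 : Tendsto (fun t => g (φ.toFun t)) (𝓝[≠] 0) (𝓝 (g 0)) :=
    (hg.continuousAt.tendsto.comp φ.tendsto_toFun).mono_left nhdsWithin_le_nhds
  refine ((h1.pow 2).smul h2).congr fun t => ?_
  rw [zero_add, φ.toFun_zero, sub_zero, smul_smul, smul_eq_mul, mul_pow, inv_pow]

theorem tendsto_leading_self {g : ℂ → ℂ × ℂ} (hg : AnalyticAt ℂ g 0) :
    Tendsto (fun t : ℂ => (t ^ 2)⁻¹ • t ^ 2 • g t) (𝓝[≠] 0) (𝓝 (g 0)) := by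
  have h := tendsto_leading (φ := DiffGerm.refl ℂ) hg
  simpa [DiffGerm.refl] using h

/-- σ-equivalent curves have proportional leading vectors, whereas the g_i(0) are pairwise
independent. Hence equality of sets of σ-curves yields a bijection of indices. -/
theorem IsSeparated.curve_injective (hg : IsSeparated g) :
    Function.Injective fun i => (⟦hg.curve i⟧ : Quotient sigmaSetoid) := by
  intro i j hij
  obtain ⟨φ, hφ⟩ : SigmaEquiv (hg.curve i) (hg.curve j) := Quotient.exact hij
  by_contra hne
  apply hg.wedge_ne_zero i j hne
  have h1 := tendsto_leading (φ := φ) (hg.analytic i)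
  have h2 := (tendsto_leading_self (hg.analytic j)).congr'
    (f₂ := fun t : ℂ => (t ^ 2)⁻¹ • φ.toFun t ^ 2 • g i (φ.toFun t)) (by
    filter_upwards [nhdsWithin_le_nhds hφ] with t ht
    exact congrArg _ ht.symm)
  rw [← tendsto_nhds_unique h1 h2]
  simp only [wedge, Prod.smul_fst, Prod.smul_snd, smul_eq_mul]
  ring

/-- A permutation of the coordinates composed with changes of coordinates on the factors. -/
def DiffGerm.piPerm (e : Fin n ≃ Fin n) (φ : Fin n → DiffGerm ℂ) : DiffGerm (Fin n → ℂ) where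
  toFun := fun x k => (φ (e.symm k)).toFun (x (e.symm k))
  invFun := fun y i => (φ i).invFun (y (e i))
  analytic_toFun := by
    rw [analyticAt_pi_iff]
    exact fun k => analyticAt_comp_coord _ 0 (φ (e.symm k)).analytic_toFun
  analytic_invFun := by
    rw [analyticAt_pi_iff]
    exact fun i => analyticAt_comp_coord _ 0 (φ i).analytic_invFun
  toFun_zero := by ext k; exact (φ (e.symm k)).toFun_zero
  invFun_zero := by ext i; exact (φ i).invFun_zero
  left_inv := by
    filter_upwards [eventually_all.2 fun i => (tendsto_coord i).eventually (φ i).left_inv] with x hx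
    ext i
    simpa using hx i
  right_inv := by
    filter_upwards [eventually_all.2 fun k =>
      (tendsto_coord k).eventually (φ (e.symm k)).right_inv] with x hx
    ext k
    simpa using hx k

/-- If γ_{e i} ∘ φ_i = γ'_i, then setting the e(i)-th coordinate equal to φ_i(x_i) turns the sum of
the γ_k into the sum of the γ'_i, term by term. -/
theorem IsSeparated.exists_conjugate {g' : Fin n → ℂ → ℂ × ℂ} (hg : IsSeparated g)
    (hg' : IsSeparated g') (h : Set.range (fun i => (⟦hg.curve i⟧ : Quotient sigmaSetoid)) =
      Set.range fun i => (⟦hg'.curve i⟧ : Quotient sigmaSetoid)) :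
    ∃ χ : DiffGerm (Fin n → ℂ), ∀ᶠ x in 𝓝 (0 : Fin n → ℂ),
      separatedMap g (χ.toFun x) = separatedMap g' x := by
  let e : Fin n ≃ Fin n := (Equiv.ofInjective _ hg'.curve_injective).trans
    ((Equiv.setCongr h.symm).trans (Equiv.ofInjective _ hg.curve_injective).symm)
  have he : ∀ i, (⟦hg.curve (e i)⟧ : Quotient sigmaSetoid) = ⟦hg'.curve i⟧ := by
    intro i
    have h1 := Equiv.apply_ofInjective_symm hg.curve_injective
      (Equiv.setCongr h.symm (Equiv.ofInjective _ hg'.curve_injective i))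
    exact h1
  have hφ : ∀ i, SigmaEquiv (hg.curve (e i)) (hg'.curve i) := fun i => Quotient.exact (he i)
  choose φ hφ using hφ
  refine ⟨DiffGerm.piPerm e φ, ?_⟩
  filter_upwards [eventually_all.2 fun i => (tendsto_coord i).eventually (hφ i)] with x hx
  rw [separatedMap, ← Equiv.sum_comp e]
  refine Finset.sum_congr rfl fun i _ => ?_
  simp only [DiffGerm.piPerm, Equiv.symm_apply_apply]
  exact hx i

end Axes

/-! ### Classification and realization. -/

section Main

variable {n : ℕ}

theorem IsAGeneric.isAConjugateToGeneric {Φ : (Fin n → ℂ) → ℂ × ℂ} (h : IsAGeneric Φ) :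
    IsAConjugateToGeneric Φ :=
  ⟨Φ, h, DiffGerm.refl _, DiffGerm.refl _, Eventually.of_forall fun _ => rfl⟩

/-- The target diffeomorphism is absorbed by a second passage to normal form, so a source
diffeomorphism suffices. -/
theorem IsAConjugateToGeneric.exists_separated {Φ : (Fin n → ℂ) → ℂ × ℂ}
    (h : IsAConjugateToGeneric Φ) : ∃ χ g, IsSeparated g ∧
      ConjugateBy χ (DiffGerm.refl _) (separatedMap g) Φ := by
  obtain ⟨Φ₀, h₀, φ, ψ, h⟩ := h
  obtain ⟨φ₀, g₀, hg₀, e₀⟩ := exists_separated_of_generic h₀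
  obtain ⟨φ₁, g, hg, e₁⟩ := hg₀.exists_comp ψ
  refine ⟨φ.comp (φ₀.comp φ₁), g, hg, ?_⟩
  have t₀ := φ₀.tendsto_invFun.comp φ.tendsto_invFun
  filter_upwards [h, φ.tendsto_invFun.eventually φ₀.right_inv, t₀.eventually e₀,
    t₀.eventually φ₁.right_inv, (φ₁.tendsto_invFun.comp t₀).eventually e₁] with x h1 h2 h3 h4 h5
  simp only [Function.comp_apply] at h2 h3 h4 h5
  change separatedMap g (φ₁.invFun (φ₀.invFun (φ.invFun x))) = _
  rw [← h5, h4, ← h3, h2, h1]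

theorem IsAConjugateToGeneric.exists_separated_curves (hn : 1 ≤ n) {Φ : (Fin n → ℂ) → ℂ × ℂ}
    (h : IsAConjugateToGeneric Φ) : ∃ χ g, ∃ hg : IsSeparated g,
      ConjugateBy χ (DiffGerm.refl _) (separatedMap g) Φ ∧
      HasTangencySigmaCurves Φ fun i => (⟦hg.curve i⟧ : Quotient sigmaSetoid) := by
  obtain ⟨χ, g, hg, h⟩ := h.exists_separated
  refine ⟨χ, g, hg, h, ?_⟩
  exact (hg.hasTangencySigmaCurves hn hg.curve fun _ =>
    Eventually.of_forall fun _ => rfl).conjugate h (analyticAt_separatedMap hg.analytic)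
      (separatedMap_zero g)

/-- A conjugacy transports tangency curves and their images. Conversely, ψ ∘ Φ₁ and Φ₂ have the same
σ-curves, so their separated forms are right equivalent. -/
theorem IsAConjugateToGeneric.aConjugate_iff (hn : 1 ≤ n) {Φ₁ Φ₂ : (Fin n → ℂ) → ℂ × ℂ}
    (h₁ : IsAConjugateToGeneric Φ₁) (h₂ : IsAConjugateToGeneric Φ₂) :
    AConjugate Φ₁ Φ₂ ↔ ∃ ψ : DiffGerm (ℂ × ℂ),
      SigmaCurve.map ψ '' tangencySigmaCurves Φ₁ = tangencySigmaCurves Φ₂ := by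
  obtain ⟨χ₁, g₁, hg₁, c₁, T₁⟩ := h₁.exists_separated_curves hn
  have ha := c₁.analyticAt (analyticAt_separatedMap hg₁.analytic) (separatedMap_zero g₁)
  have h0 := c₁.map_zero (separatedMap_zero g₁)
  have himage : ∀ {φ ψ Φ}, ConjugateBy φ ψ Φ₁ Φ →
      SigmaCurve.map ψ '' tangencySigmaCurves Φ₁ = tangencySigmaCurves Φ := by
    intro φ ψ Φ h
    rw [(T₁.conjugate h ha h0).tangencySigmaCurves_eq, T₁.tangencySigmaCurves_eq]
    exact (Set.range_comp _ _).symm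
  refine ⟨fun ⟨φ, ψ, h⟩ => ⟨ψ, himage h⟩, fun ⟨ψ, hψ⟩ => ?_⟩
  have hψΦ : ConjugateBy (DiffGerm.refl _) ψ Φ₁ fun x => ψ.toFun (Φ₁ x) :=
    Eventually.of_forall fun _ => rfl
  have h₃ : IsAConjugateToGeneric fun x => ψ.toFun (Φ₁ x) := by
    obtain ⟨Φ₀, hΦ₀, φ₀, ψ₀, h⟩ := h₁
    exact ⟨Φ₀, hΦ₀, _, _, ConjugateBy.trans h hψΦ⟩
  obtain ⟨χ₂, g₂, hg₂, c₂, T₂⟩ := h₂.exists_separated_curves hn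
  obtain ⟨χ₃, g₃, hg₃, c₃, T₃⟩ := h₃.exists_separated_curves hn
  rw [himage hψΦ, T₂.tangencySigmaCurves_eq, T₃.tangencySigmaCurves_eq] at hψ
  obtain ⟨χ, hχ⟩ := hg₃.exists_conjugate hg₂ hψ
  have hχ' : ConjugateBy χ.symm (DiffGerm.refl _) (separatedMap g₃) (separatedMap g₂) := hχ
  have c₃' := c₃.symm (analyticAt_separatedMap hg₃.analytic) (separatedMap_zero g₃)
  exact ⟨_, _, ((hψΦ.trans c₃').trans hχ').trans c₂⟩

theorem span_singleton_eq_of_wedge_eq_zero {v w : ℂ × ℂ} (hv : v ≠ 0) (hw : w ≠ 0)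
    (h : wedge v w = 0) : Submodule.span ℂ {v} = Submodule.span ℂ {w} := by
  obtain ⟨a, b⟩ := v
  obtain ⟨c, d⟩ := w
  have h1 : a * d - b * c = 0 := h
  have h2 : a ≠ 0 ∨ b ≠ 0 := by
    by_contra! H
    exact hv (Prod.ext H.1 H.2)
  obtain ⟨z, hz⟩ : ∃ z : ℂ, z • (a, b) = (c, d) := by
    rcases h2 with h2 | h2
    · refine ⟨c / a, Prod.ext ?_ ?_⟩ <;> simp only [Prod.smul_mk, smul_eq_mul] <;> field_simp
      linear_combination -h1
    · refine ⟨d / b, Prod.ext ?_ ?_⟩ <;> simp only [Prod.smul_mk, smul_eq_mul] <;> field_simp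
      linear_combination h1
  have hz0 : z ≠ 0 := by
    rintro rfl
    exact hw (by rw [← hz, zero_smul])
  exact Submodule.span_singleton_eq_span_singleton.2 ⟨Units.mk0 z hz0, hz⟩

theorem ParamCurve.exists_leading (σ : ParamCurve)
    (h : SigmaCurve.multiplicity (⟦σ⟧ : Quotient sigmaSetoid) = 2) :
    ∃ g : ℂ → ℂ × ℂ, AnalyticAt ℂ g 0 ∧ g 0 ≠ 0 ∧ ∀ᶠ t in 𝓝 (0 : ℂ), σ.toFun t = t ^ 2 • g t := by
  have h1 : analyticOrderNatAt σ.toFun 0 = 2 := h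
  have h2 : analyticOrderAt σ.toFun 0 = (2 : ℕ) := by
    have h3 : analyticOrderAt σ.toFun 0 ≠ ⊤ := fun H => σ.nonconst (analyticOrderAt_eq_top.1 H)
    rw [← h1, Nat.cast_analyticOrderNatAt h3]
  obtain ⟨g, hg, hg0, hσ⟩ := (σ.analytic.analyticOrderAt_eq_natCast).1 h2
  exact ⟨g, hg, hg0, by simpa using hσ⟩

/-- The cone is spanned by the leading vectors of all representatives, and by `tendsto_leading`
these are multiples of the leading vector of one of them. -/
theorem SigmaCurve.tangentCone_eq {C : SigmaCurve} (hC : C.multiplicity = 2) {σ : ParamCurve}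
    (h : (⟦σ⟧ : Quotient sigmaSetoid) = C) {g : ℂ → ℂ × ℂ} (hg : AnalyticAt ℂ g 0)
    (hσ : ∀ᶠ t in 𝓝 (0 : ℂ), σ.toFun t = t ^ 2 • g t) :
    C.tangentCone = Submodule.span ℂ {g 0} := by
  rw [SigmaCurve.tangentCone, hC]
  refine le_antisymm (Submodule.span_le.2 ?_) (Submodule.span_mono ?_)
  · rintro v ⟨σ', hσ', hv⟩
    obtain ⟨φ, hφ⟩ : SigmaEquiv σ σ' := Quotient.exact (h.trans hσ'.symm)
    have h1 := (tendsto_leading (φ := φ) hg).congr'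
      (f₂ := fun t : ℂ => (t ^ 2)⁻¹ • σ'.toFun t) (by
      filter_upwards [nhdsWithin_le_nhds hφ,
        nhdsWithin_le_nhds (φ.tendsto_toFun.eventually hσ)] with t h1 h2
      rw [← h1, h2])
    rw [tendsto_nhds_unique hv h1]
    exact Submodule.smul_mem _ _ (Submodule.mem_span_singleton_self _)
  · rw [Set.singleton_subset_iff]
    refine ⟨σ, h, (tendsto_leading_self hg).congr' ?_⟩
    filter_upwards [nhdsWithin_le_nhds hσ] with t ht
    rw [ht]

theorem exists_separated_of_multiplicity_eq_two (C : Fin n → SigmaCurve)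
    (hC : ∀ i, (C i).multiplicity = 2) (hT : ∀ i j, i ≠ j → (C i).tangentCone ≠ (C j).tangentCone) :
    ∃ (g : Fin n → ℂ → ℂ × ℂ) (σ : Fin n → ParamCurve), IsSeparated g ∧
      (∀ i, (⟦σ i⟧ : Quotient sigmaSetoid) = C i) ∧
      (∀ i, ∀ᶠ t in 𝓝 (0 : ℂ), (σ i).toFun t = t ^ 2 • g i t) ∧
      ∀ i, (C i).tangentCone = Submodule.span ℂ {g i 0} := by
  choose σ hσ using fun i => Quotient.exists_rep (C i)
  have hm : ∀ i, SigmaCurve.multiplicity (⟦σ i⟧ : Quotient sigmaSetoid) = 2 := fun i => by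
    rw [hσ]; exact hC i
  choose g hg hg0 hgσ using fun i => (σ i).exists_leading (hm i)
  have hcone : ∀ i, (C i).tangentCone = Submodule.span ℂ {g i 0} := fun i =>
    SigmaCurve.tangentCone_eq (hC i) (hσ i) (hg i) (hgσ i)
  refine ⟨g, σ, ⟨hg, hg0, fun i j hij h0 => hT i j hij ?_⟩, hσ, hgσ, hcone⟩
  rw [hcone, hcone]
  exact span_singleton_eq_of_wedge_eq_zero (hg0 i) (hg0 j) h0

theorem DiffGerm.exists_of_equiv {E : Type*} [NormedAddCommGroup E] [NormedSpace ℂ E]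
    [CompleteSpace E] (A : E ≃L[ℂ] E) : ∃ φ : DiffGerm E, φ.toFun = A :=
  DiffGerm.exists_of_fderiv ((A : E →L[ℂ] E).analyticAt 0) (map_zero A) A A.hasFDerivAt

variable {g : Fin n → ℂ → ℂ × ℂ}

/-- Only finitely many linear forms z₁ + c z₂ vanish on some g_i(0). Two others, with distinct c and
d, serve as target coordinates in which all g_i(0) have non-zero entries. -/
theorem IsSeparated.isAConjugateToGeneric (hg : IsSeparated g) :
    IsAConjugateToGeneric (separatedMap g) := by
  classical
  -- When the second coordinate is 0 the quotient is 0 by convention. This merely excludes one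
  -- superfluous value, since the form is then non-zero on g_i(0) for every c.
  let S : Finset ℂ := Finset.univ.image fun i => -((g i 0).1 / (g i 0).2)
  have hS : ∀ c, c ∉ S → ∀ i, (g i 0).1 + (g i 0).2 * c ≠ 0 := by
    intro c hc i h
    by_cases h2 : (g i 0).2 = 0
    · rw [h2, zero_mul, add_zero] at h
      exact hg.ne_zero i (Prod.ext h h2)
    · refine hc (Finset.mem_image.2 ⟨i, Finset.mem_univ i, ?_⟩)
      field_simp
      linear_combination -h
  obtain ⟨c, hc⟩ := Infinite.exists_notMem_finset S
  obtain ⟨d, hd⟩ := Infinite.exists_notMem_finset (insert c S)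
  rw [Finset.mem_insert, not_or] at hd
  have hw : wedge (1, 1) (c, d) ≠ 0 := by
    simp only [wedge, one_mul]
    exact sub_ne_zero.2 hd.1
  obtain ⟨ψ, hψ⟩ := DiffGerm.exists_of_equiv (basisEquiv (1, 1) (c, d) hw)
  set B := basisEquiv (1, 1) (c, d) hw
  have hB : ∀ z : ℂ × ℂ, B z = (z.1 + z.2 * c, z.1 + z.2 * d) := fun z => by
    rw [basisEquiv_apply]; simp
  have hB' : IsSeparated fun i t => B (g i t) := by
    refine ⟨fun i => AnalyticAt.fun_comp (g := B) ((B : ℂ × ℂ →L[ℂ] ℂ × ℂ).analyticAt _)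
      (hg.analytic i), fun i => by simpa using hg.ne_zero i, fun i j hij => ?_⟩
    have h1 := wedge_map (B : ℂ × ℂ →L[ℂ] ℂ × ℂ) (g i 0) (g j 0)
    refine h1.trans_ne (mul_ne_zero ?_ (hg.wedge_ne_zero i j hij))
    simpa [hB] using hw
  refine ⟨_, hB'.isAGeneric (fun i => ?_) (fun i => ?_), DiffGerm.refl _, ψ.symm, ?_⟩
  · rw [hB]; exact hS c hc i
  · rw [hB]; exact hS d hd.2 i
  · have ht : Tendsto (separatedMap g) (𝓝 0) (𝓝 0) := by
      simpa [separatedMap_zero] using (analyticAt_separatedMap hg.analytic).continuousAt.tendsto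
    filter_upwards [ht.eventually ψ.left_inv] with x hx
    change ψ.invFun (separatedMap (fun i t => B (g i t)) x) = _
    rw [hψ] at hx
    rw [← hx]
    refine congrArg ψ.invFun ?_
    simp only [separatedMap, map_sum, map_smul]

end Main

end

theorem mainTheorem5 (n : ℕ) (hn : 1 ≤ n) :
    (∀ Φ : (Fin n → ℂ) → ℂ × ℂ, IsAConjugateToGeneric Φ →
      ∃ C : Fin n → SigmaCurve, HasTangencySigmaCurves Φ C) ∧
    (∀ Φ₁ Φ₂ : (Fin n → ℂ) → ℂ × ℂ, IsAGeneric Φ₁ → IsAGeneric Φ₂ →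
      (AConjugate Φ₁ Φ₂ ↔ ∃ ψ : DiffGerm (ℂ × ℂ),
        SigmaCurve.map ψ '' tangencySigmaCurves Φ₁ = tangencySigmaCurves Φ₂)) ∧
    (∀ Φ₁ Φ₂ : (Fin n → ℂ) → ℂ × ℂ, IsAConjugateToGeneric Φ₁ → IsAConjugateToGeneric Φ₂ →
      (AConjugate Φ₁ Φ₂ ↔ ∃ ψ : DiffGerm (ℂ × ℂ),
        SigmaCurve.map ψ '' tangencySigmaCurves Φ₁ = tangencySigmaCurves Φ₂)) ∧
    (∀ C : Fin n → SigmaCurve, (∀ i, (C i).multiplicity = 2) →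
      (∀ i j, i ≠ j → (C i).tangentCone ≠ (C j).tangentCone) →
      (∃ Φ : (Fin n → ℂ) → ℂ × ℂ, IsAConjugateToGeneric Φ ∧ HasTangencySigmaCurves Φ C) ∧
      ((∀ i, (C i).tangentCone ≠ Submodule.span ℂ {((1 : ℂ), (0 : ℂ))} ∧
          (C i).tangentCone ≠ Submodule.span ℂ {((0 : ℂ), (1 : ℂ))}) →
        ∃ Φ : (Fin n → ℂ) → ℂ × ℂ, IsAGeneric Φ ∧ HasTangencySigmaCurves Φ C)) := by
  refine ⟨fun Φ h => ?_, fun Φ₁ Φ₂ h₁ h₂ => h₁.isAConjugateToGeneric.aConjugate_iff hn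
    h₂.isAConjugateToGeneric, fun Φ₁ Φ₂ h₁ h₂ => h₁.aConjugate_iff hn h₂, fun C hC hT => ?_⟩
  · obtain ⟨χ, g, hg, -, h⟩ := h.exists_separated_curves hn
    exact ⟨_, h⟩
  · obtain ⟨g, σ, hg, hσ, hgσ, hcone⟩ := exists_separated_of_multiplicity_eq_two C hC hT
    have hΦ : HasTangencySigmaCurves (separatedMap g) C := by
      have h := hg.hasTangencySigmaCurves hn σ hgσ
      rwa [funext hσ] at h
    refine ⟨⟨_, hg.isAConjugateToGeneric, hΦ⟩,
      fun haxes => ⟨_, hg.isAGeneric (fun i h0 => ?_) (fun i h0 => ?_), hΦ⟩⟩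
    · refine (haxes i).2 ?_
      rw [hcone]
      exact span_singleton_eq_of_wedge_eq_zero (hg.ne_zero i) (by simp) (by simp [wedge, h0])
    · refine (haxes i).1 ?_
      rw [hcone]
      exact span_singleton_eq_of_wedge_eq_zero (hg.ne_zero i) (by simp) (by simp [wedge, h0])
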